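/- Let $K$ be a commutative ring with unit. A $K$-linear 2-category is a strict 2-category $\mathfrak C$ whose hom-categories are $K$-linear and whose composition is $K$-bilinear on 2-morphisms. A \emph{$K$-linear Gray semigroup} $(\mathfrak C,\otimes)$ is a $K$-linear 2-category with a semigroupal structure $(\otimes,a,\pi)$, i.e. a tensor product pseudofunctor $\otimes$ on $\mathfrak C\times\mathfrak C$ (with structural 2-isomorphisms $\widehat\otimes((f',g'),(f,g)):(f'\otimes g')\circ(f\otimes g)\Rightarrow(f'\circ f)\otimes(g'\circ g)$ and $\otimes_0(X,Y):id_X\otimes id_Y\Rightarrow id_{X\otimes Y}$), a pseudonatural isomorphism $a_{X,Y,Z}:X\otimes(Y\otimes Z)\to(X\otimes Y)\otimes Z$ (with structural 2-isomorphisms $\widehat a(f,g,h)$), and an invertible modification $\pi$ (the pentagonator, filling Mac Lane's pentagon) satisfying the Stasheff $K_5$ relation, such that $\otimes$ is $K$-bilinear on 2-morphisms, all $\otimes_0(X,Y)$, $a_{X,Y,Z}$, $\widehat a(f,g,h)$, $\pi_{X,Y,Z,T}$ are identities, and $\otimes$ is cubical, i.e. $\widehat\otimes((f',id),(f,g))$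 and $\widehat\otimes((f,g'),(id,g))$ are identities. \textbf{Deformations.} Let $\mathfrak C_{(1)}$ be the extension of scalars of $\mathfrak C$ along $K\to K[\epsilon]/(\epsilon^2)$: same objects and 1-morphisms, and 2-morphisms $\tau_0+\tau_1\epsilon$ with $\tau_0,\tau_1$ parallel 2-morphisms of $\mathfrak C$. A \emph{first order unitary deformation} of $(\mathfrak C,\otimes)$ is a semigroupal structure on $\mathfrak C_{(1)}$ with the same underlying functors $\otimes$ and the same 1-morphisms $a_{X,Y,Z}$, whose structural 2-isomorphisms are $\widehat\otimes_\epsilon=\widehat\otimes+\widehat\otimes^{(1)}\epsilon$, $\widehat a_\epsilon=1+\widehat a^{(1)}\epsilon$, $\pi_\epsilon=1+\pi^{(1)}\epsilon$ and $(\otimes_0)_\epsilon=1$. Two of them are \emph{equivalent} if the identity 2-functor of $\mathfrak C_{(1)}$ admits a semigroupal structure $(\psi,\omega)$ from the first to the second with $\psi_{X,Y}=id_{X\otimes Y}$, $\widehat\psi(f,g)\equiv1_{f\otimes g}$ and $\omega_{X,Y,Z}\equiv 1_{id_{X\otimes Y\otimes Z}}$ modulo $\epsilon$. \textbf{The complex.}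 Let $\otimes(n):\mathfrak C^n\to\mathfrak C$ be the iterated tensor product pseudofunctor. For $m,n\ge0$ let $X^{m,n}$ be the $K$-module of families of 2-morphisms $\phi$ that assign to each chain of $m+1$ composable 1-morphisms $f_i=(f_i^0,\dots,f_i^n)$ ($0\le i\le m$, $f_m$ applied first) of $\mathfrak C^{n+1}$ a 2-morphism $$\phi(f_0,\dots,f_m):(f_0^0\otimes\cdots\otimes f_0^n)\circ\cdots\circ(f_m^0\otimes\cdots\otimes f_m^n)\Rightarrow(f_0^0\circ\cdots\circ f_m^0)\otimes\cdots\otimes(f_0^n\circ\cdots\circ f_m^n),$$ natural in the $f_i$. It is \emph{special} if $\phi(f_0,\dots,f_m)=0$ whenever some $f_i$ is an identity. Writing $\lceil-\rceil$ for the composition with the canonical 2-isomorphisms built from $\widehat\otimes$ that is needed to get the right source and target, $F=\otimes(n+1)$, and $|f^j|=f_0^j\circ\cdots\circ f_m^j$, put $$(\delta_h\phi)(f_0,\dots,f_{m+1})=\lceil1_{F(f_0)}\circ\phi(f_1,\dots,f_{m+1})\rceil+\sum_{i=1}^{m+1}(-1)^i\lceil\phi(f_0,\dots,f_{i-1}\circ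 f_i,\dots,f_{m+1})\rceil+(-1)^{m+2}\lceil\phi(f_0,\dots,f_m)\circ1_{F(f_{m+1})}\rceil,$$ $$(\delta_v\phi)(f^0,\dots,f^{n+1})=\lceil1_{|f^0|}\otimes\phi(f^1,\dots,f^{n+1})\rceil+\sum_{i=1}^{n+1}(-1)^i\lceil\phi(f^0,\dots,f^{i-1}\otimes f^i,\dots,f^{n+1})\rceil+(-1)^{n+2}\lceil\phi(f^0,\dots,f^n)\otimes1_{|f^{n+1}|}\rceil,$$ where $f^j=(f_0^j,\dots,f_m^j)$ and $\otimes$ of columns is taken entrywise. Let $\widetilde X^{n}_{pent}$ be the $K$-module of all families of 2-morphisms $\mathfrak n_{X_0,\dots,X_n}:id_{X_0\otimes\cdots\otimes X_n}\Rightarrow id_{X_0\otimes\cdots\otimes X_n}$, with $$(\delta_{pent}\mathfrak n)_{X_0,\dots,X_{n+1}}=1_{id_{X_0}}\otimes\mathfrak n_{X_1,\dots,X_{n+1}}+\sum_{i=1}^{n+1}(-1)^i\mathfrak n_{X_0,\dots,X_{i-1}\otimes X_i,\dots,X_{n+1}}+(-1)^{n+2}\mathfrak n_{X_0,\dots,X_n}\otimes1_{id_{X_{n+1}}},$$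 and let $\varphi:\widetilde X^n_{pent}\to X^{0,n}$ be given, for $f=(f^0,\dots,f^n):(X_0,\dots,X_n)\to(X_0',\dots,X_n')$, by $\varphi(\mathfrak n)(f)=\mathfrak n_{X'_0,\dots,X'_n}\circ1_{f^0\otimes\cdots\otimes f^n}-1_{f^0\otimes\cdots\otimes f^n}\circ\mathfrak n_{X_0,\dots,X_n}$. Put $X^{0,n}_{mod}=X^{0,n}\oplus\widetilde X^{n+1}_{pent}$ and $X^{m,n}_{mod}=X^{m,n}$ for $m\ge1$. On the first column let $\delta'_v(\phi,\mathfrak n)=(\delta_v\phi+\varphi(\mathfrak n),-\delta_{pent}\mathfrak n)$ and $\delta'_h(\phi,\mathfrak n)=\delta_h\phi$; elsewhere $\delta'_v=\delta_v$, $\delta'_h=\delta_h$. Let $X^{m,n}_{mod,s}$ be the submodule of elements whose component in $X^{m,n}$ is special. The unitary deformation complex is $X^q_{unit}=\bigoplus_{m+n=q,\,m\ge0,\,n\ge1}X^{m,n}_{mod,s}$ for $q\ge1$, with coboundary $\delta_{unit}=(-1)^n\delta'_h+\delta'_v$ on $X^{m,n}_{mod,s}$, and $H^2_{unit}(\mathfrak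 C)$ is its cohomology module in degree $2$ (cocycles in $X^2_{unit}$ modulo $\delta_{unit}(X^1_{unit})$). \textbf{Theorem.} Let $(\mathfrak C,\otimes)$ be a $K$-linear Gray semigroup. Equivalence of first order unitary deformations is an equivalence relation, $\delta_{unit}(X^1_{unit})$ consists of $2$-cocycles of $X^\bullet_{unit}$, and the equivalence classes of first order unitary deformations of $(\mathfrak C,\otimes)$ are in bijection with the elements of $H^2_{unit}(\mathfrak C)$; the bijection sends the class of the deformation with first order terms $(\widehat\otimes^{(1)},\widehat a^{(1)},\pi^{(1)})$ to the class of the $2$-cocycle $((\widehat a^{(1)},\pi^{(1)}),\widehat\otimes^{(1)})\in X^{0,2}_{mod,s}\oplus X^{1,1}_{mod,s}$. -/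

import Mathlib

open CategoryTheory Bicategory

universe w v u uK

namespace GrayDeformation

section LinearTwoCategories

/-- The composition functors of a 2-category whose hom-categories are `K`-linear are `K`-bilinear
on 2-morphisms. -/
class LinearComposition (K : Type uK) [CommRing K] (C : Type u) [Bicategory.{w, v} C]
    [∀ X Y : C, Preadditive (X ⟶ Y)] [∀ X Y : C, Linear K (X ⟶ Y)] : Prop where
  whiskerLeft_add {X Y Z : C} (f : X ⟶ Y) {g h : Y ⟶ Z} (η θ : g ⟶ h) :
    f ◁ (η + θ) = f ◁ η + f ◁ θ
  add_whiskerRight {X Y Z : C} {f g : X ⟶ Y} (η θ : f ⟶ g) (h : Y ⟶ Z) :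
    (η + θ) ▷ h = η ▷ h + θ ▷ h
  whiskerLeft_smul {X Y Z : C} (f : X ⟶ Y) {g h : Y ⟶ Z} (r : K) (η : g ⟶ h) :
    f ◁ (r • η) = r • (f ◁ η)
  smul_whiskerRight {X Y Z : C} {f g : X ⟶ Y} (r : K) (η : f ⟶ g) (h : Y ⟶ Z) :
    (r • η) ▷ h = r • (η ▷ h)

/-- Horizontal composite of two 2-morphisms. -/
def hcomp {C : Type u} [Bicategory.{w, v} C] {X Y Z : C} {f f' : X ⟶ Y} {g g' : Y ⟶ Z}
    (η : f ⟶ f') (θ : g ⟶ g') : f ≫ g ⟶ f' ≫ g' :=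
  η ▷ g ≫ f' ◁ θ

/-- A 2-morphism is an identity: its source and target coincide and it is the identity of them. -/
def IsIdentityTwo {C : Type u} [Bicategory.{w, v} C] {X Y : C} {f g : X ⟶ Y} (η : f ⟶ g) : Prop :=
  ∃ h : f = g, η = eqToHom h

/-- A 1-morphism is an identity. -/
def IsIdentityOne {C : Type u} [Bicategory.{w, v} C] {X Y : C} (f : X ⟶ Y) : Prop :=
  X = Y ∧ HEq f (𝟙 X)

end LinearTwoCategories

section Semigroupal

/-- The object map of a tensor product `C × C → C`, together with the functors
`C(X, X') × C(Y, Y') ⥤ C(X ⊗ Y, X' ⊗ Y')`. -/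
structure TensorFunctor (C : Type u) [Bicategory.{w, v} C] where
  obj : C → C → C
  map {X X' Y Y' : C} : (X ⟶ X') → (Y ⟶ Y') → (obj X Y ⟶ obj X' Y')
  map₂ {X X' Y Y' : C} {f f' : X ⟶ X'} {g g' : Y ⟶ Y'} :
    (f ⟶ f') → (g ⟶ g') → (map f g ⟶ map f' g')
  map₂_id {X X' Y Y' : C} (f : X ⟶ X') (g : Y ⟶ Y') : map₂ (𝟙 f) (𝟙 g) = 𝟙 (map f g)
  map₂_comp {X X' Y Y' : C} {f f' f'' : X ⟶ X'} {g g' g'' : Y ⟶ Y'}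
    (τ : f ⟶ f') (τ' : f' ⟶ f'') (σ : g ⟶ g') (σ' : g' ⟶ g'') :
    map₂ (τ ≫ τ') (σ ≫ σ') = map₂ τ σ ≫ map₂ τ' σ'

/-- The tensor product of 2-morphisms is `K`-bilinear. -/
class TensorFunctor.IsBilinear (K : Type uK) [CommRing K] {C : Type u} [Bicategory.{w, v} C]
    [∀ X Y : C, Preadditive (X ⟶ Y)] [∀ X Y : C, Linear K (X ⟶ Y)]
    (T : TensorFunctor C) : Prop where
  add_left {X X' Y Y' : C} {f f' : X ⟶ X'} {g g' : Y ⟶ Y'} (τ τ' : f ⟶ f') (σ : g ⟶ g') :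
    T.map₂ (τ + τ') σ = T.map₂ τ σ + T.map₂ τ' σ
  add_right {X X' Y Y' : C} {f f' : X ⟶ X'} {g g' : Y ⟶ Y'} (τ : f ⟶ f') (σ σ' : g ⟶ g') :
    T.map₂ τ (σ + σ') = T.map₂ τ σ + T.map₂ τ σ'
  smul_left {X X' Y Y' : C} {f f' : X ⟶ X'} {g g' : Y ⟶ Y'} (r : K) (τ : f ⟶ f') (σ : g ⟶ g') :
    T.map₂ (r • τ) σ = r • T.map₂ τ σ
  smul_right {X X' Y Y' : C} {f f' : X ⟶ X'} {g g' : Y ⟶ Y'} (r : K) (τ : f ⟶ f') (σ : g ⟶ g') :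
    T.map₂ τ (r • σ) = r • T.map₂ τ σ

variable {C : Type u} [Bicategory.{w, v} C]

/-- The 1-isomorphisms `a_{X,Y,Z} : X ⊗ (Y ⊗ Z) ⟶ (X ⊗ Y) ⊗ Z` of an associator. -/
structure AssociatorCells (T : TensorFunctor C) where
  a (X Y Z : C) : T.obj X (T.obj Y Z) ⟶ T.obj (T.obj X Y) Z
  aInv (X Y Z : C) : T.obj (T.obj X Y) Z ⟶ T.obj X (T.obj Y Z)
  a_aInv (X Y Z : C) : a X Y Z ≫ aInv X Y Z = 𝟙 _
  aInv_a (X Y Z : C) : aInv X Y Z ≫ a X Y Z = 𝟙 _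

/-- The structural 2-isomorphisms of a semigroupal structure. In the usual applicative order
`tensorComp f g f' g'` is `⊗̂((f',g'),(f,g)) : (f' ⊗ g') ∘ (f ⊗ g) ⟹ (f' ∘ f) ⊗ (g' ∘ g)`. -/
structure SemigroupalData (T : TensorFunctor C) (A : AssociatorCells T) where
  tensorComp {X X' X'' Y Y' Y'' : C} (f : X ⟶ X') (g : Y ⟶ Y') (f' : X' ⟶ X'') (g' : Y' ⟶ Y'') :
    T.map f g ≫ T.map f' g' ≅ T.map (f ≫ f') (g ≫ g')
  tensorId (X Y : C) : T.map (𝟙 X) (𝟙 Y) ≅ 𝟙 (T.obj X Y)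
  assoc {X X' Y Y' Z Z' : C} (f : X ⟶ X') (g : Y ⟶ Y') (h : Z ⟶ Z') :
    A.a X Y Z ≫ T.map (T.map f g) h ≅ T.map f (T.map g h) ≫ A.a X' Y' Z'
  pent (X Y Z W : C) :
    T.map (𝟙 X) (A.a Y Z W) ≫ A.a X (T.obj Y Z) W ≫ T.map (A.a X Y Z) (𝟙 W) ≅
      A.a X Y (T.obj Z W) ≫ A.a (T.obj X Y) Z W

namespace SemigroupalData

variable {T : TensorFunctor C} {A : AssociatorCells T} (D : SemigroupalData T A)

/-- `⊗̂` for three composable pairs. -/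
def tensorComp₃ {X₀ X₁ X₂ X₃ Y₀ Y₁ Y₂ Y₃ : C} (f₁ : X₀ ⟶ X₁) (g₁ : Y₀ ⟶ Y₁) (f₂ : X₁ ⟶ X₂)
    (g₂ : Y₁ ⟶ Y₂) (f₃ : X₂ ⟶ X₃) (g₃ : Y₂ ⟶ Y₃) :
    T.map f₁ g₁ ≫ T.map f₂ g₂ ≫ T.map f₃ g₃ ≅ T.map (f₁ ≫ f₂ ≫ f₃) (g₁ ≫ g₂ ≫ g₃) :=
  whiskerLeftIso (T.map f₁ g₁) (D.tensorComp f₂ g₂ f₃ g₃) ≪≫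
    D.tensorComp f₁ g₁ (f₂ ≫ f₃) (g₂ ≫ g₃)

/-- The pasting of `τ ⊗ σ` with instances of `⊗̂`, for 2-morphisms between composites of two
1-morphisms. -/
def paste₂₂ {X X' X'' V' Y Y' Y'' W' : C}
    {f : X ⟶ X'} {f' : X' ⟶ X''} {p : X ⟶ V'} {p' : V' ⟶ X''}
    {g : Y ⟶ Y'} {g' : Y' ⟶ Y''} {q : Y ⟶ W'} {q' : W' ⟶ Y''}
    (τ : f ≫ f' ⟶ p ≫ p') (σ : g ≫ g' ⟶ q ≫ q') :
    T.map f g ≫ T.map f' g' ⟶ T.map p q ≫ T.map p' q' :=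
  (D.tensorComp f g f' g').hom ≫ T.map₂ τ σ ≫ (D.tensorComp p q p' q').inv

/-- The same pasting, from composites of three to composites of two 1-morphisms. -/
def paste₃₂ {X₀ X₁ X₂ X₃ Y₀ Y₁ Y₂ Y₃ V W : C}
    {f₁ : X₀ ⟶ X₁} {f₂ : X₁ ⟶ X₂} {f₃ : X₂ ⟶ X₃} {p : X₀ ⟶ V} {p' : V ⟶ X₃}
    {g₁ : Y₀ ⟶ Y₁} {g₂ : Y₁ ⟶ Y₂} {g₃ : Y₂ ⟶ Y₃} {q : Y₀ ⟶ W} {q' : W ⟶ Y₃}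
    (τ : f₁ ≫ f₂ ≫ f₃ ⟶ p ≫ p') (σ : g₁ ≫ g₂ ≫ g₃ ⟶ q ≫ q') :
    T.map f₁ g₁ ≫ T.map f₂ g₂ ≫ T.map f₃ g₃ ⟶ T.map p q ≫ T.map p' q' :=
  (D.tensorComp₃ f₁ g₁ f₂ g₂ f₃ g₃).hom ≫ T.map₂ τ σ ≫ (D.tensorComp p q p' q').inv

/-- The same pasting, between composites of three 1-morphisms. -/
def paste₃₃ {X₀ X₁ X₂ X₃ Y₀ Y₁ Y₂ Y₃ V₁ V₂ W₁ W₂ : C}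
    {f₁ : X₀ ⟶ X₁} {f₂ : X₁ ⟶ X₂} {f₃ : X₂ ⟶ X₃} {p₁ : X₀ ⟶ V₁} {p₂ : V₁ ⟶ V₂} {p₃ : V₂ ⟶ X₃}
    {g₁ : Y₀ ⟶ Y₁} {g₂ : Y₁ ⟶ Y₂} {g₃ : Y₂ ⟶ Y₃} {q₁ : Y₀ ⟶ W₁} {q₂ : W₁ ⟶ W₂} {q₃ : W₂ ⟶ Y₃}
    (τ : f₁ ≫ f₂ ≫ f₃ ⟶ p₁ ≫ p₂ ≫ p₃) (σ : g₁ ≫ g₂ ≫ g₃ ⟶ q₁ ≫ q₂ ≫ q₃) :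
    T.map f₁ g₁ ≫ T.map f₂ g₂ ≫ T.map f₃ g₃ ⟶ T.map p₁ q₁ ≫ T.map p₂ q₂ ≫ T.map p₃ q₃ :=
  (D.tensorComp₃ f₁ g₁ f₂ g₂ f₃ g₃).hom ≫ T.map₂ τ σ ≫ (D.tensorComp₃ p₁ q₁ p₂ q₂ p₃ q₃).inv

end SemigroupalData

/-- A semigroupal structure `(⊗, a, π)` whose underlying functors and 1-isomorphisms are `T` and
`A`: `⊗` is a pseudofunctor, `a` is a pseudonatural isomorphism, `π` is an invertible modification,
and `π` satisfies the Stasheff `K₅` relation. The operation `⊗≫` is vertical composition,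
preceded by the (identity) constraint 2-cells of the composition of 1-morphisms. -/
structure SemigroupalStructure (T : TensorFunctor C) (A : AssociatorCells T) extends
    SemigroupalData T A where
  /- `⊗` is a pseudofunctor. -/
  tensorComp_naturality {X X' X'' Y Y' Y'' : C} {f₁ f₂ : X ⟶ X'} {g₁ g₂ : Y ⟶ Y'}
    {f₁' f₂' : X' ⟶ X''} {g₁' g₂' : Y' ⟶ Y''}
    (τ : f₁ ⟶ f₂) (σ : g₁ ⟶ g₂) (τ' : f₁' ⟶ f₂') (σ' : g₁' ⟶ g₂') :
    (tensorComp f₁ g₁ f₁' g₁').hom ≫ T.map₂ (hcomp τ τ') (hcomp σ σ') =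
      hcomp (T.map₂ τ σ) (T.map₂ τ' σ') ≫ (tensorComp f₂ g₂ f₂' g₂').hom
  tensorComp_assoc {X X' X'' X''' Y Y' Y'' Y''' : C} (f : X ⟶ X') (g : Y ⟶ Y')
    (f' : X' ⟶ X'') (g' : Y' ⟶ Y'') (f'' : X'' ⟶ X''') (g'' : Y'' ⟶ Y''') :
    (tensorComp f g f' g').hom ▷ T.map f'' g'' ≫ (tensorComp (f ≫ f') (g ≫ g') f'' g'').hom ≫
        T.map₂ (α_ f f' f'').hom (α_ g g' g'').hom =
      (α_ _ _ _).hom ≫ T.map f g ◁ (tensorComp f' g' f'' g'').hom ≫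
        (tensorComp f g (f' ≫ f'') (g' ≫ g'')).hom
  tensorComp_id {X X' Y Y' : C} (f : X ⟶ X') (g : Y ⟶ Y') :
    (tensorComp f g (𝟙 X') (𝟙 Y')).hom ≫ T.map₂ (ρ_ f).hom (ρ_ g).hom =
      T.map f g ◁ (tensorId X' Y').hom ≫ (ρ_ _).hom
  id_tensorComp {X X' Y Y' : C} (f : X ⟶ X') (g : Y ⟶ Y') :
    (tensorComp (𝟙 X) (𝟙 Y) f g).hom ≫ T.map₂ (λ_ f).hom (λ_ g).hom =
      (tensorId X Y).hom ▷ T.map f g ≫ (λ_ _).hom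
  /- `a` is a pseudonatural transformation. -/
  assoc_naturality {X X' Y Y' Z Z' : C} {f₁ f₂ : X ⟶ X'} {g₁ g₂ : Y ⟶ Y'} {h₁ h₂ : Z ⟶ Z'}
    (τ : f₁ ⟶ f₂) (σ : g₁ ⟶ g₂) (η : h₁ ⟶ h₂) :
    (assoc f₁ g₁ h₁).hom ≫ T.map₂ τ (T.map₂ σ η) ▷ A.a X' Y' Z' =
      A.a X Y Z ◁ T.map₂ (T.map₂ τ σ) η ≫ (assoc f₂ g₂ h₂).hom
  assoc_comp {X X' X'' Y Y' Y'' Z Z' Z'' : C} (f : X ⟶ X') (g : Y ⟶ Y') (h : Z ⟶ Z')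
    (f' : X' ⟶ X'') (g' : Y' ⟶ Y'') (h' : Z' ⟶ Z'') :
    A.a X Y Z ◁ ((tensorComp (T.map f g) h (T.map f' g') h').hom ≫
          T.map₂ (tensorComp f g f' g').hom (𝟙 (h ≫ h'))) ≫
        (assoc (f ≫ f') (g ≫ g') (h ≫ h')).hom =
      𝟙 _ ⊗≫ (assoc f g h).hom ▷ T.map (T.map f' g') h' ⊗≫
        T.map f (T.map g h) ◁ (assoc f' g' h').hom ⊗≫
        ((tensorComp f (T.map g h) f' (T.map g' h')).hom ≫
          T.map₂ (𝟙 (f ≫ f')) (tensorComp g h g' h').hom) ▷ A.a X'' Y'' Z''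
  assoc_id (X Y Z : C) :
    (assoc (𝟙 X) (𝟙 Y) (𝟙 Z)).hom ≫
        (T.map₂ (𝟙 (𝟙 X)) (tensorId Y Z).hom ≫ (tensorId X (T.obj Y Z)).hom) ▷ A.a X Y Z ≫
        (λ_ _).hom =
      A.a X Y Z ◁ (T.map₂ (tensorId X Y).hom (𝟙 (𝟙 Z)) ≫ (tensorId (T.obj X Y) Z).hom) ≫
        (ρ_ _).hom
  /- `π` is a modification. -/
  pent_naturality {X X' Y Y' Z Z' W W' : C}
    (f : X ⟶ X') (g : Y ⟶ Y') (h : Z ⟶ Z') (k : W ⟶ W') :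
    (pent X Y Z W).hom ▷ T.map (T.map (T.map f g) h) k ⊗≫
        A.a X Y (T.obj Z W) ◁ (assoc (T.map f g) h k).hom ⊗≫
        (assoc f g (T.map h k)).hom ▷ A.a (T.obj X' Y') Z' W' ⊗≫ 𝟙 _ =
      𝟙 _ ⊗≫
        T.map (𝟙 X) (A.a Y Z W) ◁ A.a X (T.obj Y Z) W ◁
          toSemigroupalData.paste₂₂ (assoc f g h).hom ((λ_ k).hom ≫ (ρ_ k).inv) ⊗≫
        T.map (𝟙 X) (A.a Y Z W) ◁ (assoc f (T.map g h) k).hom ▷ T.map (A.a X' Y' Z') (𝟙 W') ⊗≫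
        toSemigroupalData.paste₂₂ ((λ_ f).hom ≫ (ρ_ f).inv) (assoc g h k).hom ▷
          (A.a X' (T.obj Y' Z') W' ≫ T.map (A.a X' Y' Z') (𝟙 W')) ⊗≫
        T.map f (T.map g (T.map h k)) ◁ (pent X' Y' Z' W').hom
  /- The `K₅` relation. -/
  pent_K₅ (X Y Z V U : C) :
    𝟙 (T.map (𝟙 X) (T.map (𝟙 Y) (A.a Z V U)) ≫ T.map (𝟙 X) (A.a Y (T.obj Z V) U) ≫
        A.a X (T.obj Y (T.obj Z V)) U ≫ T.map (T.map (𝟙 X) (A.a Y Z V)) (𝟙 U) ≫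
        T.map (A.a X (T.obj Y Z) V) (𝟙 U) ≫ T.map (T.map (A.a X Y Z) (𝟙 V)) (𝟙 U)) ⊗≫
      (T.map (𝟙 X) (T.map (𝟙 Y) (A.a Z V U)) ≫ T.map (𝟙 X) (A.a Y (T.obj Z V) U) ≫
        A.a X (T.obj Y (T.obj Z V)) U) ◁
          toSemigroupalData.paste₃₂ (pent X Y Z V).hom (𝟙 U ◁ (λ_ (𝟙 U)).hom) ⊗≫
      T.map (𝟙 X) (T.map (𝟙 Y) (A.a Z V U)) ◁ (pent X Y (T.obj Z V) U).hom ▷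
          T.map (A.a (T.obj X Y) Z V) (𝟙 U) ⊗≫
      (assoc (𝟙 X) (𝟙 Y) (A.a Z V U)).inv ▷
          (A.a (T.obj X Y) (T.obj Z V) U ≫ T.map (A.a (T.obj X Y) Z V) (𝟙 U)) ⊗≫
      A.a X Y (T.obj Z (T.obj V U)) ◁ T.map₂ (tensorId X Y).hom (𝟙 (A.a Z V U)) ▷
          (A.a (T.obj X Y) (T.obj Z V) U ≫ T.map (A.a (T.obj X Y) Z V) (𝟙 U)) ⊗≫
      A.a X Y (T.obj Z (T.obj V U)) ◁ (pent (T.obj X Y) Z V U).hom ⊗≫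
      𝟙 (A.a X Y (T.obj Z (T.obj V U)) ≫ A.a (T.obj X Y) Z (T.obj V U) ≫
        A.a (T.obj (T.obj X Y) Z) V U) =
    𝟙 _ ⊗≫
      (T.map (𝟙 X) (T.map (𝟙 Y) (A.a Z V U)) ≫ T.map (𝟙 X) (A.a Y (T.obj Z V) U)) ◁
          (assoc (𝟙 X) (A.a Y Z V) (𝟙 U)).hom ▷
          (T.map (A.a X (T.obj Y Z) V) (𝟙 U) ≫ T.map (T.map (A.a X Y Z) (𝟙 V)) (𝟙 U)) ⊗≫
      toSemigroupalData.paste₃₂ (𝟙 X ◁ (λ_ (𝟙 X)).hom) (pent Y Z V U).hom ▷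
          (A.a X (T.obj (T.obj Y Z) V) U ≫ T.map (A.a X (T.obj Y Z) V) (𝟙 U) ≫
            T.map (T.map (A.a X Y Z) (𝟙 V)) (𝟙 U)) ⊗≫
      T.map (𝟙 X) (A.a Y Z (T.obj V U)) ◁ (pent X (T.obj Y Z) V U).hom ▷
          T.map (T.map (A.a X Y Z) (𝟙 V)) (𝟙 U) ⊗≫
      (T.map (𝟙 X) (A.a Y Z (T.obj V U)) ≫ A.a X (T.obj Y Z) (T.obj V U)) ◁
          (assoc (A.a X Y Z) (𝟙 V) (𝟙 U)).hom ⊗≫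
      (T.map (𝟙 X) (A.a Y Z (T.obj V U)) ≫ A.a X (T.obj Y Z) (T.obj V U)) ◁
          T.map₂ (𝟙 (A.a X Y Z)) (tensorId V U).hom ▷ A.a (T.obj (T.obj X Y) Z) V U ⊗≫
      (pent X Y Z (T.obj V U)).hom ▷ A.a (T.obj (T.obj X Y) Z) V U ⊗≫
      𝟙 _

/-- The tensor product is cubical (in particular unitary) and the structural 1- and
2-isomorphisms of the associator and of the pentagonator are identities. -/
structure SemigroupalStructure.IsGray {T : TensorFunctor C} {A : AssociatorCells T}
    (S : SemigroupalStructure T A) : Prop where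
  tensorId (X Y : C) : IsIdentityTwo (S.tensorId X Y).hom
  tensorComp_left {X X' X'' Y Y' : C} (f : X ⟶ X') (g : Y ⟶ Y') (f' : X' ⟶ X'') :
    IsIdentityTwo (S.tensorComp f g f' (𝟙 Y')).hom
  tensorComp_right {X X' Y Y' Y'' : C} (f : X ⟶ X') (g : Y ⟶ Y') (g' : Y' ⟶ Y'') :
    IsIdentityTwo (S.tensorComp (𝟙 X) g f g').hom
  a (X Y Z : C) : IsIdentityOne (A.a X Y Z)
  assoc {X X' Y Y' Z Z' : C} (f : X ⟶ X') (g : Y ⟶ Y') (h : Z ⟶ Z') :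
    IsIdentityTwo (S.assoc f g h).hom
  pent (X Y Z W : C) : IsIdentityTwo (S.pent X Y Z W).hom

/-- A semigroupal structure `(ψ, ω)` on the identity 2-functor
`(C, ⊗, a, π) → (C, ⊗', a', π')`, with given 1-morphisms `ψ_{X,Y} : X ⊗' Y ⟶ X ⊗ Y`. -/
structure IdentitySemigroupalData {T T' : TensorFunctor C} {A : AssociatorCells T}
    {A' : AssociatorCells T'} (S : SemigroupalStructure T A) (S' : SemigroupalStructure T' A')
    (ψ : ∀ X Y : C, T'.obj X Y ⟶ T.obj X Y) where
  nat {X X' Y Y' : C} (f : X ⟶ X') (g : Y ⟶ Y') :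
    ψ X Y ≫ T.map f g ≅ T'.map f g ≫ ψ X' Y'
  omega (X Y Z : C) :
    T'.map (𝟙 X) (ψ Y Z) ≫ ψ X (T.obj Y Z) ≫ A.a X Y Z ≅
      A'.a X Y Z ≫ T'.map (ψ X Y) (𝟙 Z) ≫ ψ (T.obj X Y) Z

/-- The 2-isomorphism `χ_{X,Y,Z,W}`. -/
def IdentitySemigroupalData.chi {T T' : TensorFunctor C} {A : AssociatorCells T}
    {A' : AssociatorCells T'} {S : SemigroupalStructure T A} {S' : SemigroupalStructure T' A'}
    {ψ : ∀ X Y : C, T'.obj X Y ⟶ T.obj X Y} (P : IdentitySemigroupalData S S' ψ) (X Y Z W : C) :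
    T'.map (T'.map (𝟙 X) (𝟙 Y)) (ψ Z W) ≫ T'.map (ψ X Y) (𝟙 (T.obj Z W)) ⟶
      T'.map (ψ X Y) (T'.map (𝟙 Z) (𝟙 W)) ≫ T'.map (𝟙 (T.obj X Y)) (ψ Z W) :=
  S'.paste₂₂
    ((P.nat (𝟙 X) (𝟙 Y)).inv ≫ ψ X Y ◁ (S.tensorId X Y).hom)
    (ψ Z W ◁ (S.tensorId Z W).inv ≫ (P.nat (𝟙 Z) (𝟙 W)).hom)

/-- The axioms of a semigroupal structure on the identity 2-functor: `ψ` is a pseudonatural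
transformation, `ω` is a modification, and they satisfy the coherence relation relating `π` and
`π'`. -/
structure IdentitySemigroupalStructure {T T' : TensorFunctor C} {A : AssociatorCells T}
    {A' : AssociatorCells T'} (S : SemigroupalStructure T A) (S' : SemigroupalStructure T' A')
    (ψ : ∀ X Y : C, T'.obj X Y ⟶ T.obj X Y) extends IdentitySemigroupalData S S' ψ where
  nat_naturality {X X' Y Y' : C} {f₁ f₂ : X ⟶ X'} {g₁ g₂ : Y ⟶ Y'} (τ : f₁ ⟶ f₂) (σ : g₁ ⟶ g₂) :
    (nat f₁ g₁).hom ≫ T'.map₂ τ σ ▷ ψ X' Y' = ψ X Y ◁ T.map₂ τ σ ≫ (nat f₂ g₂).hom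
  nat_comp {X X' X'' Y Y' Y'' : C} (f : X ⟶ X') (g : Y ⟶ Y') (f' : X' ⟶ X'') (g' : Y' ⟶ Y'') :
    ψ X Y ◁ (S.tensorComp f g f' g').hom ≫ (nat (f ≫ f') (g ≫ g')).hom =
      𝟙 _ ⊗≫ (nat f g).hom ▷ T.map f' g' ⊗≫ T'.map f g ◁ (nat f' g').hom ⊗≫
        (S'.tensorComp f g f' g').hom ▷ ψ X'' Y''
  nat_id (X Y : C) :
    (nat (𝟙 X) (𝟙 Y)).hom ≫ (S'.tensorId X Y).hom ▷ ψ X Y ≫ (λ_ _).hom =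
      ψ X Y ◁ (S.tensorId X Y).hom ≫ (ρ_ _).hom
  omega_naturality {X X' Y Y' Z Z' : C} (f : X ⟶ X') (g : Y ⟶ Y') (h : Z ⟶ Z') :
    (omega X Y Z).hom ▷ T.map (T.map f g) h ⊗≫
        (A'.a X Y Z ≫ T'.map (ψ X Y) (𝟙 Z)) ◁ (nat (T.map f g) h).hom ⊗≫
        A'.a X Y Z ◁ S'.paste₂₂ (nat f g).hom ((λ_ h).hom ≫ (ρ_ h).inv) ▷
          ψ (T.obj X' Y') Z' ⊗≫
        (S'.assoc f g h).hom ▷ (T'.map (ψ X' Y') (𝟙 Z') ≫ ψ (T.obj X' Y') Z') ⊗≫ 𝟙 _ =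
      𝟙 _ ⊗≫
        (T'.map (𝟙 X) (ψ Y Z) ≫ ψ X (T.obj Y Z)) ◁ (S.assoc f g h).hom ⊗≫
        T'.map (𝟙 X) (ψ Y Z) ◁ (nat f (T.map g h)).hom ▷ A.a X' Y' Z' ⊗≫
        S'.paste₂₂ ((λ_ f).hom ≫ (ρ_ f).inv) (nat g h).hom ▷
          (ψ X' (T.obj Y' Z') ≫ A.a X' Y' Z') ⊗≫
        T'.map f (T'.map g h) ◁ (omega X' Y' Z').hom
  omega_coherence (X Y Z W : C) :
    𝟙 (T'.map (𝟙 X) (T'.map (𝟙 Y) (ψ Z W)) ≫ T'.map (𝟙 X) (ψ Y (T.obj Z W)) ≫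
        ψ X (T.obj Y (T.obj Z W)) ≫ T.map (𝟙 X) (A.a Y Z W) ≫ A.a X (T.obj Y Z) W ≫
        T.map (A.a X Y Z) (𝟙 W)) ⊗≫
      (T'.map (𝟙 X) (T'.map (𝟙 Y) (ψ Z W)) ≫ T'.map (𝟙 X) (ψ Y (T.obj Z W)) ≫
        ψ X (T.obj Y (T.obj Z W))) ◁ (S.pent X Y Z W).hom ⊗≫
      T'.map (𝟙 X) (T'.map (𝟙 Y) (ψ Z W)) ◁ (omega X Y (T.obj Z W)).hom ▷
        A.a (T.obj X Y) Z W ⊗≫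
      (S'.assoc (𝟙 X) (𝟙 Y) (ψ Z W)).inv ▷
        (T'.map (ψ X Y) (𝟙 (T.obj Z W)) ≫ ψ (T.obj X Y) (T.obj Z W) ≫
          A.a (T.obj X Y) Z W) ⊗≫
      A'.a X Y (T'.obj Z W) ◁ toIdentitySemigroupalData.chi X Y Z W ▷
        (ψ (T.obj X Y) (T.obj Z W) ≫ A.a (T.obj X Y) Z W) ⊗≫
      (A'.a X Y (T'.obj Z W) ≫ T'.map (ψ X Y) (T'.map (𝟙 Z) (𝟙 W))) ◁
        (omega (T.obj X Y) Z W).hom ⊗≫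
      A'.a X Y (T'.obj Z W) ◁ (S'.assoc (ψ X Y) (𝟙 Z) (𝟙 W)).inv ▷
        (T'.map (ψ (T.obj X Y) Z) (𝟙 W) ≫ ψ (T.obj (T.obj X Y) Z) W) ⊗≫
      𝟙 (A'.a X Y (T'.obj Z W) ≫ A'.a (T'.obj X Y) Z W ≫ T'.map (T'.map (ψ X Y) (𝟙 Z)) (𝟙 W) ≫
        T'.map (ψ (T.obj X Y) Z) (𝟙 W) ≫ ψ (T.obj (T.obj X Y) Z) W) =
    𝟙 _ ⊗≫
      (T'.map (𝟙 X) (T'.map (𝟙 Y) (ψ Z W)) ≫ T'.map (𝟙 X) (ψ Y (T.obj Z W))) ◁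
        (nat (𝟙 X) (A.a Y Z W)).hom ▷ (A.a X (T.obj Y Z) W ≫ T.map (A.a X Y Z) (𝟙 W)) ⊗≫
      S'.paste₃₃ (𝟙 (𝟙 X ≫ 𝟙 X ≫ 𝟙 X)) (omega Y Z W).hom ▷
        (ψ X (T.obj (T.obj Y Z) W) ≫ A.a X (T.obj Y Z) W ≫ T.map (A.a X Y Z) (𝟙 W)) ⊗≫
      (T'.map (𝟙 X) (A'.a Y Z W) ≫ T'.map (𝟙 X) (T'.map (ψ Y Z) (𝟙 W))) ◁
        (omega X (T.obj Y Z) W).hom ▷ T.map (A.a X Y Z) (𝟙 W) ⊗≫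
      T'.map (𝟙 X) (A'.a Y Z W) ◁ (S'.assoc (𝟙 X) (ψ Y Z) (𝟙 W)).inv ▷
        (T'.map (ψ X (T.obj Y Z)) (𝟙 W) ≫ ψ (T.obj X (T.obj Y Z)) W ≫
          T.map (A.a X Y Z) (𝟙 W)) ⊗≫
      (T'.map (𝟙 X) (A'.a Y Z W) ≫ A'.a X (T'.obj Y Z) W ≫
          T'.map (T'.map (𝟙 X) (ψ Y Z)) (𝟙 W) ≫ T'.map (ψ X (T.obj Y Z)) (𝟙 W)) ◁
        (nat (A.a X Y Z) (𝟙 W)).hom ⊗≫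
      (T'.map (𝟙 X) (A'.a Y Z W) ≫ A'.a X (T'.obj Y Z) W) ◁
        S'.paste₃₃ (omega X Y Z).hom (𝟙 (𝟙 W ≫ 𝟙 W ≫ 𝟙 W)) ▷
        ψ (T.obj (T.obj X Y) Z) W ⊗≫
      (S'.pent X Y Z W).hom ▷ (T'.map (T'.map (ψ X Y) (𝟙 Z)) (𝟙 W) ≫
        T'.map (ψ (T.obj X Y) Z) (𝟙 W) ≫ ψ (T.obj (T.obj X Y) Z) W) ⊗≫
      𝟙 _

end Semigroupal

section FirstOrder

/-- The extension of scalars of the `K`-linear 2-category `C` along `K → K[ε]/(ε²)`. It has the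
same objects and the same 1-morphisms as `C`. -/
structure FirstOrderExt (K : Type uK) (C : Type u) : Type u where
  as : C

/-- A 1-morphism of `FirstOrderExt K C`: a 1-morphism of `C`. -/
structure FirstOrderHom {K : Type uK} {C : Type u} [Bicategory.{w, v} C]
    (X Y : FirstOrderExt K C) : Type v where
  of : X.as ⟶ Y.as

/-- A 2-morphism `zero + one • ε` of `FirstOrderExt K C`. -/
@[ext]
structure FirstOrderHom₂ {K : Type uK} {C : Type u} [Bicategory.{w, v} C]
    {X Y : FirstOrderExt K C} (f g : FirstOrderHom X Y) : Type w where
  zero : f.of ⟶ g.of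
  one : f.of ⟶ g.of

theorem LinearComposition.whiskerLeft_zero (K : Type uK) [CommRing K] {C : Type u}
    [Bicategory.{w, v} C] [∀ X Y : C, Preadditive (X ⟶ Y)] [∀ X Y : C, Linear K (X ⟶ Y)]
    [LinearComposition K C] {X Y Z : C} (f : X ⟶ Y) (g h : Y ⟶ Z) :
    f ◁ (0 : g ⟶ h) = 0 := by
  simpa using LinearComposition.whiskerLeft_smul (K := K) f (0 : K) (0 : g ⟶ h)

theorem LinearComposition.zero_whiskerRight (K : Type uK) [CommRing K] {C : Type u}
    [Bicategory.{w, v} C] [∀ X Y : C, Preadditive (X ⟶ Y)] [∀ X Y : C, Linear K (X ⟶ Y)]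
    [LinearComposition K C] {X Y Z : C} (f g : X ⟶ Y) (h : Y ⟶ Z) :
    (0 : f ⟶ g) ▷ h = 0 := by
  simpa using LinearComposition.smul_whiskerRight (K := K) (0 : K) (0 : f ⟶ g) h

variable {K : Type uK} [CommRing K] {C : Type u} [Bicategory.{w, v} C]
  [∀ X Y : C, Preadditive (X ⟶ Y)]

@[simps]
instance (X Y : FirstOrderExt K C) : Category.{w} (FirstOrderHom X Y) where
  Hom f g := FirstOrderHom₂ f g
  id f := ⟨𝟙 f.of, 0⟩
  comp η θ := ⟨η.zero ≫ θ.zero, η.zero ≫ θ.one + η.one ≫ θ.zero⟩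
  id_comp η := FirstOrderHom₂.ext (by simp) (by simp)
  comp_id η := FirstOrderHom₂.ext (by simp) (by simp)
  assoc η θ ι := FirstOrderHom₂.ext (by simp) (by simp [add_assoc])

/-- A 2-isomorphism of `C`, regarded as a 2-isomorphism of `FirstOrderExt K C`. -/
@[simps]
def firstOrderIso {X Y : FirstOrderExt K C} {f g : FirstOrderHom X Y} (η : f.of ≅ g.of) :
    f ≅ g where
  hom := (⟨η.hom, 0⟩ : FirstOrderHom₂ f g)
  inv := (⟨η.inv, 0⟩ : FirstOrderHom₂ g f)
  hom_inv_id := FirstOrderHom₂.ext (by simp) (by simp)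
  inv_hom_id := FirstOrderHom₂.ext (by simp) (by simp)

variable [∀ X Y : C, Linear K (X ⟶ Y)] [LinearComposition K C]

open LinearComposition in
/-- Composition in `FirstOrderExt K C` is the composition of `C`, extended `K[ε]/(ε²)`-bilinearly
to 2-morphisms. -/
instance : Bicategory.{w, v} (FirstOrderExt K C) where
  Hom X Y := FirstOrderHom X Y
  id X := ⟨𝟙 X.as⟩
  comp f g := ⟨f.of ≫ g.of⟩
  homCategory X Y := inferInstanceAs (Category (FirstOrderHom X Y))
  whiskerLeft f _ _ η := ⟨f.of ◁ η.zero, f.of ◁ η.one⟩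
  whiskerRight η h := ⟨η.zero ▷ h.of, η.one ▷ h.of⟩
  associator f g h := firstOrderIso (α_ f.of g.of h.of)
  leftUnitor f := firstOrderIso (λ_ f.of)
  rightUnitor f := firstOrderIso (ρ_ f.of)
  whiskerLeft_id f g := FirstOrderHom₂.ext (by simp) (by simp [whiskerLeft_zero K])
  whiskerLeft_comp f g h i η θ := FirstOrderHom₂.ext (by simp)
    (by simp [whiskerLeft_add (K := K)])
  id_whiskerLeft η := FirstOrderHom₂.ext (by simp) (by simp)
  comp_whiskerLeft f g h h' η := FirstOrderHom₂.ext (by simp) (by simp)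
  id_whiskerRight f g := FirstOrderHom₂.ext (by simp) (by simp [zero_whiskerRight K])
  comp_whiskerRight η θ i := FirstOrderHom₂.ext (by simp) (by simp [add_whiskerRight (K := K)])
  whiskerRight_id η := FirstOrderHom₂.ext (by simp) (by simp)
  whiskerRight_comp η g h := FirstOrderHom₂.ext (by simp) (by simp)
  whisker_assoc f g g' η h := FirstOrderHom₂.ext (by simp) (by simp)
  whisker_exchange η θ := FirstOrderHom₂.ext (by simp [whisker_exchange])
    (by simp [whisker_exchange, add_comm])
  pentagon f g h i := FirstOrderHom₂.ext (by simp)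
    (by simp [whiskerLeft_zero K, zero_whiskerRight K])
  triangle f g := FirstOrderHom₂.ext (by simp)
    (by simp [whiskerLeft_zero K, zero_whiskerRight K])

/-- The `K[ε]/(ε²)`-bilinear extension of a tensor product. -/
def TensorFunctor.firstOrder (K : Type uK) [CommRing K] [∀ X Y : C, Linear K (X ⟶ Y)]
    [LinearComposition K C] (T : TensorFunctor C) [T.IsBilinear K] :
    TensorFunctor (FirstOrderExt K C) where
  obj X Y := ⟨T.obj X.as Y.as⟩
  map f g := ⟨T.map f.of g.of⟩
  map₂ τ σ := ⟨T.map₂ τ.zero σ.zero, T.map₂ τ.zero σ.one + T.map₂ τ.one σ.zero⟩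
  map₂_id f g := FirstOrderHom₂.ext (T.map₂_id f.of g.of) (by
    have h₁ : T.map₂ (𝟙 f.of) (0 : g.of ⟶ g.of) = 0 := by
      simpa using TensorFunctor.IsBilinear.smul_right (T := T) (0 : K) (𝟙 f.of) (0 : g.of ⟶ g.of)
    have h₂ : T.map₂ (0 : f.of ⟶ f.of) (𝟙 g.of) = 0 := by
      simpa using TensorFunctor.IsBilinear.smul_left (T := T) (0 : K) (0 : f.of ⟶ f.of) (𝟙 g.of)
    change T.map₂ (𝟙 f.of) 0 + T.map₂ 0 (𝟙 g.of) = 0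
    rw [h₁, h₂, add_zero])
  map₂_comp τ τ' σ σ' := FirstOrderHom₂.ext (T.map₂_comp _ _ _ _) (by
    change T.map₂ (τ.zero ≫ τ'.zero) (σ.zero ≫ σ'.one + σ.one ≫ σ'.zero) +
        T.map₂ (τ.zero ≫ τ'.one + τ.one ≫ τ'.zero) (σ.zero ≫ σ'.zero) =
      T.map₂ τ.zero σ.zero ≫ (T.map₂ τ'.zero σ'.one + T.map₂ τ'.one σ'.zero) +
        (T.map₂ τ.zero σ.one + T.map₂ τ.one σ.zero) ≫ T.map₂ τ'.zero σ'.zero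
    simp only [TensorFunctor.IsBilinear.add_left K, TensorFunctor.IsBilinear.add_right K,
      T.map₂_comp, Preadditive.comp_add, Preadditive.add_comp]
    abel)

/-- The 1-isomorphisms of an associator, in the first order extension. -/
def AssociatorCells.firstOrder (K : Type uK) [CommRing K] [∀ X Y : C, Linear K (X ⟶ Y)]
    [LinearComposition K C] {T : TensorFunctor C} [T.IsBilinear K] (A : AssociatorCells T) :
    AssociatorCells (T.firstOrder K) where
  a X Y Z := ⟨A.a X.as Y.as Z.as⟩
  aInv X Y Z := ⟨A.aInv X.as Y.as Z.as⟩
  a_aInv X Y Z := congrArg FirstOrderHom.mk (A.a_aInv X.as Y.as Z.as)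
  aInv_a X Y Z := congrArg FirstOrderHom.mk (A.aInv_a X.as Y.as Z.as)

/-- A first order unitary deformation of a `K`-linear semigroupal 2-category: a semigroupal
structure on its first order extension, with the same underlying functors and 1-isomorphisms,
whose structural 2-isomorphisms reduce to the original ones modulo `ε`, and such that `⊗₀` is not
deformed. -/
structure UnitaryDeformation (K : Type uK) [CommRing K] [∀ X Y : C, Linear K (X ⟶ Y)]
    [LinearComposition K C] {T : TensorFunctor C} [T.IsBilinear K] {A : AssociatorCells T}
    (S : SemigroupalStructure T A) extends SemigroupalStructure (T.firstOrder K) (A.firstOrder K) where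
  tensorComp_zero {X X' X'' Y Y' Y'' : C} (f : X ⟶ X') (g : Y ⟶ Y') (f' : X' ⟶ X'')
    (g' : Y' ⟶ Y'') :
    (tensorComp ⟨f⟩ ⟨g⟩ ⟨f'⟩ ⟨g'⟩).hom.zero = (S.tensorComp f g f' g').hom
  tensorId_zero (X Y : C) : (tensorId ⟨X⟩ ⟨Y⟩).hom.zero = (S.tensorId X Y).hom
  tensorId_one (X Y : C) : (tensorId ⟨X⟩ ⟨Y⟩).hom.one = 0
  assoc_zero {X X' Y Y' Z Z' : C} (f : X ⟶ X') (g : Y ⟶ Y') (h : Z ⟶ Z') :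
    (assoc ⟨f⟩ ⟨g⟩ ⟨h⟩).hom.zero = (S.assoc f g h).hom
  pent_zero (X Y Z W : C) : (pent ⟨X⟩ ⟨Y⟩ ⟨Z⟩ ⟨W⟩).hom.zero = (S.pent X Y Z W).hom

namespace UnitaryDeformation

variable {T : TensorFunctor C} [T.IsBilinear K] {A : AssociatorCells T}
  {S : SemigroupalStructure T A} (D : UnitaryDeformation K S)

/-- The first order term of `⊗̂`. -/
def tensorComp₁ {X X' X'' Y Y' Y'' : C} (f : X ⟶ X') (g : Y ⟶ Y') (f' : X' ⟶ X'')
    (g' : Y' ⟶ Y'') : T.map f g ≫ T.map f' g' ⟶ T.map (f ≫ f') (g ≫ g') :=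
  (D.tensorComp (X := ⟨X⟩) (X' := ⟨X'⟩) (X'' := ⟨X''⟩) (Y := ⟨Y⟩) (Y' := ⟨Y'⟩) (Y'' := ⟨Y''⟩)
    ⟨f⟩ ⟨g⟩ ⟨f'⟩ ⟨g'⟩).hom.one

/-- The first order term of `â`. -/
def assoc₁ {X X' Y Y' Z Z' : C} (f : X ⟶ X') (g : Y ⟶ Y') (h : Z ⟶ Z') :
    A.a X Y Z ≫ T.map (T.map f g) h ⟶ T.map f (T.map g h) ≫ A.a X' Y' Z' :=
  (D.assoc (X := ⟨X⟩) (X' := ⟨X'⟩) (Y := ⟨Y⟩) (Y' := ⟨Y'⟩) (Z := ⟨Z⟩) (Z' := ⟨Z'⟩)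
    ⟨f⟩ ⟨g⟩ ⟨h⟩).hom.one

/-- The first order term of `π`. -/
def pent₁ (X Y Z W : C) :
    T.map (𝟙 X) (A.a Y Z W) ≫ A.a X (T.obj Y Z) W ≫ T.map (A.a X Y Z) (𝟙 W) ⟶
      A.a X Y (T.obj Z W) ≫ A.a (T.obj X Y) Z W :=
  (D.pent ⟨X⟩ ⟨Y⟩ ⟨Z⟩ ⟨W⟩).hom.one

end UnitaryDeformation

/-- Two deformations are equivalent if there is a semigroupal structure on the identity 2-functor
of the extension from the first to the second, whose 1-morphisms `ψ_{X,Y}` are identities and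
which is trivial modulo `ε`. -/
def UnitaryDeformation.Equivalent {T : TensorFunctor C} [T.IsBilinear K] {A : AssociatorCells T}
    {S : SemigroupalStructure T A} (D D' : UnitaryDeformation K S) : Prop :=
  ∃ P : IdentitySemigroupalStructure D.toSemigroupalStructure D'.toSemigroupalStructure
      (fun X Y => 𝟙 ((T.firstOrder K).obj X Y)),
    (∀ {X X' Y Y' : C} (f : X ⟶ X') (g : Y ⟶ Y'),
      (P.nat (X := ⟨X⟩) (X' := ⟨X'⟩) (Y := ⟨Y⟩) (Y' := ⟨Y'⟩) ⟨f⟩ ⟨g⟩).hom.zero =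
        (λ_ (T.map f g)).hom ≫ (ρ_ (T.map f g)).inv) ∧
    ∀ X Y Z : C, (P.omega ⟨X⟩ ⟨Y⟩ ⟨Z⟩).hom.zero =
      T.map (𝟙 X) (𝟙 (T.obj Y Z)) ◁ (λ_ (A.a X Y Z)).hom ≫
        (S.tensorId X (T.obj Y Z)).hom ▷ A.a X Y Z ≫ (λ_ (A.a X Y Z)).hom ≫
        (ρ_ (A.a X Y Z)).inv ≫ A.a X Y Z ◁ (S.tensorId (T.obj X Y) Z).inv ≫
        A.a X Y Z ◁ (ρ_ (T.map (𝟙 (T.obj X Y)) (𝟙 Z))).inv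

end FirstOrder

section Chains

/-- The data of a (lax) functor of bicategories: a functor on each hom-category together with
2-morphisms `F f ≫ F g ⟶ F (f ≫ g)`. -/
structure LaxData (B : Type u) [Bicategory.{w, v} B] (D : Type u) [Bicategory.{w, v} D] extends
    PrelaxFunctor B D where
  mapComp {X Y Z : B} (f : X ⟶ Y) (g : Y ⟶ Z) : map f ≫ map g ⟶ map (f ≫ g)

/-- `Chain B m X Y` is the set of chains `(f₀, …, f_m)` of `m + 1` composable 1-morphisms from `X`
to `Y`; in the chain `(f₀, …, f_m)` the morphism `f_m` is applied first. -/
inductive Chain (B : Type u) [Bicategory.{w, v} B] : ℕ → B → B → Type (max u v)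
  | single {X Y : B} (f : X ⟶ Y) : Chain B 0 X Y
  | cons {m : ℕ} {X Y Z : B} (f : Y ⟶ Z) (c : Chain B m X Y) : Chain B (m + 1) X Z

namespace Chain

variable {B : Type u} [Bicategory.{w, v} B]

/-- The composite of a chain. -/
def comp : ∀ {m : ℕ} {X Y : B}, Chain B m X Y → (X ⟶ Y)
  | _, _, _, single f => f
  | _, _, _, cons f c => c.comp ≫ f

/-- The chain has an identity among its members. -/
inductive HasId : ∀ {m : ℕ} {X Y : B}, Chain B m X Y → Prop
  | single (X : B) : HasId (single (𝟙 X))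
  | head {m : ℕ} {X Y : B} (c : Chain B m X Y) : HasId (cons (𝟙 Y) c)
  | tail {m : ℕ} {X Y Z : B} (f : Y ⟶ Z) {c : Chain B m X Y} (h : HasId c) : HasId (cons f c)

/-- Families of 2-morphisms between the members of two chains. -/
inductive Hom : ∀ {m : ℕ} {X Y : B}, Chain B m X Y → Chain B m X Y → Type (max u v w)
  | single {X Y : B} {f f' : X ⟶ Y} (τ : f ⟶ f') : Hom (single f) (single f')
  | cons {m : ℕ} {X Y Z : B} {f f' : Y ⟶ Z} {c c' : Chain B m X Y} (τ : f ⟶ f') (s : Hom c c') :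
      Hom (cons f c) (cons f' c')

/-- The horizontal composite of a family of 2-morphisms between the members of two chains. -/
def Hom.comp : ∀ {m : ℕ} {X Y : B} {c c' : Chain B m X Y}, Hom c c' → (c.comp ⟶ c'.comp)
  | _, _, _, _, _, single τ => τ
  | _, _, _, _, _, cons τ s => hcomp s.comp τ

/-- `merge j (f₀, …, f_{m+1}) = (f₀, …, f_j ∘ f_{j+1}, …, f_{m+1})`. -/
def merge : ∀ {m : ℕ} {X Y : B}, Fin (m + 1) → Chain B (m + 1) X Y → Chain B m X Y
  | 0, _, _, _, cons f (single g) => single (g ≫ f)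
  | _ + 1, _, _, ⟨0, _⟩, cons f (cons g c) => cons (g ≫ f) c
  | _ + 1, _, _, ⟨j + 1, h⟩, cons f c => cons f (merge ⟨j, Nat.lt_of_succ_lt_succ h⟩ c)

/-- The comparison of the composites of `merge j c` and of `c`. -/
def mergeComp : ∀ {m : ℕ} {X Y : B} (j : Fin (m + 1)) (c : Chain B (m + 1) X Y),
    (merge j c).comp ⟶ c.comp
  | 0, _, _, _, cons f (single g) => 𝟙 (g ≫ f)
  | _ + 1, _, _, ⟨0, _⟩, cons f (cons g c) => (α_ c.comp g f).inv
  | _ + 1, _, _, ⟨j + 1, h⟩, cons f c => mergeComp ⟨j, Nat.lt_of_succ_lt_succ h⟩ c ▷ f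

/-- The target of the member `f_{m+1}` of the chain `(f₀, …, f_{m+1})`. -/
def lastObj : ∀ {m : ℕ} {X Y : B}, Chain B (m + 1) X Y → B
  | 0, _, _, cons (Y := Y) _ (single _) => Y
  | _ + 1, _, _, cons _ c => c.lastObj

/-- The member `f_{m+1}` of the chain `(f₀, …, f_{m+1})`. -/
def last : ∀ {m : ℕ} {X Y : B} (c : Chain B (m + 1) X Y), X ⟶ c.lastObj
  | 0, _, _, cons _ (single g) => g
  | _ + 1, _, _, cons _ c => c.last

/-- The chain `(f₀, …, f_m)` obtained from `(f₀, …, f_{m+1})`. -/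
def init : ∀ {m : ℕ} {X Y : B} (c : Chain B (m + 1) X Y), Chain B m c.lastObj Y
  | 0, _, _, cons f (single _) => single f
  | _ + 1, _, _, cons f c => cons f c.init

/-- The comparison of the two ways of composing a chain. -/
def lastComp : ∀ {m : ℕ} {X Y : B} (c : Chain B (m + 1) X Y),
    c.last ≫ c.init.comp ≅ c.comp
  | 0, _, _, cons f (single g) => Iso.refl (g ≫ f)
  | _ + 1, _, _, cons f c =>
    (α_ c.last c.init.comp f).symm ≪≫ whiskerRightIso c.lastComp f

end Chain

namespace LaxData

variable {B : Type u} [Bicategory.{w, v} B] {D : Type u} [Bicategory.{w, v} D] (F : LaxData B D)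

/-- The image of a chain. -/
def onChain : ∀ {m : ℕ} {X Y : B}, Chain B m X Y → Chain D m (F.obj X) (F.obj Y)
  | _, _, _, .single f => .single (F.map f)
  | _, _, _, .cons f c => .cons (F.map f) (onChain c)

/-- The image of a family of 2-morphisms between the members of two chains. -/
def onChainHom : ∀ {m : ℕ} {X Y : B} {c c' : Chain B m X Y}, c.Hom c' →
    (F.onChain c).Hom (F.onChain c')
  | _, _, _, _, _, .single τ => .single (F.map₂ τ)
  | _, _, _, _, _, .cons τ s => .cons (F.map₂ τ) (onChainHom s)

/-- The canonical 2-morphism `F f₀ ∘ ⋯ ∘ F f_m ⟹ F (f₀ ∘ ⋯ ∘ f_m)`. -/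
def iter : ∀ {m : ℕ} {X Y : B} (c : Chain B m X Y), (F.onChain c).comp ⟶ F.map c.comp
  | _, _, _, .single f => 𝟙 (F.map f)
  | _, _, _, .cons f c => iter c ▷ F.map f ≫ F.mapComp c.comp f

/-- The 2-morphism from the composite of the images of the members of `c` to the composite of the
images of the members of `merge j c`. -/
def mergeSrc : ∀ {m : ℕ} {X Y : B} (j : Fin (m + 1)) (c : Chain B (m + 1) X Y),
    (F.onChain c).comp ⟶ (F.onChain (c.merge j)).comp
  | 0, _, _, _, .cons f (.single g) => F.mapComp g f
  | _ + 1, _, _, ⟨0, _⟩, .cons f (.cons g c) =>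
    (α_ (F.onChain c).comp (F.map g) (F.map f)).hom ≫ (F.onChain c).comp ◁ F.mapComp g f
  | _ + 1, _, _, ⟨j + 1, h⟩, .cons f c =>
    mergeSrc ⟨j, Nat.lt_of_succ_lt_succ h⟩ c ▷ F.map f

/-- The comparison of the two ways of composing the image of a chain. -/
def lastSrc : ∀ {m : ℕ} {X Y : B} (c : Chain B (m + 1) X Y),
    (F.onChain c).comp ⟶ F.map c.last ≫ (F.onChain c.init).comp
  | 0, _, _, .cons f (.single g) => 𝟙 (F.map g ≫ F.map f)
  | _ + 1, _, _, .cons f c =>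
    lastSrc c ▷ F.map f ≫ (α_ (F.map c.last) (F.onChain c.init).comp (F.map f)).hom

/-- Families of 2-morphisms `φ(f₀, …, f_m) : F f₀ ∘ ⋯ ∘ F f_m ⟹ F (f₀ ∘ ⋯ ∘ f_m)`. -/
abbrev Cochain (m : ℕ) : Type (max u v w) :=
  ∀ (X Y : B) (c : Chain B m X Y), (F.onChain c).comp ⟶ F.map c.comp

variable {F} in
/-- `φ(f₀, …, f_m)` is natural in `(f₀, …, f_m)`. -/
def Cochain.IsNatural {m : ℕ} (φ : F.Cochain m) : Prop :=
  ∀ (X Y : B) (c c' : Chain B m X Y) (s : c.Hom c'),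
    φ X Y c ≫ F.map₂ s.comp = (F.onChainHom s).comp ≫ φ X Y c'

variable (K : Type uK) [CommRing K] [∀ X Y : D, Preadditive (X ⟶ Y)]
  [∀ X Y : D, Linear K (X ⟶ Y)]

/-- The cochains which are natural and special, i.e. vanish on the chains which have an identity
among their members. -/
def specialCochains (m : ℕ) : Submodule K (F.Cochain m) where
  carrier := {φ | φ.IsNatural ∧ ∀ (X Y : B) (c : Chain B m X Y), c.HasId → φ X Y c = 0}
  add_mem' {φ φ'} h h' := by
    refine ⟨fun X Y c c' s => ?_, fun X Y c hc => ?_⟩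
    · simp [h.1 X Y c c' s, h'.1 X Y c c' s]
    · simp [h.2 X Y c hc, h'.2 X Y c hc]
  zero_mem' := by
    refine ⟨fun X Y c c' s => ?_, fun X Y c hc => ?_⟩
    · simp
    · simp
  smul_mem' r φ h := by
    refine ⟨fun X Y c c' s => ?_, fun X Y c hc => ?_⟩
    · simp [h.1 X Y c c' s]
    · simp [h.2 X Y c hc]

variable [LinearComposition K D]

/-- `φ ↦ ⌈1_{F f₀} ∘ φ(f₁, …, f_{m+1})⌉`. -/
def firstTerm (m : ℕ) : F.Cochain m →ₗ[K] F.Cochain (m + 1) where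
  toFun φ _ _
    | .cons f c => φ _ _ c ▷ F.map f ≫ F.mapComp c.comp f
  map_add' φ φ' := by
    funext X Y c
    cases c with
    | cons f c =>
      exact (congrArg (· ≫ F.mapComp c.comp f)
        (LinearComposition.add_whiskerRight (K := K) (φ _ _ c) (φ' _ _ c) (F.map f))).trans
        (Preadditive.add_comp ..)
  map_smul' r φ := by
    funext X Y c
    cases c with
    | cons f c =>
      exact (congrArg (· ≫ F.mapComp c.comp f)
        (LinearComposition.smul_whiskerRight r (φ _ _ c) (F.map f))).trans
        (Linear.smul_comp ..)

/-- `φ ↦ ⌈φ(f₀, …, f_j ∘ f_{j+1}, …, f_{m+1})⌉`. -/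
def mergeTerm (m : ℕ) (j : Fin (m + 1)) : F.Cochain m →ₗ[K] F.Cochain (m + 1) where
  toFun φ X Y c := F.mergeSrc j c ≫ φ X Y (c.merge j) ≫ F.map₂ (c.mergeComp j)
  map_add' φ φ' := by
    funext X Y c
    simp
  map_smul' r φ := by
    funext X Y c
    simp

/-- `φ ↦ ⌈φ(f₀, …, f_m) ∘ 1_{F f_{m+1}}⌉`. -/
def lastTerm (m : ℕ) : F.Cochain m →ₗ[K] F.Cochain (m + 1) where
  toFun φ X Y c := F.lastSrc c ≫ F.map c.last ◁ φ _ _ c.init ≫ F.mapComp c.last c.init.comp ≫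
    F.map₂ c.lastComp.hom
  map_add' φ φ' := by
    funext X Y c
    simp [LinearComposition.whiskerLeft_add (K := K)]
  map_smul' r φ := by
    funext X Y c
    simp [LinearComposition.whiskerLeft_smul]

/-- The coboundary operator of the complex of the pseudofunctor `F`. -/
def delta (m : ℕ) : F.Cochain m →ₗ[K] F.Cochain (m + 1) :=
  F.firstTerm K m + ∑ j : Fin (m + 1), (-1 : K) ^ (j.val + 1) • F.mergeTerm K m j +
    (-1 : K) ^ (m + 2) • F.lastTerm K m

end LaxData

namespace LaxData

/-- The identity. -/
def id (B : Type u) [Bicategory.{w, v} B] : LaxData B B where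
  obj X := X
  map f := f
  map₂ η := η
  mapComp f g := 𝟙 (f ≫ g)

/-- The first projection of a product. -/
def fst (B B' : Type u) [Bicategory.{w, v} B] [Bicategory.{w, v} B'] : LaxData (B × B') B where
  obj X := X.1
  map f := f.1
  map₂ η := η.1
  mapComp f g := 𝟙 (f.1 ≫ g.1)

/-- The second projection of a product. -/
def snd (B B' : Type u) [Bicategory.{w, v} B] [Bicategory.{w, v} B'] : LaxData (B × B') B' where
  obj X := X.2
  map f := f.2
  map₂ η := η.2
  mapComp f g := 𝟙 (f.2 ≫ g.2)

end LaxData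

end Chains

section Tensor

/-- `Tup C n` is the 2-category `C × (C × ⋯)` of `(n + 1)`-tuples. -/
def Tup (C : Type u) : ℕ → Type u
  | 0 => C
  | n + 1 => C × Tup C n

/-- The product 2-category structure on `Tup C n`. -/
instance Tup.bicategory (C : Type u) [inst : Bicategory.{w, v} C] :
    ∀ n : ℕ, Bicategory.{w, v} (Tup C n)
  | 0 => inst
  | n + 1 => @Bicategory.prod C inst (Tup C n) (Tup.bicategory C n)

variable {C : Type u} [Bicategory.{w, v} C]

namespace SemigroupalData

variable {T : TensorFunctor C} {A : AssociatorCells T} (S : SemigroupalData T A)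

/-- The functor `⊗ ∘ (F × G)`. -/
def tensorLax {B B' : Type u} [Bicategory.{w, v} B] [Bicategory.{w, v} B'] (F : LaxData B C)
    (G : LaxData B' C) : LaxData (B × B') C where
  obj X := T.obj (F.obj X.1) (G.obj X.2)
  map f := T.map (F.map f.1) (G.map f.2)
  map₂ η := T.map₂ (F.map₂ η.1) (G.map₂ η.2)
  map₂_id f := by
    change T.map₂ (F.map₂ (𝟙 f.1)) (G.map₂ (𝟙 f.2)) = _
    rw [F.map₂_id, G.map₂_id, T.map₂_id]
  map₂_comp η θ := by
    change T.map₂ (F.map₂ (η.1 ≫ θ.1)) (G.map₂ (η.2 ≫ θ.2)) = _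
    rw [F.map₂_comp, G.map₂_comp, T.map₂_comp]
  mapComp f g := (S.tensorComp (F.map f.1) (G.map f.2) (F.map g.1) (G.map g.2)).hom ≫
    T.map₂ (F.mapComp f.1 g.1) (G.mapComp f.2 g.2)

/-- The iterated tensor product `(X₀, …, X_n) ↦ X₀ ⊗ (X₁ ⊗ ⋯)`. -/
def tens : ∀ n : ℕ, LaxData (Tup C n) C
  | 0 => LaxData.id C
  | n + 1 => S.tensorLax (LaxData.id C) (tens n)

/-- `(X₀, …, X_{n+1}) ↦ (X₀, …, X_i ⊗ X_{i+1}, …, X_{n+1})`. -/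
def face : ∀ (n : ℕ) (_ : Fin (n + 1)), LaxData (Tup C (n + 1)) (Tup C n)
  | 0, _ => S.tensorLax (LaxData.id C) (LaxData.id C)
  | n + 1, ⟨0, _⟩ =>
    { obj := fun (X : C × (C × Tup C n)) => ((T.obj X.1 X.2.1, X.2.2) : C × Tup C n)
      map := fun {X Y : C × (C × Tup C n)} (f : X ⟶ Y) =>
        Prod.mkHom (T.map f.1 f.2.1) f.2.2
      map₂ := fun {X Y : C × (C × Tup C n)} {f g : X ⟶ Y} (η : f ⟶ g) =>
        Prod.mkHom (T.map₂ η.1 η.2.1) η.2.2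
      map₂_id := fun {X Y : C × (C × Tup C n)} (f : X ⟶ Y) =>
        Prod.ext (T.map₂_id f.1 f.2.1) rfl
      map₂_comp := fun {X Y : C × (C × Tup C n)} {f g h : X ⟶ Y} (η : f ⟶ g) (θ : g ⟶ h) =>
        Prod.ext (T.map₂_comp η.1 θ.1 η.2.1 θ.2.1) rfl
      mapComp := fun {X Y Z : C × (C × Tup C n)} (f : X ⟶ Y) (g : Y ⟶ Z) =>
        Prod.mkHom (S.tensorComp f.1 f.2.1 g.1 g.2.1).hom (𝟙 (f.2.2 ≫ g.2.2)) }
  | n + 1, ⟨i + 1, h⟩ =>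
    let d := face n ⟨i, Nat.lt_of_succ_lt_succ h⟩
    { obj := fun (X : C × Tup C (n + 1)) => ((X.1, d.obj X.2) : C × Tup C n)
      map := fun {X Y : C × Tup C (n + 1)} (f : X ⟶ Y) => Prod.mkHom f.1 (d.map f.2)
      map₂ := fun {X Y : C × Tup C (n + 1)} {f g : X ⟶ Y} (η : f ⟶ g) =>
        Prod.mkHom η.1 (d.map₂ η.2)
      map₂_id := fun {X Y : C × Tup C (n + 1)} (f : X ⟶ Y) => Prod.ext rfl (d.map₂_id f.2)
      map₂_comp := fun {X Y : C × Tup C (n + 1)} {f g h : X ⟶ Y} (η : f ⟶ g) (θ : g ⟶ h) =>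
        Prod.ext rfl (d.map₂_comp η.2 θ.2)
      mapComp := fun {X Y Z : C × Tup C (n + 1)} (f : X ⟶ Y) (g : Y ⟶ Z) =>
        Prod.mkHom (𝟙 (f.1 ≫ g.1)) (d.mapComp f.2 g.2) }

end SemigroupalData

/-- `(X₀, …, X_{n+1}) ↦ ((X₀, …, X_n), X_{n+1})`. -/
def unsnoc (C : Type u) [Bicategory.{w, v} C] : ∀ n : ℕ, LaxData (Tup C (n + 1)) (Tup C n × C)
  | 0 => LaxData.id (C × C)
  | n + 1 =>
    let d := unsnoc C n
    { obj := fun (X : C × Tup C (n + 1)) => (((X.1, (d.obj X.2).1), (d.obj X.2).2) :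
        (C × Tup C n) × C)
      map := fun {X Y : C × Tup C (n + 1)} (f : X ⟶ Y) =>
        Prod.mkHom (Prod.mkHom f.1 (d.map f.2).1) (d.map f.2).2
      map₂ := fun {X Y : C × Tup C (n + 1)} {f g : X ⟶ Y} (η : f ⟶ g) =>
        Prod.mkHom (Prod.mkHom η.1 (d.map₂ η.2).1) (d.map₂ η.2).2
      map₂_id := fun {X Y : C × Tup C (n + 1)} (f : X ⟶ Y) =>
        Prod.ext (Prod.ext rfl (Prod.ext_iff.1 (d.map₂_id f.2)).1)
          (Prod.ext_iff.1 (d.map₂_id f.2)).2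
      map₂_comp := fun {X Y : C × Tup C (n + 1)} {f g h : X ⟶ Y} (η : f ⟶ g) (θ : g ⟶ h) =>
        Prod.ext (Prod.ext rfl (Prod.ext_iff.1 (d.map₂_comp η.2 θ.2)).1)
          (Prod.ext_iff.1 (d.map₂_comp η.2 θ.2)).2
      mapComp := fun {X Y Z : C × Tup C (n + 1)} (f : X ⟶ Y) (g : Y ⟶ Z) =>
        Prod.mkHom (Prod.mkHom (𝟙 (f.1 ≫ g.1)) (d.mapComp f.2 g.2).1) (d.mapComp f.2 g.2).2 }

/-- `G ∘ E` and `F` coincide on objects and on 1-morphisms. -/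
structure LaxData.Factors {B B' D : Type u} [Bicategory.{w, v} B] [Bicategory.{w, v} B']
    [Bicategory.{w, v} D] (F : LaxData B D) (E : LaxData B B') (G : LaxData B' D) : Prop where
  obj (X : B) : G.obj (E.obj X) = F.obj X
  map {X Y : B} (f : X ⟶ Y) : HEq (G.map (E.map f)) (F.map f)

theorem comp_heq {D : Type u} [Bicategory.{w, v} D] {X X' Y Y' Z Z' : D} {f : X ⟶ Y}
    {f' : X' ⟶ Y'} {g : Y ⟶ Z} {g' : Y' ⟶ Z'} (hX : X = X') (hY : Y = Y') (hZ : Z = Z')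
    (hf : HEq f f') (hg : HEq g g') : HEq (f ≫ g) (f' ≫ g') := by
  subst hX hY hZ hf hg
  rfl

theorem id_heq {D : Type u} [Bicategory.{w, v} D] {X X' : D} (hX : X = X') :
    HEq (𝟙 X) (𝟙 X') := by
  subst hX
  rfl

theorem LaxData.Factors.comp {B B' D : Type u} [Bicategory.{w, v} B] [Bicategory.{w, v} B']
    [Bicategory.{w, v} D] {F : LaxData B D} {E : LaxData B B'} {G : LaxData B' D}
    (h : F.Factors E G) {m : ℕ} {X Y : B} (c : Chain B m X Y) :
    HEq (G.onChain (E.onChain c)).comp (F.onChain c).comp := by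
  induction c with
  | single f => exact h.map f
  | cons f c ih => exact comp_heq (h.obj _) (h.obj _) (h.obj _) ih (h.map f)

theorem TensorFunctor.map_heq (T : TensorFunctor C) {X X' Y Y' Z Z' W W' : C} {f : X ⟶ Y}
    {f' : X' ⟶ Y'} {g : Z ⟶ W} {g' : Z' ⟶ W'} (hX : X = X') (hY : Y = Y') (hZ : Z = Z')
    (hW : W = W') (hf : HEq f f') (hg : HEq g g') : HEq (T.map f g) (T.map f' g') := by
  subst hX hY hZ hW hf hg
  rfl

theorem IsIdentityOne.comp_heq [Bicategory.Strict C] {X Y Z : C} {f : X ⟶ Y}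
    (hf : IsIdentityOne f) (g : Y ⟶ Z) : HEq (f ≫ g) g := by
  obtain ⟨rfl, h⟩ := hf
  rw [eq_of_heq h, Bicategory.Strict.id_comp]

theorem IsIdentityOne.heq_comp [Bicategory.Strict C] {X Y Z : C} {f : X ⟶ Y}
    (hf : IsIdentityOne f) (g : Z ⟶ X) : HEq (g ≫ f) g := by
  obtain ⟨rfl, h⟩ := hf
  rw [eq_of_heq h, Bicategory.Strict.comp_id]

namespace SemigroupalStructure.IsGray

variable {T : TensorFunctor C} {A : AssociatorCells T} {S : SemigroupalStructure T A}

theorem tensor_assoc (hS : S.IsGray) (X Y Z : C) : T.obj X (T.obj Y Z) = T.obj (T.obj X Y) Z := (hS.a X Y Z).1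

theorem map_id (hS : S.IsGray) (X Y : C) : T.map (𝟙 X) (𝟙 Y) = 𝟙 (T.obj X Y) := (hS.tensorId X Y).1

theorem map_assoc [Bicategory.Strict C] (hS : S.IsGray) {X X' Y Y' Z Z' : C} (f : X ⟶ X')
    (g : Y ⟶ Y') (h : Z ⟶ Z') : HEq (T.map (T.map f g) h) (T.map f (T.map g h)) :=
  (((hS.a X Y Z).comp_heq _).symm.trans (heq_of_eq (hS.assoc f g h).1)).trans
    ((hS.a X' Y' Z').heq_comp _)

theorem face_factors [Bicategory.Strict C] (hS : S.IsGray) : ∀ (n : ℕ) (i : Fin (n + 1)),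
    (S.tens (n + 1)).Factors (S.face n i) (S.tens n)
  | 0, _ => ⟨fun _ => rfl, fun _ => HEq.rfl⟩
  | _ + 1, ⟨0, _⟩ => ⟨fun _ => (hS.tensor_assoc _ _ _).symm, fun _ => hS.map_assoc _ _ _⟩
  | n + 1, ⟨i + 1, h⟩ =>
    have ih := face_factors hS n ⟨i, Nat.lt_of_succ_lt_succ h⟩
    ⟨fun X => congrArg (T.obj X.1) (ih.obj X.2), fun {_ _} f => T.map_heq rfl rfl
      (ih.obj _) (ih.obj _) HEq.rfl (ih.map f.2)⟩

theorem unsnoc_factors [Bicategory.Strict C] (hS : S.IsGray) : ∀ n : ℕ,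
    (S.tens (n + 1)).Factors (unsnoc C n) (S.tensorLax (S.tens n) (LaxData.id C))
  | 0 => ⟨fun _ => rfl, fun _ => HEq.rfl⟩
  | n + 1 =>
    have ih := unsnoc_factors hS n
    ⟨fun X => (hS.tensor_assoc _ _ _).symm.trans (congrArg (T.obj X.1) (ih.obj X.2)),
      fun {_ _} f => (hS.map_assoc _ _ _).trans (T.map_heq rfl rfl
        (ih.obj _) (ih.obj _) HEq.rfl (ih.map f.2))⟩

theorem pent_src_heq [Bicategory.Strict C] (hS : S.IsGray) (X Y Z W : C) :
    HEq (T.map (𝟙 X) (A.a Y Z W) ≫ A.a X (T.obj Y Z) W ≫ T.map (A.a X Y Z) (𝟙 W))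
      (𝟙 (T.obj X (T.obj Y (T.obj Z W)))) := by
  rw [(hS.pent X Y Z W).1]
  exact ((hS.a _ _ _).comp_heq _).trans ((hS.a _ _ _).2.trans
    (id_heq (hS.tensor_assoc X Y (T.obj Z W)).symm))

end SemigroupalStructure.IsGray

end Tensor

section Complexes

variable {K : Type uK} [CommRing K] {C : Type u} [Bicategory.{w, v} C]
  [∀ X Y : C, Preadditive (X ⟶ Y)] [∀ X Y : C, Linear K (X ⟶ Y)]

/-- Transport of 2-morphisms along equalities of 1-morphisms. -/
def castHom₂ (K : Type uK) [CommRing K] [∀ X Y : C, Linear K (X ⟶ Y)] {X X' Y Y' : C}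
    {f g : X ⟶ Y} {f' g' : X' ⟶ Y'} (hX : X = X') (hY : Y = Y') (hf : HEq f f')
    (hg : HEq g g') : (f ⟶ g) →ₗ[K] (f' ⟶ g') := by
  subst hX hY hf hg
  exact LinearMap.id

namespace LaxData

/-- `φ ↦ φ ∘ E`, where `E` is such that `G ∘ E` and `F` coincide. -/
def Factors.pullback (K : Type uK) [CommRing K] [∀ X Y : C, Linear K (X ⟶ Y)] {B B' : Type u}
    [Bicategory.{w, v} B] [Bicategory.{w, v} B'] {F : LaxData B C} {E : LaxData B B'}
    {G : LaxData B' C} (h : F.Factors E G) (m : ℕ) : G.Cochain m →ₗ[K] F.Cochain m where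
  toFun φ X Y c := castHom₂ K (h.obj X) (h.obj Y) (h.comp c) (h.map c.comp)
    (φ _ _ (E.onChain c) ≫ G.map₂ (E.iter c))
  map_add' φ φ' := by
    funext X Y c
    simp
  map_smul' r φ := by
    funext X Y c
    simp

end LaxData

variable {T : TensorFunctor C} {A : AssociatorCells T}

namespace TensorFunctor

variable {X X' Y Y' : C} {k : T.obj X Y ⟶ T.obj X' Y'} {f f' f'' : X ⟶ X'} {g g' g'' : Y ⟶ Y'}

theorem pad_right_add (K : Type uK) [CommRing K] [∀ X Y : C, Linear K (X ⟶ Y)] [T.IsBilinear K]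
    (s : k ⟶ T.map f g) (τ : f ⟶ f') (η η' : g ⟶ g') (t : g' ⟶ g'') :
    s ≫ T.map₂ τ ((η + η') ≫ t) = s ≫ T.map₂ τ (η ≫ t) + s ≫ T.map₂ τ (η' ≫ t) := by
  simp [IsBilinear.add_right K]

theorem pad_right_smul [T.IsBilinear K] (r : K)
    (s : k ⟶ T.map f g) (τ : f ⟶ f') (η : g ⟶ g') (t : g' ⟶ g'') :
    s ≫ T.map₂ τ ((r • η) ≫ t) = r • (s ≫ T.map₂ τ (η ≫ t)) := by
  simp [IsBilinear.smul_right]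

theorem pad_left_add (K : Type uK) [CommRing K] [∀ X Y : C, Linear K (X ⟶ Y)] [T.IsBilinear K]
    (s : k ⟶ T.map f g) (τ τ' : f ⟶ f') (t : f' ⟶ f'') (η : g ⟶ g') :
    s ≫ T.map₂ ((τ + τ') ≫ t) η = s ≫ T.map₂ (τ ≫ t) η + s ≫ T.map₂ (τ' ≫ t) η := by
  simp [IsBilinear.add_left K]

theorem pad_left_smul [T.IsBilinear K] (r : K)
    (s : k ⟶ T.map f g) (τ : f ⟶ f') (t : f' ⟶ f'') (η : g ⟶ g') :
    s ≫ T.map₂ ((r • τ) ≫ t) η = r • (s ≫ T.map₂ (τ ≫ t) η) := by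
  simp [IsBilinear.smul_left]

end TensorFunctor

namespace SemigroupalData

variable (S : SemigroupalData T A)

section

variable {B B' : Type u} [Bicategory.{w, v} B] [Bicategory.{w, v} B'] (F : LaxData B C)
  (G : LaxData B' C)

/-- The canonical 2-morphism
`(F f₀ ⊗ G g₀) ∘ ⋯ ∘ (F f_m ⊗ G g_m) ⟹ (F f₀ ∘ ⋯ ∘ F f_m) ⊗ (G g₀ ∘ ⋯ ∘ G g_m)`. -/
def split : ∀ {m : ℕ} {X Y : B × B'} (c : Chain (B × B') m X Y),
    ((S.tensorLax F G).onChain c).comp ⟶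
      T.map (F.onChain ((LaxData.fst B B').onChain c)).comp
        (G.onChain ((LaxData.snd B B').onChain c)).comp
  | _, _, _, .single f => 𝟙 (T.map (F.map f.1) (G.map f.2))
  | _, _, _, .cons f c => split c ▷ T.map (F.map f.1) (G.map f.2) ≫
      (S.tensorComp _ _ (F.map f.1) (G.map f.2)).hom

variable (K) [T.IsBilinear K]

/-- `φ ↦ ⌈1_{F (f₀ ∘ ⋯ ∘ f_m)} ⊗ φ(g₀, …, g_m)⌉`. -/
def leftTensor (m : ℕ) : G.Cochain m →ₗ[K] (S.tensorLax F G).Cochain m where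
  toFun φ X Y c := S.split F G c ≫
    T.map₂ (F.iter ((LaxData.fst B B').onChain c) ≫ F.map₂ ((LaxData.fst B B').iter c))
      (φ _ _ ((LaxData.snd B B').onChain c) ≫ G.map₂ ((LaxData.snd B B').iter c))
  map_add' φ φ' := by
    funext X Y c
    exact TensorFunctor.pad_right_add K ..
  map_smul' r φ := by
    funext X Y c
    exact TensorFunctor.pad_right_smul ..

/-- `φ ↦ ⌈φ(f₀, …, f_m) ⊗ 1_{G (g₀ ∘ ⋯ ∘ g_m)}⌉`. -/
def rightTensor (m : ℕ) : F.Cochain m →ₗ[K] (S.tensorLax F G).Cochain m where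
  toFun φ X Y c := S.split F G c ≫
    T.map₂ (φ _ _ ((LaxData.fst B B').onChain c) ≫ F.map₂ ((LaxData.fst B B').iter c))
      (G.iter ((LaxData.snd B B').onChain c) ≫ G.map₂ ((LaxData.snd B B').iter c))
  map_add' φ φ' := by
    funext X Y c
    exact TensorFunctor.pad_left_add K ..
  map_smul' r φ := by
    funext X Y c
    exact TensorFunctor.pad_left_smul ..

end

/-- The space `X^{m,n}` of the extended double complex. -/
abbrev DoubleCochain (m n : ℕ) : Type (max u v w) := (S.tens n).Cochain m

/-- The space of families of 2-morphisms
`id_{X₀ ⊗ ⋯ ⊗ X_n} ⟹ id_{X₀ ⊗ ⋯ ⊗ X_n}`, i.e. the `n`-th space of the general pentagonator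
complex. -/
abbrev PentCochain (n : ℕ) : Type (max u w) :=
  ∀ X : Tup C n, 𝟙 ((S.tens n).obj X) ⟶ 𝟙 ((S.tens n).obj X)

/-- The map `(φ n)(f) = n_{X'} ∘ 1_f - 1_f ∘ n_X` from the pentagonator complex to the first column
of the extended double complex. -/
def phi (K : Type uK) [CommRing K] [∀ X Y : C, Linear K (X ⟶ Y)] [LinearComposition K C] (n : ℕ) :
    S.PentCochain n →ₗ[K] S.DoubleCochain 0 n where
  toFun p X Y
    | .single f =>
      (ρ_ ((S.tens n).map f)).inv ≫ (S.tens n).map f ◁ p Y ≫ (ρ_ ((S.tens n).map f)).hom -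
        (λ_ ((S.tens n).map f)).inv ≫ p X ▷ (S.tens n).map f ≫ (λ_ ((S.tens n).map f)).hom
  map_add' p p' := by
    funext X Y c
    cases c with
    | single f =>
      change (ρ_ ((S.tens n).map f)).inv ≫ (S.tens n).map f ◁ (p Y + p' Y) ≫
            (ρ_ ((S.tens n).map f)).hom -
          (λ_ ((S.tens n).map f)).inv ≫ (p X + p' X) ▷ (S.tens n).map f ≫
            (λ_ ((S.tens n).map f)).hom =
        ((ρ_ ((S.tens n).map f)).inv ≫ (S.tens n).map f ◁ p Y ≫ (ρ_ ((S.tens n).map f)).hom -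
          (λ_ ((S.tens n).map f)).inv ≫ p X ▷ (S.tens n).map f ≫
            (λ_ ((S.tens n).map f)).hom) +
        ((ρ_ ((S.tens n).map f)).inv ≫ (S.tens n).map f ◁ p' Y ≫ (ρ_ ((S.tens n).map f)).hom -
          (λ_ ((S.tens n).map f)).inv ≫ p' X ▷ (S.tens n).map f ≫
            (λ_ ((S.tens n).map f)).hom)
      simp only [LinearComposition.whiskerLeft_add (K := K),
        LinearComposition.add_whiskerRight (K := K), Preadditive.add_comp, Preadditive.comp_add]
      abel
  map_smul' r p := by
    funext X Y c
    cases c with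
    | single f =>
      change (ρ_ ((S.tens n).map f)).inv ≫ (S.tens n).map f ◁ (r • p Y) ≫
            (ρ_ ((S.tens n).map f)).hom -
          (λ_ ((S.tens n).map f)).inv ≫ (r • p X) ▷ (S.tens n).map f ≫
            (λ_ ((S.tens n).map f)).hom =
        r • ((ρ_ ((S.tens n).map f)).inv ≫ (S.tens n).map f ◁ p Y ≫
            (ρ_ ((S.tens n).map f)).hom -
          (λ_ ((S.tens n).map f)).inv ≫ p X ▷ (S.tens n).map f ≫
            (λ_ ((S.tens n).map f)).hom)
      simp only [LinearComposition.whiskerLeft_smul,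
        LinearComposition.smul_whiskerRight, Linear.smul_comp, Linear.comp_smul, smul_sub]

/-- `n ↦ 1_{id_X} ⊗ n_Y`. -/
def pentLeft (K : Type uK) [CommRing K] [∀ X Y : C, Linear K (X ⟶ Y)] [T.IsBilinear K]
    (X Y : C) : (𝟙 Y ⟶ 𝟙 Y) →ₗ[K] (𝟙 (T.obj X Y) ⟶ 𝟙 (T.obj X Y)) where
  toFun p := (S.tensorId X Y).inv ≫ T.map₂ (𝟙 (𝟙 X)) p ≫ (S.tensorId X Y).hom
  map_add' p p' := by simp [TensorFunctor.IsBilinear.add_right K]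
  map_smul' r p := by simp [TensorFunctor.IsBilinear.smul_right]

/-- `n ↦ n_X ⊗ 1_{id_Y}`. -/
def pentRight (K : Type uK) [CommRing K] [∀ X Y : C, Linear K (X ⟶ Y)] [T.IsBilinear K]
    (X Y : C) : (𝟙 X ⟶ 𝟙 X) →ₗ[K] (𝟙 (T.obj X Y) ⟶ 𝟙 (T.obj X Y)) where
  toFun p := (S.tensorId X Y).inv ≫ T.map₂ p (𝟙 (𝟙 Y)) ≫ (S.tensorId X Y).hom
  map_add' p p' := by simp [TensorFunctor.IsBilinear.add_left K]
  map_smul' r p := by simp [TensorFunctor.IsBilinear.smul_left]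

end SemigroupalData

namespace SemigroupalStructure.IsGray

open SemigroupalData

variable [Bicategory.Strict C] {S : SemigroupalStructure T A} (hS : S.IsGray)

section

variable (K) [T.IsBilinear K]

/-- The vertical coboundary operator of the extended double complex. -/
def deltaV (m n : ℕ) : S.DoubleCochain m n →ₗ[K] S.DoubleCochain m (n + 1) :=
  let first : S.DoubleCochain m n →ₗ[K] S.DoubleCochain m (n + 1) :=
    S.leftTensor K (LaxData.id C) (S.tens n) m
  first +
    ∑ i : Fin (n + 1), (-1 : K) ^ (i.val + 1) • (hS.face_factors n i).pullback K m +
    (-1 : K) ^ (n + 2) • ((hS.unsnoc_factors n).pullback K m).comp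
      (S.rightTensor K (S.tens n) (LaxData.id C) m)

/-- The coboundary operator of the general pentagonator complex. -/
def deltaPent (n : ℕ) : S.PentCochain n →ₗ[K] S.PentCochain (n + 1) :=
  LinearMap.pi fun X : C × Tup C n =>
    (S.pentLeft K X.1 ((S.tens n).obj X.2)).comp (LinearMap.proj X.2) +
    ∑ i : Fin (n + 1), (-1 : K) ^ (i.val + 1) •
      (castHom₂ K ((hS.face_factors n i).obj X) ((hS.face_factors n i).obj X)
        (id_heq ((hS.face_factors n i).obj X)) (id_heq ((hS.face_factors n i).obj X))).comp
        (LinearMap.proj ((S.face n i).obj X)) +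
    (-1 : K) ^ (n + 2) •
      (castHom₂ K ((hS.unsnoc_factors n).obj X) ((hS.unsnoc_factors n).obj X)
        (id_heq ((hS.unsnoc_factors n).obj X)) (id_heq ((hS.unsnoc_factors n).obj X))).comp
        ((S.pentRight K ((S.tens n).obj ((unsnoc C n).obj X).1) ((unsnoc C n).obj X).2).comp
          (LinearMap.proj ((unsnoc C n).obj X).1))

end

end SemigroupalStructure.IsGray

namespace SemigroupalData

variable (S : SemigroupalData T A)

/-- The space `X_mod^{m,n}` of the modified extended double complex. -/
def ModCochain : ℕ → ℕ → Type (max u v w)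
  | 0, n => S.DoubleCochain 0 n × S.PentCochain (n + 1)
  | m + 1, n => S.DoubleCochain (m + 1) n

instance : ∀ m n : ℕ, AddCommGroup (S.ModCochain m n)
  | 0, n => inferInstanceAs (AddCommGroup (S.DoubleCochain 0 n × S.PentCochain (n + 1)))
  | m + 1, n => inferInstanceAs (AddCommGroup (S.DoubleCochain (m + 1) n))

instance : ∀ m n : ℕ, Module K (S.ModCochain m n)
  | 0, n => inferInstanceAs (Module K (S.DoubleCochain 0 n × S.PentCochain (n + 1)))
  | m + 1, n => inferInstanceAs (Module K (S.DoubleCochain (m + 1) n))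

/-- The submodule of natural special elements of `X_mod^{m,n}`. -/
def modSpecial (K : Type uK) [CommRing K] [∀ X Y : C, Linear K (X ⟶ Y)] :
    ∀ m n : ℕ, Submodule K (S.ModCochain m n)
  | 0, n => ((S.tens n).specialCochains K 0).prod
      (⊤ : Submodule K (S.PentCochain (n + 1)))
  | m + 1, n => (S.tens n).specialCochains K (m + 1)

/-- The horizontal coboundary operator of the modified extended double complex. -/
def deltaH' (K : Type uK) [CommRing K] [∀ X Y : C, Linear K (X ⟶ Y)] [LinearComposition K C] :
    ∀ m n : ℕ, S.ModCochain m n →ₗ[K] S.ModCochain (m + 1) n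
  | 0, n => ((S.tens n).delta K 0).comp
      (LinearMap.fst K (S.DoubleCochain 0 n) (S.PentCochain (n + 1)))
  | m + 1, n => (S.tens n).delta K (m + 1)

/-- The space of elements `x` of degree `q` of the total complex of the modified double complex;
`x ⟨(m, n), _⟩` is the component of bidegree
`(m, n + 1)`. -/
abbrev TotalCochain (q : ℕ) : Type (max u v w) :=
  ∀ p : {p : ℕ × ℕ // p.1 + (p.2 + 1) = q}, S.ModCochain p.1.1 (p.1.2 + 1)

/-- The component of bidegree `(m, n + 1)`. -/
def component (K : Type uK) [CommRing K] [∀ X Y : C, Linear K (X ⟶ Y)] {q : ℕ} (m n : ℕ)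
    (h : m + (n + 1) = q) : S.TotalCochain q →ₗ[K] S.ModCochain m (n + 1) :=
  LinearMap.proj (⟨(m, n), h⟩ : {p : ℕ × ℕ // p.1 + (p.2 + 1) = q})

/-- The submodule of natural special elements: the space `X_unit^q`. -/
def unitaryCochains (K : Type uK) [CommRing K] [∀ X Y : C, Linear K (X ⟶ Y)] (q : ℕ) :
    Submodule K (S.TotalCochain q) :=
  Submodule.pi Set.univ fun p => S.modSpecial K p.1.1 (p.1.2 + 1)

end SemigroupalData

namespace SemigroupalStructure.IsGray

open SemigroupalData

variable [Bicategory.Strict C] {S : SemigroupalStructure T A} (hS : S.IsGray)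
  [LinearComposition K C] [T.IsBilinear K]

variable (K) in
/-- The vertical coboundary operator of the modified extended double complex; in the first column
it is the coboundary operator `(φ, n) ↦ (δ_v φ + phi n, -δ_pent n)` of the cone of `phi`. -/
def deltaV' : ∀ m n : ℕ, S.ModCochain m n →ₗ[K] S.ModCochain m (n + 1)
  | 0, n => LinearMap.prod
      ((hS.deltaV K 0 n).coprod (S.phi K (n + 1)))
      ((-hS.deltaPent K (n + 1)).comp
        (LinearMap.snd K (S.DoubleCochain 0 n) (S.PentCochain (n + 1))))
  | m + 1, n => hS.deltaV K (m + 1) n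

variable (K) in
/-- The coboundary operator of the total complex of the modified double complex, which on the
component of bidegree `(m, n)` is `(-1)^n δ'_h + δ'_v`. -/
def deltaUnit (q : ℕ) : S.TotalCochain q →ₗ[K] S.TotalCochain (q + 1) :=
  LinearMap.pi fun
    | ⟨(0, 0), _⟩ => 0
    | ⟨(0, n + 1), h⟩ => (hS.deltaV' K 0 (n + 1)).comp
        (S.component K (q := q) 0 n (by simp only at h; omega))
    | ⟨(m + 1, 0), h⟩ => (-1 : K) ^ 1 • (S.deltaH' K m 1).comp
        (S.component K (q := q) m 0 (by simp only at h; omega))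
    | ⟨(m + 1, n + 1), h⟩ =>
      (-1 : K) ^ (n + 2) • (S.deltaH' K m (n + 2)).comp
        (S.component K (q := q) m (n + 1) (by simp only at h; omega)) +
      (hS.deltaV' K (m + 1) (n + 1)).comp
        (S.component K (q := q) (m + 1) n (by simp only at h; omega))

variable (K) in
/-- The cocycles of degree `q` of the unitary deformation complex. -/
def unitaryCocycles (q : ℕ) : Submodule K (S.TotalCochain q) :=
  S.unitaryCochains K q ⊓ LinearMap.ker (hS.deltaUnit K q)

variable (K) in
/-- The coboundaries of degree `q + 1` of the unitary deformation complex. -/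
def unitaryCoboundaries (q : ℕ) : Submodule K (S.TotalCochain (q + 1)) :=
  (S.unitaryCochains K q).map (hS.deltaUnit K q)

variable (K) in
/-- The cohomology in degree `q + 1` of the unitary deformation complex. -/
abbrev unitaryCohomology (q : ℕ) : Type (max u v w) :=
  hS.unitaryCocycles K (q + 1) ⧸
    (hS.unitaryCoboundaries K q).comap (hS.unitaryCocycles K (q + 1)).subtype

end SemigroupalStructure.IsGray

/-- The cochain of degree 2 formed by the first order terms of the structural 2-isomorphisms of a
first order unitary deformation. -/
def UnitaryDeformation.firstOrderTerm [Bicategory.Strict C] {S : SemigroupalStructure T A}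
    [LinearComposition K C] [T.IsBilinear K] (D : UnitaryDeformation K S) (hS : S.IsGray) : S.TotalCochain 2
  | ⟨(0, 0), h⟩ => absurd h (by simp; try omega)
  | ⟨(0, 1), _⟩ =>
    ((fun (X Y : C × (C × C)) (c : Chain (C × (C × C)) 0 X Y) =>
      match c with
      | .single f => castHom₂ K rfl (hS.tensor_assoc _ _ _).symm
          (((hS.a _ _ _).comp_heq _).trans (hS.map_assoc _ _ _)) ((hS.a _ _ _).heq_comp _)
          (D.assoc₁ f.1 f.2.1 f.2.2)),
     (fun X : C × (C × (C × C)) => castHom₂ K rfl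
        ((hS.tensor_assoc _ _ _).trans (hS.tensor_assoc _ _ _)).symm
        (hS.pent_src_heq _ _ _ _)
        ((heq_of_eq (hS.pent _ _ _ _).1.symm).trans (hS.pent_src_heq _ _ _ _))
        (D.pent₁ X.1 X.2.1 X.2.2.1 X.2.2.2)))
  | ⟨(0, n + 2), h⟩ => absurd h (by simp; try omega)
  | ⟨(1, 0), _⟩ => fun (X Z : C × C) (c : Chain (C × C) 1 X Z) =>
    match c with
    | .cons f' (.single f) => D.tensorComp₁ f.1 f.2 f'.1 f'.2
  | ⟨(1, n + 1), h⟩ => absurd h (by simp; try omega)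
  | ⟨(m + 2, n), h⟩ => absurd h (by simp; try omega)

end Complexes

end GrayDeformation

open GrayDeformation

set_option linter.unusedSectionVars false

/-! Every axiom of a semigroupal structure on the extension of scalars is an equation modulo ε². Its
constant coefficient is the same axiom for the undeformed structure and holds automatically; its
coefficient of ε is a K-linear equation in the first order terms. The theorem amounts to recognising
these linear equations.

In a Gray semigroup `⊗₀`, `a`, `â` and `π` are identities, and so is `⊗̂` as soon as one of its two
pairs consists of identities. An axiom pasted from cells of the form 1 + vε therefore says that two
sums of whiskered and tensored first order terms agree, since (1 + vε)(1 + v'ε) = 1 + (v + v')ε;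
only `⊗̂` on general pairs survives as a coefficient. Associativity of `⊗̂` gives the component of
the cocycle condition in bidegree (2,1), compatibility of `â` with composition the one in (1,2), the
modification axiom for `π` the one in (0,3), and the K₅ relation the pentagonator component.
Naturality of `⊗̂` and `â` is naturality of the cochains, and the unit axioms with undeformed `⊗₀`
say exactly that the cochains are special. Read forwards this is
`UnitaryDeformation.firstOrderTerm_mem`; read backwards it builds a deformation from any cocycle,
`exists_firstOrderTerm_eq`. The intermediate form of the cocycle condition is `IsCocycle`, with
`mem_unitaryCocycles_iff`.

The same expansion, applied to a semigroupal structure (ψ, ω) on the identity 2-functor that is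
trivial modulo ε, shows that its axioms say that the difference of the two first order terms is the
coboundary of the first order terms of ψ and ω (`isEquivalence_iff`, `axioms_iff`,
`equivalent_iff`). Equivalence is thus congruence modulo a submodule, hence an equivalence relation,
and its classes are those of cocycles modulo coboundaries. That coboundaries are cocycles
(`unitaryCoboundaries_le`) is the vanishing of the square of the total differential in degree 1,
checked block by block.

Strictness and the Gray conditions are equalities of objects and 1-morphisms, so the two sides of
most identities live in different, merely equal, hom-modules. All 2-morphisms are therefore compared
inside one module, the direct sum `CellSpace` of all hom-modules. There a 2-morphism is unchanged by
composition with identity cells, by whiskering with identity 1-morphisms and by `castHom₂`, while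
nothing is lost for parallel 2-morphisms (`cell_injective`). The operations `ver`, `hor` and `ten`
extend vertical composition, horizontal composition and the tensor product to bilinear maps on this
module. -/

namespace GrayDeformation

/-! ### Identity 2-morphisms and identity 1-morphisms, up to equality of their boundaries. -/

section Identities

variable {C : Type u} [Bicategory.{w, v} C]

namespace IsIdentityTwo

variable {X Y Z : C}

theorem id (f : X ⟶ Y) : IsIdentityTwo (𝟙 f) := ⟨rfl, rfl⟩

theorem eqToHom {f g : X ⟶ Y} (h : f = g) : IsIdentityTwo (CategoryTheory.eqToHom h) := ⟨h, rfl⟩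

theorem comp {f g h : X ⟶ Y} {η : f ⟶ g} {θ : g ⟶ h} (hη : IsIdentityTwo η)
    (hθ : IsIdentityTwo θ) : IsIdentityTwo (η ≫ θ) := by
  obtain ⟨rfl, rfl⟩ := hη
  obtain ⟨rfl, rfl⟩ := hθ
  exact ⟨rfl, by simp⟩

/-- Identity cells can be cancelled; this is how the unit axioms force structural cells to be
identities. -/
theorem of_comp {f g h : X ⟶ Y} {η : f ⟶ g} {θ : g ⟶ h} (h₁ : IsIdentityTwo (η ≫ θ))
    (h₂ : IsIdentityTwo θ) : IsIdentityTwo η := by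
  obtain ⟨rfl, rfl⟩ := h₂
  simpa using h₁

theorem inv {f g : X ⟶ Y} {η : f ≅ g} (hη : IsIdentityTwo η.hom) : IsIdentityTwo η.inv := by
  obtain ⟨rfl, h⟩ := hη
  refine ⟨rfl, ?_⟩
  have := η.hom_inv_id
  rw [h] at this
  simpa using this

theorem whiskerLeft (f : X ⟶ Y) {g h : Y ⟶ Z} {η : g ⟶ h} (hη : IsIdentityTwo η) :
    IsIdentityTwo (f ◁ η) := by
  obtain ⟨rfl, rfl⟩ := hη
  exact ⟨rfl, by simp⟩

theorem whiskerRight {f g : X ⟶ Y} {η : f ⟶ g} (hη : IsIdentityTwo η) (h : Y ⟶ Z) :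
    IsIdentityTwo (η ▷ h) := by
  obtain ⟨rfl, rfl⟩ := hη
  exact ⟨rfl, by simp⟩

theorem map₂ (T : TensorFunctor C) {X' Y' : C} {f f' : X ⟶ X'} {g g' : Y ⟶ Y'} {τ : f ⟶ f'}
    {σ : g ⟶ g'} (hτ : IsIdentityTwo τ) (hσ : IsIdentityTwo σ) : IsIdentityTwo (T.map₂ τ σ) := by
  obtain ⟨rfl, rfl⟩ := hτ
  obtain ⟨rfl, rfl⟩ := hσ
  exact ⟨rfl, T.map₂_id _ _⟩

/-- Any two `eqToHom` with the same boundary agree by proof irrelevance, so an axiom all of whose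
cells are identities needs no computation. -/
theorem eq {f g : X ⟶ Y} {η θ : f ⟶ g} (hη : IsIdentityTwo η) (hθ : IsIdentityTwo θ) : η = θ := by
  obtain ⟨_, rfl⟩ := hη
  obtain ⟨_, rfl⟩ := hθ
  rfl

variable [Bicategory.Strict C] {W : C}

theorem associator_hom (f : X ⟶ Y) (g : Y ⟶ Z) (h : Z ⟶ W) : IsIdentityTwo (α_ f g h).hom :=
  ⟨Strict.assoc f g h, by simp [Strict.associator_eqToIso]⟩

theorem associator_inv (f : X ⟶ Y) (g : Y ⟶ Z) (h : Z ⟶ W) : IsIdentityTwo (α_ f g h).inv :=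
  (associator_hom f g h).inv

theorem leftUnitor_hom (f : X ⟶ Y) : IsIdentityTwo (λ_ f).hom :=
  ⟨Strict.id_comp f, by simp [Strict.leftUnitor_eqToIso]⟩

theorem leftUnitor_inv (f : X ⟶ Y) : IsIdentityTwo (λ_ f).inv := (leftUnitor_hom f).inv

theorem rightUnitor_hom (f : X ⟶ Y) : IsIdentityTwo (ρ_ f).hom :=
  ⟨Strict.comp_id f, by simp [Strict.rightUnitor_eqToIso]⟩

theorem rightUnitor_inv (f : X ⟶ Y) : IsIdentityTwo (ρ_ f).inv := (rightUnitor_hom f).inv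

end IsIdentityTwo

/-- The coherence isomorphism between two 1-morphisms of a strict 2-category is an identity. -/
class CoherentIdentity {X Y : C} (f g : X ⟶ Y) [BicategoricalCoherence f g] : Prop where
  isIdentity : IsIdentityTwo (BicategoricalCoherence.iso (f := f) (g := g)).hom

namespace CoherentIdentity

variable [Bicategory.Strict C] {W X Y Z : C}

/-- Each of these instances follows one of those by which `BicategoricalCoherence` is found, so the
search that supplies the coherence cell of a `⊗≫` also certifies it as an identity. -/
instance refl (f : X ⟶ Y) : CoherentIdentity f f := ⟨.id f⟩

instance whiskerLeft (f : X ⟶ Y) (g h : Y ⟶ Z) [BicategoricalCoherence g h]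
    [H : CoherentIdentity g h] : CoherentIdentity (f ≫ g) (f ≫ h) := ⟨H.1.whiskerLeft f⟩

instance whiskerRight (f g : X ⟶ Y) (h : Y ⟶ Z) [BicategoricalCoherence f g]
    [H : CoherentIdentity f g] : CoherentIdentity (f ≫ h) (g ≫ h) := ⟨H.1.whiskerRight h⟩

instance assoc (f : W ⟶ X) (g : X ⟶ Y) (h : Y ⟶ Z) (i : W ⟶ Z)
    [BicategoricalCoherence (f ≫ g ≫ h) i] [H : CoherentIdentity (f ≫ g ≫ h) i] :
    CoherentIdentity ((f ≫ g) ≫ h) i :=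
  ⟨(IsIdentityTwo.associator_hom f g h).comp H.1⟩

instance assoc' (f : W ⟶ X) (g : X ⟶ Y) (h : Y ⟶ Z) (i : W ⟶ Z)
    [BicategoricalCoherence i (f ≫ g ≫ h)] [H : CoherentIdentity i (f ≫ g ≫ h)] :
    CoherentIdentity i ((f ≫ g) ≫ h) :=
  ⟨H.1.comp (IsIdentityTwo.associator_inv f g h)⟩

end CoherentIdentity

namespace IsIdentityOne

theorem id (X : C) : IsIdentityOne (𝟙 X) := ⟨rfl, HEq.rfl⟩

theorem comp [Bicategory.Strict C] {X Y Z : C} {f : X ⟶ Y} {g : Y ⟶ Z} (hf : IsIdentityOne f)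
    (hg : IsIdentityOne g) : IsIdentityOne (f ≫ g) := by
  obtain ⟨rfl, hf⟩ := hf
  obtain ⟨rfl, hg⟩ := hg
  obtain rfl := eq_of_heq hf
  obtain rfl := eq_of_heq hg
  exact ⟨rfl, heq_of_eq (Strict.id_comp _)⟩

theorem map {T : TensorFunctor C} {A : AssociatorCells T} {S : SemigroupalStructure T A}
    (hS : S.IsGray) {X X' Y Y' : C} {f : X ⟶ X'} {g : Y ⟶ Y'} (hf : IsIdentityOne f)
    (hg : IsIdentityOne g) : IsIdentityOne (T.map f g) := by
  obtain ⟨rfl, hf⟩ := hf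
  obtain ⟨rfl, hg⟩ := hg
  obtain rfl := eq_of_heq hf
  obtain rfl := eq_of_heq hg
  exact ⟨rfl, heq_of_eq (hS.map_id _ _)⟩

end IsIdentityOne

end Identities

/-! ### One module containing all 2-morphisms, with bilinear composition and tensor product. -/

section CellSpace

/-- The index of a module of 2-morphisms: a pair of parallel 1-morphisms. -/
structure CellIndex (C : Type u) [Bicategory.{w, v} C] : Type (max u v) where
  {src tgt : C}
  dom : src ⟶ tgt
  cod : src ⟶ tgt

variable (K : Type uK) [CommRing K] (C : Type u) [Bicategory.{w, v} C]
  [∀ X Y : C, Preadditive (X ⟶ Y)] [∀ X Y : C, Linear K (X ⟶ Y)]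

/-- The direct sum of all the modules of 2-morphisms of `C`. -/
abbrev CellSpace : Type (max u v w) := DirectSum (CellIndex C) fun i => i.dom ⟶ i.cod

variable {C}

open Classical in
/-- A 2-morphism, as an element of the direct sum of all the modules of 2-morphisms. -/
noncomputable def cell {X Y : C} {f g : X ⟶ Y} : (f ⟶ g) →ₗ[K] CellSpace C :=
  DirectSum.lof K (CellIndex C) (fun i => i.dom ⟶ i.cod) ⟨f, g⟩

/-- The summand is fixed by the boundary, so equalities of parallel 2-morphisms may be proved after
applying `cell`. -/
theorem cell_injective {X Y : C} {f g : X ⟶ Y} :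
    Function.Injective (cell K : (f ⟶ g) →ₗ[K] CellSpace C) := by
  classical
  exact DirectSum.of_injective (β := fun i : CellIndex C => i.dom ⟶ i.cod) ⟨f, g⟩

@[simp]
-- The summand depends only on the boundary, and equal boundaries give the same summand; transports
-- disappear from every computation.
theorem cell_castHom₂ {X X' Y Y' : C} {f g : X ⟶ Y} {f' g' : X' ⟶ Y'} (hX : X = X') (hY : Y = Y')
    (hf : HEq f f') (hg : HEq g g') (η : f ⟶ g) :
    cell K (castHom₂ K hX hY hf hg η) = cell K η := by
  subst hX hY hf hg
  rfl

variable {K}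

/-- Used repeatedly, it reduces multilinear identities such as associativity to single 2-morphisms.
-/
theorem CellSpace.ext {M : Type*} [AddCommGroup M] [Module K M] {L L' : CellSpace C →ₗ[K] M}
    (h : ∀ {X Y : C} {f g : X ⟶ Y} (η : f ⟶ g), L (cell K η) = L' (cell K η)) : L = L' := by
  classical
  exact DirectSum.linearMap_ext K fun i => LinearMap.ext fun η => h η

variable (K) in
open Classical in
/-- The bilinear map on the direct sum of all the modules of 2-morphisms given by its components. -/
noncomputable def cellLift (B : ∀ i j : CellIndex C, (i.dom ⟶ i.cod) →ₗ[K] (j.dom ⟶ j.cod) →ₗ[K] CellSpace C) :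
    CellSpace C →ₗ[K] CellSpace C →ₗ[K] CellSpace C :=
  DirectSum.toModule K _ _ fun i =>
    (DirectSum.toModule K _ _ fun j => (B i j).flip).flip

theorem cellLift_cell
    (B : ∀ i j : CellIndex C, (i.dom ⟶ i.cod) →ₗ[K] (j.dom ⟶ j.cod) →ₗ[K] CellSpace C)
    {X Y X' Y' : C} {f g : X ⟶ Y} {f' g' : X' ⟶ Y'} (η : f ⟶ g) (θ : f' ⟶ g') :
    cellLift K B (cell K η) (cell K θ) = B ⟨f, g⟩ ⟨f', g'⟩ η θ := by
  classical
  unfold cellLift cell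
  rw [DirectSum.toModule_lof, LinearMap.flip_apply]
  exact congrArg (fun L => L η) (DirectSum.toModule_lof K (φ := fun j : CellIndex C =>
    (B ⟨f, g⟩ j).flip) ⟨f', g'⟩ θ)

open Classical in
/-- The components of the vertical composition. -/
noncomputable def verComponent (i j : CellIndex C) :
    (i.dom ⟶ i.cod) →ₗ[K] (j.dom ⟶ j.cod) →ₗ[K] CellSpace C :=
  if h : i.src = j.src ∧ i.tgt = j.tgt ∧ HEq i.cod j.dom then by
    obtain ⟨f, g⟩ := i
    obtain ⟨f', g'⟩ := j
    dsimp only at h ⊢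
    obtain ⟨rfl, rfl, h⟩ := h
    obtain rfl := eq_of_heq h
    exact (Linear.comp (S := K) f g g').compr₂ (cell K)
  else 0

variable (K) in
/-- Vertical composition, extended by zero to a bilinear map. -/
noncomputable def ver : CellSpace C →ₗ[K] CellSpace C →ₗ[K] CellSpace C := cellLift K verComponent

theorem ver_cell {X Y : C} {f g h : X ⟶ Y} (η : f ⟶ g) (θ : g ⟶ h) :
    ver K (cell K η) (cell K θ) = cell K (η ≫ θ) := by
  rw [ver, cellLift_cell, verComponent, dif_pos ⟨rfl, rfl, HEq.rfl⟩]
  rfl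

variable (K) in
/-- The identity 2-morphism of a 1-morphism. -/
noncomputable abbrev cellId {X Y : C} (f : X ⟶ Y) : CellSpace C := cell K (𝟙 f)

section

variable (T : TensorFunctor C) [T.IsBilinear K]

variable (K) in
/-- The tensor product of 2-morphisms, extended to a bilinear map. -/
noncomputable def ten : CellSpace C →ₗ[K] CellSpace C →ₗ[K] CellSpace C :=
  cellLift K fun i j => LinearMap.mk₂ K
    (fun (τ : i.dom ⟶ i.cod) (σ : j.dom ⟶ j.cod) => cell K (T.map₂ τ σ))
    (by intros; simp [TensorFunctor.IsBilinear.add_left K])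
    (by intros; simp [TensorFunctor.IsBilinear.smul_left])
    (by intros; simp [TensorFunctor.IsBilinear.add_right K])
    (by intros; simp [TensorFunctor.IsBilinear.smul_right])

theorem ten_cell {X X' Y Y' : C} {f f' : X ⟶ X'} {g g' : Y ⟶ Y'} (τ : f ⟶ f') (σ : g ⟶ g') :
    ten K T (cell K τ) (cell K σ) = cell K (T.map₂ τ σ) := by
  rw [ten, cellLift_cell]
  rfl

theorem ten_cellId {X X' Y Y' : C} (f : X ⟶ X') (g : Y ⟶ Y') :
    ten K T (cellId K f) (cellId K g) = cellId K (T.map f g) := by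
  rw [ten_cell, T.map₂_id]

end

section

variable [LinearComposition K C]

open Classical in
/-- The components of the horizontal composition. -/
noncomputable def horComponent (i j : CellIndex C) :
    (i.dom ⟶ i.cod) →ₗ[K] (j.dom ⟶ j.cod) →ₗ[K] CellSpace C :=
  if h : i.tgt = j.src then by
    obtain ⟨f, g⟩ := i
    obtain ⟨f', g'⟩ := j
    dsimp only at h ⊢
    obtain rfl := h
    exact LinearMap.mk₂ K (fun η θ => cell K (hcomp η θ))
      (by intros; simp [hcomp, LinearComposition.add_whiskerRight (K := K)])
      (by intros; simp [hcomp, LinearComposition.smul_whiskerRight])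
      (by intros; simp [hcomp, LinearComposition.whiskerLeft_add (K := K)])
      (by intros; simp [hcomp, LinearComposition.whiskerLeft_smul])
  else 0

variable (K) in
/-- Horizontal composition, extended by zero to a bilinear map. -/
noncomputable def hor : CellSpace C →ₗ[K] CellSpace C →ₗ[K] CellSpace C := cellLift K horComponent

theorem hor_cell {X Y Z : C} {f f' : X ⟶ Y} {g g' : Y ⟶ Z} (η : f ⟶ f') (θ : g ⟶ g') :
    hor K (cell K η) (cell K θ) = cell K (hcomp η θ) := by
  rw [hor, cellLift_cell, horComponent, dif_pos rfl]
  rfl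

theorem hor_cellId_cell {X Y Z : C} (f : X ⟶ Y) {g g' : Y ⟶ Z} (θ : g ⟶ g') :
    hor K (cellId K f) (cell K θ) = cell K (f ◁ θ) := by
  simp [cellId, hor_cell, hcomp]

theorem hor_cell_cellId {X Y Z : C} {f f' : X ⟶ Y} (η : f ⟶ f') (g : Y ⟶ Z) :
    hor K (cell K η) (cellId K g) = cell K (η ▷ g) := by
  simp [cellId, hor_cell, hcomp]

end

section

variable {X Y Z : C}

/-- Substituting the equality behind `e` turns it into an identity. The lemmas that follow absorb
identity cells in other positions in the same way. -/
theorem cell_comp_identity {f g h : X ⟶ Y} (η : f ⟶ g) {e : g ⟶ h} (he : IsIdentityTwo e) :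
    cell K (η ≫ e) = cell K η := by
  obtain ⟨rfl, rfl⟩ := he
  simp

theorem cell_comp_comp_identity {f g h i : X ⟶ Y} (η : f ⟶ g) (θ : g ⟶ h) {e : h ⟶ i}
    (he : IsIdentityTwo e) : cell K (η ≫ θ ≫ e) = cell K (η ≫ θ) := by
  obtain ⟨rfl, rfl⟩ := he
  simp

theorem cell_identity_comp {f g h : X ⟶ Y} {e : f ⟶ g} (he : IsIdentityTwo e) (η : g ⟶ h) :
    cell K (e ≫ η) = cell K η := by
  obtain ⟨rfl, rfl⟩ := he
  simp

theorem cell_identity {f g : X ⟶ Y} {e : f ⟶ g} (he : IsIdentityTwo e) :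
    cell K e = cellId K f := by
  obtain ⟨rfl, rfl⟩ := he
  rfl

theorem cellId_congr {X X' Y Y' : C} {f : X ⟶ Y} {f' : X' ⟶ Y'} (hX : X = X') (hY : Y = Y')
    (hf : HEq f f') : cellId K f = cellId K f' := by
  subst hX hY hf
  rfl

theorem cellId_comp_identity [Bicategory.Strict C] (f : X ⟶ Y) {g : Y ⟶ Z} (hg : IsIdentityOne g) :
    cellId K (f ≫ g) = cellId K f :=
  cellId_congr rfl hg.1.symm (hg.heq_comp f)

theorem cellId_identity_comp [Bicategory.Strict C] {f : X ⟶ Y} (hf : IsIdentityOne f) (g : Y ⟶ Z) :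
    cellId K (f ≫ g) = cellId K g :=
  cellId_congr hf.1 rfl (hf.comp_heq g)

/-- The 1-morphism `a` may connect objects that are only provably equal, as the associator does;
after substitution the unitors of a strict 2-category finish. -/
theorem cell_whiskerLeft_identity [Bicategory.Strict C] {a : X ⟶ Y} (ha : IsIdentityOne a)
    {f g : Y ⟶ Z} (η : f ⟶ g) : cell K (a ◁ η) = cell K η := by
  obtain ⟨rfl, ha⟩ := ha
  obtain rfl := eq_of_heq ha
  rw [id_whiskerLeft, cell_identity_comp (.leftUnitor_hom _),
    cell_comp_identity _ (.leftUnitor_inv _)]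

theorem cell_whiskerRight_identity [Bicategory.Strict C] {f g : X ⟶ Y} (η : f ⟶ g) {a : Y ⟶ Z}
    (ha : IsIdentityOne a) : cell K (η ▷ a) = cell K η := by
  obtain ⟨rfl, ha⟩ := ha
  obtain rfl := eq_of_heq ha
  rw [whiskerRight_id, cell_identity_comp (.rightUnitor_hom _),
    cell_comp_identity _ (.rightUnitor_inv _)]

end

end CellSpace
end GrayDeformation

namespace GrayDeformation

/-! ### Strictness of the first order extension, and calculus of cells 1 + vε. -/

section FirstOrderCalculus

variable {K : Type uK} [CommRing K] {C : Type u} [Bicategory.{w, v} C]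
  [∀ X Y : C, Preadditive (X ⟶ Y)] [∀ X Y : C, Linear K (X ⟶ Y)] [LinearComposition K C]

theorem FirstOrderHom₂.eqToHom_zero {X Y : FirstOrderExt K C} {f g : X ⟶ Y} (h : f = g) :
    FirstOrderHom₂.zero (eqToHom h) = eqToHom (congrArg FirstOrderHom.of h) := by
  subst h
  rfl

theorem FirstOrderHom₂.eqToHom_one {X Y : FirstOrderExt K C} {f g : X ⟶ Y} (h : f = g) :
    FirstOrderHom₂.one (eqToHom h) = 0 := by
  subst h
  rfl

/-- The constraints of the extension are `firstOrderIso` of those of `C`; this carries strictness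
from `C` to the extension. -/
theorem firstOrderIso_eqToIso {X Y : FirstOrderExt K C} {f g : X ⟶ Y}
    (h : FirstOrderHom.of f = FirstOrderHom.of g) (h' : f = g) :
    firstOrderIso (eqToIso h) = eqToIso h' := by
  subst h'
  rfl

instance [Bicategory.Strict C] : Bicategory.Strict (FirstOrderExt K C) where
  id_comp f := congrArg FirstOrderHom.mk (Strict.id_comp f.of)
  comp_id f := congrArg FirstOrderHom.mk (Strict.comp_id f.of)
  assoc f g h := congrArg FirstOrderHom.mk (Strict.assoc f.of g.of h.of)
  leftUnitor_eqToIso f :=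
    (congrArg firstOrderIso (Strict.leftUnitor_eqToIso f.of)).trans (firstOrderIso_eqToIso _ _)
  rightUnitor_eqToIso f :=
    (congrArg firstOrderIso (Strict.rightUnitor_eqToIso f.of)).trans (firstOrderIso_eqToIso _ _)
  associator_eqToIso f g h :=
    (congrArg firstOrderIso (Strict.associator_eqToIso f.of g.of h.of)).trans
      (firstOrderIso_eqToIso _ _)

theorem IsIdentityTwo.firstOrder {X Y : FirstOrderExt K C} {f g : X ⟶ Y} {η : f ⟶ g}
    (h₀ : IsIdentityTwo (FirstOrderHom₂.zero η)) (h₁ : FirstOrderHom₂.one η = 0) :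
    IsIdentityTwo η := by
  obtain ⟨h, h₀⟩ := h₀
  have h : f = g := congrArg FirstOrderHom.mk h
  refine ⟨h, FirstOrderHom₂.ext ?_ ?_⟩
  · rw [h₀, FirstOrderHom₂.eqToHom_zero]
  · rw [h₁, FirstOrderHom₂.eqToHom_one]

theorem IsIdentityOne.firstOrder {X Y : FirstOrderExt K C} {f : X ⟶ Y}
    (h : IsIdentityOne (FirstOrderHom.of f)) : IsIdentityOne f := by
  obtain ⟨X⟩ := X
  obtain ⟨Y⟩ := Y
  obtain ⟨f⟩ := f
  obtain ⟨h, hf⟩ := h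
  dsimp only at h hf
  subst h
  obtain rfl := eq_of_heq hf
  exact .id _

theorem IsIdentityOne.of {X Y : FirstOrderExt K C} {f : X ⟶ Y}
    (h : IsIdentityOne f) : IsIdentityOne (FirstOrderHom.of f) := by
  obtain ⟨rfl, h⟩ := h
  obtain rfl := eq_of_heq h
  exact .id _

variable (K) in
/-- The constant coefficient of a 2-morphism of the first order extension. -/
noncomputable abbrev cell₀ {X Y : FirstOrderExt K C} {f g : X ⟶ Y} (η : f ⟶ g) : CellSpace C :=
  cell K (FirstOrderHom₂.zero η)

variable (K) in
/-- The coefficient of `ε` of a 2-morphism of the first order extension. -/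
noncomputable abbrev cell₁ {X Y : FirstOrderExt K C} {f g : X ⟶ Y} (η : f ⟶ g) : CellSpace C :=
  cell K (FirstOrderHom₂.one η)

/-- The 2-morphism `η` of the first order extension is the sum of an identity and of `v • ε`. -/
def UnitCell {X Y : FirstOrderExt K C} {f g : X ⟶ Y} (η : f ⟶ g) (v : CellSpace C) : Prop :=
  IsIdentityTwo (FirstOrderHom₂.zero η) ∧ cell K (FirstOrderHom₂.one η) = v

theorem IsIdentityTwo.unitCell {X Y : FirstOrderExt K C} {f g : X ⟶ Y} {η : f ⟶ g}
    (h : IsIdentityTwo η) : UnitCell η 0 := by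
  obtain ⟨rfl, rfl⟩ := h
  exact ⟨.id _, map_zero _⟩

namespace UnitCell

variable {X Y Z : FirstOrderExt K C}

theorem isIdentityTwo {f g : X ⟶ Y} {η : f ⟶ g} (h : UnitCell η 0) : IsIdentityTwo η :=
  .firstOrder h.1 (cell_injective K (h.2.trans (map_zero _).symm))

/-- The constant coefficients agree automatically, both being identities. Every pasting axiom built
from such cells reduces through this to one linear equation. -/
theorem eq_iff {f g : X ⟶ Y} {η θ : f ⟶ g} {v v' : CellSpace C} (hη : UnitCell η v)
    (hθ : UnitCell θ v') : η = θ ↔ v = v' := by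
  rw [← hη.2, ← hθ.2]
  exact ⟨fun h => h ▸ rfl, fun h => FirstOrderHom₂.ext (hη.1.eq hθ.1) (cell_injective K h)⟩

/-- This is (1 + vε)(1 + v'ε) = 1 + (v + v')ε: vertical pasting becomes addition. -/
theorem comp {f g h : X ⟶ Y} {η : f ⟶ g} {θ : g ⟶ h} {v v' : CellSpace C} (hη : UnitCell η v)
    (hθ : UnitCell θ v') : UnitCell (η ≫ θ) (v + v') := by
  refine ⟨hη.1.comp hθ.1, ?_⟩
  change cell K (_ ≫ _ + _ ≫ _) = _
  rw [map_add, cell_identity_comp hη.1, cell_comp_identity _ hθ.1, hη.2, hθ.2, add_comm]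

theorem bicategoricalComp {f g g' h : X ⟶ Y} [BicategoricalCoherence g g']
    [H : CoherentIdentity g g'] {η : f ⟶ g} {θ : g' ⟶ h} {v v' : CellSpace C} (hη : UnitCell η v)
    (hθ : UnitCell θ v') : UnitCell (η ⊗≫ θ) (v + v') := by
  have := hη.comp (H.isIdentity.unitCell.comp hθ)
  rwa [zero_add] at this

theorem whiskerLeft (f : X ⟶ Y) {g h : Y ⟶ Z} {η : g ⟶ h} {v : CellSpace C} (hη : UnitCell η v) :
    UnitCell (f ◁ η) (hor K (cellId K (FirstOrderHom.of f)) v) :=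
  ⟨hη.1.whiskerLeft _, by rw [← hη.2, hor_cellId_cell]; rfl⟩

theorem whiskerRight {f g : X ⟶ Y} {η : f ⟶ g} {v : CellSpace C} (hη : UnitCell η v) (h : Y ⟶ Z) :
    UnitCell (η ▷ h) (hor K v (cellId K (FirstOrderHom.of h))) :=
  ⟨hη.1.whiskerRight _, by rw [← hη.2, hor_cell_cellId]; rfl⟩

variable [Bicategory.Strict C]

/-- Whiskering with the components of the associator or of ψ leaves the coefficient as it stands,
with no factor of `hor`. -/
theorem whiskerLeft_identity {f : X ⟶ Y} (hf : IsIdentityOne f) {g h : Y ⟶ Z} {η : g ⟶ h}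
    {v : CellSpace C} (hη : UnitCell η v) : UnitCell (f ◁ η) v :=
  ⟨hη.1.whiskerLeft _, by rw [← hη.2]; exact cell_whiskerLeft_identity hf.of _⟩

theorem whiskerRight_identity {f g : X ⟶ Y} {η : f ⟶ g} {v : CellSpace C} (hη : UnitCell η v)
    {h : Y ⟶ Z} (hh : IsIdentityOne h) : UnitCell (η ▷ h) v :=
  ⟨hη.1.whiskerRight _, by rw [← hη.2]; exact cell_whiskerRight_identity _ hh.of⟩

variable {T : TensorFunctor C} [T.IsBilinear K]

theorem map₂ {X' Y' : FirstOrderExt K C} {f f' : X ⟶ X'} {g g' : Y ⟶ Y'} {τ : f ⟶ f'} {σ : g ⟶ g'}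
    {v v' : CellSpace C} (hτ : UnitCell τ v) (hσ : UnitCell σ v') :
    UnitCell ((T.firstOrder K).map₂ τ σ) (ten K T (cellId K (FirstOrderHom.of f)) v' +
      ten K T v (cellId K (FirstOrderHom.of g))) := by
  refine ⟨.map₂ T hτ.1 hσ.1, (map_add (cell K) (T.map₂ _ _) (T.map₂ _ _)).trans ?_⟩
  rw [← ten_cell, ← ten_cell, cell_identity hτ.1, cell_identity hσ.1, hσ.2, hτ.2]

end UnitCell

end FirstOrderCalculus

/-! ### Consequences of the unit axioms when `⊗₀` is an identity. -/

section Unitary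

variable {C : Type u} [Bicategory.{w, v} C] [Bicategory.Strict C] {T : TensorFunctor C}
  {A : AssociatorCells T}

namespace SemigroupalStructure

variable (S : SemigroupalStructure T A)

/-- In the right unit axiom every cell other than `⊗̂` is an identity, so `⊗̂` is one by
cancellation. Applied to a deformation, this makes its first order term special; no cubicality is
used. -/
theorem tensorComp_isIdentityTwo_of_right (hS : ∀ X Y, IsIdentityTwo (S.tensorId X Y).hom)
    {X X' X'' Y Y' Y'' : C} (f : X ⟶ X') (g : Y ⟶ Y')
    {f' : X' ⟶ X''} {g' : Y' ⟶ Y''} (hf' : IsIdentityOne f') (hg' : IsIdentityOne g') :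
    IsIdentityTwo (S.tensorComp f g f' g').hom := by
  obtain ⟨rfl, hf'⟩ := hf'
  obtain ⟨rfl, hg'⟩ := hg'
  obtain rfl := eq_of_heq hf'
  obtain rfl := eq_of_heq hg'
  refine IsIdentityTwo.of_comp ?_ (.map₂ T (.rightUnitor_hom f) (.rightUnitor_hom g))
  rw [S.tensorComp_id]
  exact ((hS _ _).whiskerLeft _).comp (.rightUnitor_hom _)

theorem tensorComp_isIdentityTwo_of_left (hS : ∀ X Y, IsIdentityTwo (S.tensorId X Y).hom)
    {X X' X'' Y Y' Y'' : C} {f : X ⟶ X'} {g : Y ⟶ Y'}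
    (hf : IsIdentityOne f) (hg : IsIdentityOne g) (f' : X' ⟶ X'') (g' : Y' ⟶ Y'') :
    IsIdentityTwo (S.tensorComp f g f' g').hom := by
  obtain ⟨rfl, hf⟩ := hf
  obtain ⟨rfl, hg⟩ := hg
  obtain rfl := eq_of_heq hf
  obtain rfl := eq_of_heq hg
  refine IsIdentityTwo.of_comp ?_ (.map₂ T (.leftUnitor_hom f') (.leftUnitor_hom g'))
  rw [S.id_tensorComp]
  exact ((hS _ _).whiskerRight _).comp (.leftUnitor_hom _)

/-- The unit axiom of the pseudonatural transformation leaves `â` as its only cell not yet known to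
be an identity. -/
theorem assoc_isIdentityTwo (hS : ∀ X Y, IsIdentityTwo (S.tensorId X Y).hom)
    {X X' Y Y' Z Z' : C} {f : X ⟶ X'} {g : Y ⟶ Y'} {h : Z ⟶ Z'}
    (hf : IsIdentityOne f) (hg : IsIdentityOne g) (hh : IsIdentityOne h) :
    IsIdentityTwo (S.assoc f g h).hom := by
  obtain ⟨rfl, hf⟩ := hf
  obtain ⟨rfl, hg⟩ := hg
  obtain ⟨rfl, hh⟩ := hh
  obtain rfl := eq_of_heq hf
  obtain rfl := eq_of_heq hg
  obtain rfl := eq_of_heq hh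
  have e := S.assoc_id X Y Z
  refine IsIdentityTwo.of_comp ?_ ((((IsIdentityTwo.map₂ T (.id (𝟙 X)) (hS Y Z)).comp
    (hS X (T.obj Y Z))).whiskerRight (A.a X Y Z)).comp (.leftUnitor_hom _))
  rw [e]
  exact (((IsIdentityTwo.map₂ T (hS X Y) (.id _)).comp (hS _ _)).whiskerLeft _).comp
    (.rightUnitor_hom _)

end SemigroupalStructure
end Unitary
end GrayDeformation

namespace GrayDeformation

/-! ### The modification axiom and the K₅ relation at first order. -/

section Lift

variable {K : Type uK} [CommRing K] {C : Type u} [Bicategory.{w, v} C] [Bicategory.Strict C]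
  [∀ X Y : C, Preadditive (X ⟶ Y)] [∀ X Y : C, Linear K (X ⟶ Y)] [LinearComposition K C]
  {T : TensorFunctor C} [T.IsBilinear K] {A : AssociatorCells T}

/-- The identity of the source is replaced by a free parameter `c`, so that a composite such as `𝟙 ≫
f` can be recorded as `f`. -/
theorem IsIdentityTwo.unitCell_map₂ {X X' Y Y' : FirstOrderExt K C} {f f' : X ⟶ X'}
    {g g' : Y ⟶ Y'} {τ : f ⟶ f'} {σ : g ⟶ g'} {v : CellSpace C} (hτ : IsIdentityTwo τ)
    (hσ : UnitCell σ v) {c : CellSpace C} (hc : cellId K (FirstOrderHom.of f) = c) :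
    UnitCell ((T.firstOrder K).map₂ τ σ) (ten K T c v) := by
  subst hc
  have := hτ.unitCell.map₂ (T := T) hσ
  rwa [map_zero, LinearMap.zero_apply, add_zero] at this

theorem UnitCell.map₂_identity {X X' Y Y' : FirstOrderExt K C} {f f' : X ⟶ X'}
    {g g' : Y ⟶ Y'} {τ : f ⟶ f'} {σ : g ⟶ g'} {v : CellSpace C} (hτ : UnitCell τ v)
    (hσ : IsIdentityTwo σ) {c : CellSpace C} (hc : cellId K (FirstOrderHom.of g) = c) :
    UnitCell ((T.firstOrder K).map₂ τ σ) (ten K T v c) := by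
  subst hc
  have := hτ.map₂ (T := T) hσ.unitCell
  rwa [map_zero, zero_add] at this

/-- The structural 2-isomorphisms on the first order extension reduce to those of a Gray semigroup
modulo `ε`, and are identities on identities. -/
structure UnitaryLift (D : SemigroupalData (T.firstOrder K) (A.firstOrder K)) : Prop where
  tensorId (X Y : FirstOrderExt K C) : IsIdentityTwo (D.tensorId X Y).hom
  tensorComp_right {X X' X'' Y Y' Y'' : FirstOrderExt K C} (f : X ⟶ X') (g : Y ⟶ Y')
    {f' : X' ⟶ X''} {g' : Y' ⟶ Y''} (hf' : IsIdentityOne f') (hg' : IsIdentityOne g') :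
    IsIdentityTwo (D.tensorComp f g f' g').hom
  tensorComp_left {X X' X'' Y Y' Y'' : FirstOrderExt K C} {f : X ⟶ X'} {g : Y ⟶ Y'}
    (hf : IsIdentityOne f) (hg : IsIdentityOne g) (f' : X' ⟶ X'') (g' : Y' ⟶ Y'') :
    IsIdentityTwo (D.tensorComp f g f' g').hom
  assoc_identity {X X' Y Y' Z Z' : FirstOrderExt K C} {f : X ⟶ X'} {g : Y ⟶ Y'} {h : Z ⟶ Z'}
    (hf : IsIdentityOne f) (hg : IsIdentityOne g) (hh : IsIdentityOne h) :
    IsIdentityTwo (D.assoc f g h).hom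
  assoc {X X' Y Y' Z Z' : FirstOrderExt K C} (f : X ⟶ X') (g : Y ⟶ Y') (h : Z ⟶ Z') :
    IsIdentityTwo (FirstOrderHom₂.zero (D.assoc f g h).hom)
  pent (X Y Z W : FirstOrderExt K C) : IsIdentityTwo (FirstOrderHom₂.zero (D.pent X Y Z W).hom)

theorem IsIdentityTwo.cell₁ {X Y : FirstOrderExt K C} {f g : X ⟶ Y} {η : f ⟶ g}
    (h : IsIdentityTwo η) : cell₁ K η = 0 := h.unitCell.2

section

variable {S : SemigroupalStructure T A} (hS : S.IsGray)
include hS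

theorem SemigroupalStructure.IsGray.firstOrder_a (X Y Z : FirstOrderExt K C) :
    IsIdentityOne ((A.firstOrder K).a X Y Z) :=
  .firstOrder (hS.a _ _ _)

theorem SemigroupalStructure.IsGray.firstOrder_map {X X' Y Y' : FirstOrderExt K C} {f : X ⟶ X'}
    {g : Y ⟶ Y'} (hf : IsIdentityOne f) (hg : IsIdentityOne g) :
    IsIdentityOne ((T.firstOrder K).map f g) :=
  .firstOrder (.map hS hf.of hg.of)

end

namespace UnitaryLift

variable {D : SemigroupalData (T.firstOrder K) (A.firstOrder K)} (hD : UnitaryLift D)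
include hD

theorem unitCell_assoc {X X' Y Y' Z Z' : FirstOrderExt K C} (f : X ⟶ X') (g : Y ⟶ Y') (h : Z ⟶ Z') :
    UnitCell (D.assoc f g h).hom (cell₁ K (D.assoc f g h).hom) := ⟨hD.assoc f g h, rfl⟩

theorem unitCell_pent (X Y Z W : FirstOrderExt K C) :
    UnitCell (D.pent X Y Z W).hom (cell₁ K (D.pent X Y Z W).hom) := ⟨hD.pent X Y Z W, rfl⟩

/-- Both outer instances of `⊗̂` have a pair of identities, the first pair in the source and the
second in the target, so they contribute nothing to the coefficient. -/
theorem unitCell_paste₂₂ {X X' X'' V' Y Y' Y'' W' : FirstOrderExt K C}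
    {f : X ⟶ X'} {f' : X' ⟶ X''} {p : X ⟶ V'} {p' : V' ⟶ X''}
    {g : Y ⟶ Y'} {g' : Y' ⟶ Y''} {q : Y ⟶ W'} {q' : W' ⟶ Y''}
    {τ : f ≫ f' ⟶ p ≫ p'} {σ : g ≫ g' ⟶ q ≫ q'} {v : CellSpace C}
    (hf : IsIdentityOne f) (hg : IsIdentityOne g) (hp : IsIdentityOne p') (hq : IsIdentityOne q')
    (h : UnitCell ((T.firstOrder K).map₂ τ σ) v) : UnitCell (D.paste₂₂ τ σ) v := by
  have := (hD.tensorComp_left hf hg f' g').unitCell.comp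
    (h.comp (hD.tensorComp_right p q hp hq).inv.unitCell)
  rwa [zero_add, add_zero] at this

theorem tensorComp₃ {X₀ X₁ X₂ X₃ Y₀ Y₁ Y₂ Y₃ : FirstOrderExt K C} {f₁ : X₀ ⟶ X₁} {g₁ : Y₀ ⟶ Y₁}
    {f₂ : X₁ ⟶ X₂} {g₂ : Y₁ ⟶ Y₂} (f₃ : X₂ ⟶ X₃) (g₃ : Y₂ ⟶ Y₃)
    (hf₁ : IsIdentityOne f₁) (hg₁ : IsIdentityOne g₁)
    (hf₂ : IsIdentityOne f₂) (hg₂ : IsIdentityOne g₂) :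
    IsIdentityTwo (D.tensorComp₃ f₁ g₁ f₂ g₂ f₃ g₃).hom :=
  ((hD.tensorComp_left hf₂ hg₂ f₃ g₃).whiskerLeft _).comp (hD.tensorComp_left hf₁ hg₁ _ _)

theorem unitCell_paste₃₂ {X₀ X₁ X₂ X₃ Y₀ Y₁ Y₂ Y₃ V W : FirstOrderExt K C}
    {f₁ : X₀ ⟶ X₁} {f₂ : X₁ ⟶ X₂} {f₃ : X₂ ⟶ X₃} {p : X₀ ⟶ V} {p' : V ⟶ X₃}
    {g₁ : Y₀ ⟶ Y₁} {g₂ : Y₁ ⟶ Y₂} {g₃ : Y₂ ⟶ Y₃} {q : Y₀ ⟶ W} {q' : W ⟶ Y₃}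
    {τ : f₁ ≫ f₂ ≫ f₃ ⟶ p ≫ p'} {σ : g₁ ≫ g₂ ≫ g₃ ⟶ q ≫ q'} {v : CellSpace C}
    (hf₁ : IsIdentityOne f₁) (hg₁ : IsIdentityOne g₁)
    (hf₂ : IsIdentityOne f₂) (hg₂ : IsIdentityOne g₂)
    (hp : IsIdentityOne p') (hq : IsIdentityOne q')
    (h : UnitCell ((T.firstOrder K).map₂ τ σ) v) : UnitCell (D.paste₃₂ τ σ) v := by
  have := (hD.tensorComp₃ f₃ g₃ hf₁ hg₁ hf₂ hg₂).unitCell.comp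
    (h.comp (hD.tensorComp_right p q hp hq).inv.unitCell)
  rwa [zero_add, add_zero] at this

theorem unitCell_paste₃₃ {X₀ X₁ X₂ X₃ Y₀ Y₁ Y₂ Y₃ V₁ V₂ W₁ W₂ : FirstOrderExt K C}
    {f₁ : X₀ ⟶ X₁} {f₂ : X₁ ⟶ X₂} {f₃ : X₂ ⟶ X₃} {p₁ : X₀ ⟶ V₁} {p₂ : V₁ ⟶ V₂} {p₃ : V₂ ⟶ X₃}
    {g₁ : Y₀ ⟶ Y₁} {g₂ : Y₁ ⟶ Y₂} {g₃ : Y₂ ⟶ Y₃} {q₁ : Y₀ ⟶ W₁} {q₂ : W₁ ⟶ W₂} {q₃ : W₂ ⟶ Y₃}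
    {τ : f₁ ≫ f₂ ≫ f₃ ⟶ p₁ ≫ p₂ ≫ p₃} {σ : g₁ ≫ g₂ ≫ g₃ ⟶ q₁ ≫ q₂ ≫ q₃} {v : CellSpace C}
    (hf₁ : IsIdentityOne f₁) (hg₁ : IsIdentityOne g₁)
    (hf₂ : IsIdentityOne f₂) (hg₂ : IsIdentityOne g₂)
    (hp₁ : IsIdentityOne p₁) (hq₁ : IsIdentityOne q₁)
    (hp₂ : IsIdentityOne p₂) (hq₂ : IsIdentityOne q₂)
    (h : UnitCell ((T.firstOrder K).map₂ τ σ) v) : UnitCell (D.paste₃₃ τ σ) v := by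
  have := (hD.tensorComp₃ f₃ g₃ hf₁ hg₁ hf₂ hg₂).unitCell.comp
    (h.comp (hD.tensorComp₃ p₃ q₃ hp₁ hq₁ hp₂ hq₂).inv.unitCell)
  rwa [zero_add, add_zero] at this

variable {S : SemigroupalStructure T A} (hS : S.IsGray)
include hS

/-- Stated for bare structural data, so that it can be read from deformations to cocycles and back.
The whiskerings of `π` by products of general 1-morphisms are the only ones that leave a factor of
`hor`. -/
theorem pent_naturality_iff {X X' Y Y' Z Z' W W' : FirstOrderExt K C}
    (f : X ⟶ X') (g : Y ⟶ Y') (h : Z ⟶ Z') (k : W ⟶ W') :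
    ((D.pent X Y Z W).hom ▷ (T.firstOrder K).map ((T.firstOrder K).map ((T.firstOrder K).map f g) h) k ⊗≫
        (A.firstOrder K).a X Y ((T.firstOrder K).obj Z W) ◁ (D.assoc ((T.firstOrder K).map f g) h k).hom ⊗≫
        (D.assoc f g ((T.firstOrder K).map h k)).hom ▷
          (A.firstOrder K).a ((T.firstOrder K).obj X' Y') Z' W' ⊗≫ 𝟙 _ =
      𝟙 _ ⊗≫
        (T.firstOrder K).map (𝟙 X) ((A.firstOrder K).a Y Z W) ◁
          (A.firstOrder K).a X ((T.firstOrder K).obj Y Z) W ◁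
          D.paste₂₂ (D.assoc f g h).hom ((λ_ k).hom ≫ (ρ_ k).inv) ⊗≫
        (T.firstOrder K).map (𝟙 X) ((A.firstOrder K).a Y Z W) ◁
          (D.assoc f ((T.firstOrder K).map g h) k).hom ▷
          (T.firstOrder K).map ((A.firstOrder K).a X' Y' Z') (𝟙 W') ⊗≫
        D.paste₂₂ ((λ_ f).hom ≫ (ρ_ f).inv) (D.assoc g h k).hom ▷
          ((A.firstOrder K).a X' ((T.firstOrder K).obj Y' Z') W' ≫
            (T.firstOrder K).map ((A.firstOrder K).a X' Y' Z') (𝟙 W')) ⊗≫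
        (T.firstOrder K).map f ((T.firstOrder K).map g ((T.firstOrder K).map h k)) ◁
          (D.pent X' Y' Z' W').hom) ↔
      hor K (cell₁ K (D.pent X Y Z W).hom) (cellId K (T.map (T.map (T.map f.of g.of) h.of) k.of)) +
        cell₁ K (D.assoc ((T.firstOrder K).map f g) h k).hom +
        cell₁ K (D.assoc f g ((T.firstOrder K).map h k)).hom =
      ten K T (cell₁ K (D.assoc f g h).hom) (cellId K k.of) +
        cell₁ K (D.assoc f ((T.firstOrder K).map g h) k).hom +
        ten K T (cellId K f.of) (cell₁ K (D.assoc g h k).hom) +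
        hor K (cellId K (T.map f.of (T.map g.of (T.map h.of k.of))))
          (cell₁ K (D.pent X' Y' Z' W').hom) := by
  -- `a`, `m` and `i` certify the identity 1-morphisms met below: associators, tensor products of
  -- identities, and identities.
  have a := hS.firstOrder_a (K := K)
  have m {X X' Y Y' : FirstOrderExt K C} {f : X ⟶ X'} {g : Y ⟶ Y'} (hf : IsIdentityOne f) hg :=
    hS.firstOrder_map (K := K) hf (g := g) hg
  have i := IsIdentityOne.id (C := FirstOrderExt K C)
  have e₁ : cellId K (FirstOrderHom.of (𝟙 W ≫ k)) = cellId K k.of :=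
    cellId_identity_comp (i W).of k.of
  have e₂ : cellId K (FirstOrderHom.of (𝟙 X ≫ f)) = cellId K f.of :=
    cellId_identity_comp (i X).of f.of
  -- The summands of `v` and `v'` follow the right-nested factors of the two pastings one by one;
  -- the zeros come from the identity cells at the ends.
  refine (UnitCell.eq_iff
    (v := hor K (cell₁ K (D.pent X Y Z W).hom) (cellId K (T.map (T.map (T.map f.of g.of) h.of) k.of)) +
        (cell₁ K (D.assoc ((T.firstOrder K).map f g) h k).hom +
        (cell₁ K (D.assoc f g ((T.firstOrder K).map h k)).hom + 0)))
    (v' := 0 + (ten K T (cell₁ K (D.assoc f g h).hom) (cellId K k.of) +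
        (cell₁ K (D.assoc f ((T.firstOrder K).map g h) k).hom +
        (ten K T (cellId K f.of) (cell₁ K (D.assoc g h k).hom) +
        hor K (cellId K (T.map f.of (T.map g.of (T.map h.of k.of))))
          (cell₁ K (D.pent X' Y' Z' W').hom))))) ?_ ?_).trans ?_
  · refine ((hD.unitCell_pent X Y Z W).whiskerRight
      ((T.firstOrder K).map ((T.firstOrder K).map ((T.firstOrder K).map f g) h)
        k)).bicategoricalComp ?_
    refine ((hD.unitCell_assoc ((T.firstOrder K).map f g) h k).whiskerLeft_identity
      (a X Y _)).bicategoricalComp ?_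
    exact ((hD.unitCell_assoc f g ((T.firstOrder K).map h k)).whiskerRight_identity
      (a _ Z' W')).bicategoricalComp (IsIdentityTwo.id _).unitCell
  · refine (IsIdentityTwo.id _).unitCell.bicategoricalComp ?_
    refine (((hD.unitCell_paste₂₂ (a X Y Z) (i W) (a X' Y' Z') (i W')
      ((hD.unitCell_assoc f g h).map₂_identity
        ((IsIdentityTwo.leftUnitor_hom k).comp (.rightUnitor_inv k)) e₁)).whiskerLeft_identity
      (a X _ W)).whiskerLeft_identity (m (i X) (a Y Z W))).bicategoricalComp ?_
    refine (((hD.unitCell_assoc f ((T.firstOrder K).map g h) k).whiskerRight_identity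
      (m (a X' Y' Z') (i W'))).whiskerLeft_identity (m (i X) (a Y Z W))).bicategoricalComp ?_
    refine ((hD.unitCell_paste₂₂ (i X) (a Y Z W) (i X') (a Y' Z' W')
      (((IsIdentityTwo.leftUnitor_hom f).comp (.rightUnitor_inv f)).unitCell_map₂
        (hD.unitCell_assoc g h k) e₂)).whiskerRight_identity
      ((a _ _ _).comp (m (a _ _ _) (i _)))).bicategoricalComp ?_
    exact (hD.unitCell_pent X' Y' Z' W').whiskerLeft
      ((T.firstOrder K).map f ((T.firstOrder K).map g ((T.firstOrder K).map h k)))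
  · simp only [zero_add, add_zero, add_assoc]

/-- Each side of K₅ has three pentagonators. The instances of `â` and `⊗₀` have identity arguments,
hence are undeformed, and all whiskerings are by identities. -/
theorem pent_K₅_iff (X Y Z V U : FirstOrderExt K C) :
    (𝟙 ((T.firstOrder K).map (𝟙 X) ((T.firstOrder K).map (𝟙 Y) ((A.firstOrder K).a Z V U)) ≫ (T.firstOrder K).map (𝟙 X) ((A.firstOrder K).a Y ((T.firstOrder K).obj Z V) U) ≫
        (A.firstOrder K).a X ((T.firstOrder K).obj Y ((T.firstOrder K).obj Z V)) U ≫ (T.firstOrder K).map ((T.firstOrder K).map (𝟙 X) ((A.firstOrder K).a Y Z V)) (𝟙 U) ≫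
        (T.firstOrder K).map ((A.firstOrder K).a X ((T.firstOrder K).obj Y Z) V) (𝟙 U) ≫ (T.firstOrder K).map ((T.firstOrder K).map ((A.firstOrder K).a X Y Z) (𝟙 V)) (𝟙 U)) ⊗≫
      ((T.firstOrder K).map (𝟙 X) ((T.firstOrder K).map (𝟙 Y) ((A.firstOrder K).a Z V U)) ≫ (T.firstOrder K).map (𝟙 X) ((A.firstOrder K).a Y ((T.firstOrder K).obj Z V) U) ≫
        (A.firstOrder K).a X ((T.firstOrder K).obj Y ((T.firstOrder K).obj Z V)) U) ◁
          D.paste₃₂ (D.pent X Y Z V).hom (𝟙 U ◁ (λ_ (𝟙 U)).hom) ⊗≫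
      (T.firstOrder K).map (𝟙 X) ((T.firstOrder K).map (𝟙 Y) ((A.firstOrder K).a Z V U)) ◁ (D.pent X Y ((T.firstOrder K).obj Z V) U).hom ▷
          (T.firstOrder K).map ((A.firstOrder K).a ((T.firstOrder K).obj X Y) Z V) (𝟙 U) ⊗≫
      (D.assoc (𝟙 X) (𝟙 Y) ((A.firstOrder K).a Z V U)).inv ▷
          ((A.firstOrder K).a ((T.firstOrder K).obj X Y) ((T.firstOrder K).obj Z V) U ≫ (T.firstOrder K).map ((A.firstOrder K).a ((T.firstOrder K).obj X Y) Z V) (𝟙 U)) ⊗≫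
      (A.firstOrder K).a X Y ((T.firstOrder K).obj Z ((T.firstOrder K).obj V U)) ◁ (T.firstOrder K).map₂ (D.tensorId X Y).hom (𝟙 ((A.firstOrder K).a Z V U)) ▷
          ((A.firstOrder K).a ((T.firstOrder K).obj X Y) ((T.firstOrder K).obj Z V) U ≫ (T.firstOrder K).map ((A.firstOrder K).a ((T.firstOrder K).obj X Y) Z V) (𝟙 U)) ⊗≫
      (A.firstOrder K).a X Y ((T.firstOrder K).obj Z ((T.firstOrder K).obj V U)) ◁ (D.pent ((T.firstOrder K).obj X Y) Z V U).hom ⊗≫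
      𝟙 ((A.firstOrder K).a X Y ((T.firstOrder K).obj Z ((T.firstOrder K).obj V U)) ≫ (A.firstOrder K).a ((T.firstOrder K).obj X Y) Z ((T.firstOrder K).obj V U) ≫
        (A.firstOrder K).a ((T.firstOrder K).obj ((T.firstOrder K).obj X Y) Z) V U) =
    𝟙 _ ⊗≫
      ((T.firstOrder K).map (𝟙 X) ((T.firstOrder K).map (𝟙 Y) ((A.firstOrder K).a Z V U)) ≫ (T.firstOrder K).map (𝟙 X) ((A.firstOrder K).a Y ((T.firstOrder K).obj Z V) U)) ◁
          (D.assoc (𝟙 X) ((A.firstOrder K).a Y Z V) (𝟙 U)).hom ▷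
          ((T.firstOrder K).map ((A.firstOrder K).a X ((T.firstOrder K).obj Y Z) V) (𝟙 U) ≫ (T.firstOrder K).map ((T.firstOrder K).map ((A.firstOrder K).a X Y Z) (𝟙 V)) (𝟙 U)) ⊗≫
      D.paste₃₂ (𝟙 X ◁ (λ_ (𝟙 X)).hom) (D.pent Y Z V U).hom ▷
          ((A.firstOrder K).a X ((T.firstOrder K).obj ((T.firstOrder K).obj Y Z) V) U ≫ (T.firstOrder K).map ((A.firstOrder K).a X ((T.firstOrder K).obj Y Z) V) (𝟙 U) ≫
            (T.firstOrder K).map ((T.firstOrder K).map ((A.firstOrder K).a X Y Z) (𝟙 V)) (𝟙 U)) ⊗≫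
      (T.firstOrder K).map (𝟙 X) ((A.firstOrder K).a Y Z ((T.firstOrder K).obj V U)) ◁ (D.pent X ((T.firstOrder K).obj Y Z) V U).hom ▷
          (T.firstOrder K).map ((T.firstOrder K).map ((A.firstOrder K).a X Y Z) (𝟙 V)) (𝟙 U) ⊗≫
      ((T.firstOrder K).map (𝟙 X) ((A.firstOrder K).a Y Z ((T.firstOrder K).obj V U)) ≫ (A.firstOrder K).a X ((T.firstOrder K).obj Y Z) ((T.firstOrder K).obj V U)) ◁
          (D.assoc ((A.firstOrder K).a X Y Z) (𝟙 V) (𝟙 U)).hom ⊗≫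
      ((T.firstOrder K).map (𝟙 X) ((A.firstOrder K).a Y Z ((T.firstOrder K).obj V U)) ≫ (A.firstOrder K).a X ((T.firstOrder K).obj Y Z) ((T.firstOrder K).obj V U)) ◁
          (T.firstOrder K).map₂ (𝟙 ((A.firstOrder K).a X Y Z)) (D.tensorId V U).hom ▷ (A.firstOrder K).a ((T.firstOrder K).obj ((T.firstOrder K).obj X Y) Z) V U ⊗≫
      (D.pent X Y Z ((T.firstOrder K).obj V U)).hom ▷ (A.firstOrder K).a ((T.firstOrder K).obj ((T.firstOrder K).obj X Y) Z) V U ⊗≫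
      𝟙 _) ↔
      ten K T (cell₁ K (D.pent X Y Z V).hom) (cellId K (𝟙 U.as)) +
        cell₁ K (D.pent X Y ((T.firstOrder K).obj Z V) U).hom +
        cell₁ K (D.pent ((T.firstOrder K).obj X Y) Z V U).hom =
      ten K T (cellId K (𝟙 X.as)) (cell₁ K (D.pent Y Z V U).hom) +
        cell₁ K (D.pent X ((T.firstOrder K).obj Y Z) V U).hom +
        cell₁ K (D.pent X Y Z ((T.firstOrder K).obj V U)).hom := by
  have a := hS.firstOrder_a (K := K)
  have m {X X' Y Y' : FirstOrderExt K C} {f : X ⟶ X'} {g : Y ⟶ Y'} (hf : IsIdentityOne f) hg :=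
    hS.firstOrder_map (K := K) hf (g := g) hg
  have i := IsIdentityOne.id (C := FirstOrderExt K C)
  have e (Y : FirstOrderExt K C) :
      cellId K (FirstOrderHom.of (𝟙 Y ≫ 𝟙 Y ≫ 𝟙 Y)) = cellId K (𝟙 Y.as) :=
    (cellId_identity_comp (i Y).of _).trans (cellId_identity_comp (i Y).of _)
  -- The inner zeros are the cells of `â` and `⊗₀`, in the order of the pasting.
  refine (UnitCell.eq_iff
    (v := 0 + (ten K T (cell₁ K (D.pent X Y Z V).hom) (cellId K (𝟙 U.as)) +
      (cell₁ K (D.pent X Y ((T.firstOrder K).obj Z V) U).hom + (0 + (0 +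
      (cell₁ K (D.pent ((T.firstOrder K).obj X Y) Z V U).hom + 0))))))
    (v' := 0 + (0 + (ten K T (cellId K (𝟙 X.as)) (cell₁ K (D.pent Y Z V U).hom) +
      (cell₁ K (D.pent X ((T.firstOrder K).obj Y Z) V U).hom + (0 + (0 +
      (cell₁ K (D.pent X Y Z ((T.firstOrder K).obj V U)).hom + 0))))))) ?_ ?_).trans ?_
  · refine (IsIdentityTwo.id _).unitCell.bicategoricalComp ?_
    refine ((hD.unitCell_paste₃₂ (m (i X) (a Y Z V)) (i U) (a X _ V) (i U) (a _ Z V) (i U)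
      ((hD.unitCell_pent X Y Z V).map₂_identity
        ((IsIdentityTwo.leftUnitor_hom (𝟙 U)).whiskerLeft (𝟙 U)) (e U))).whiskerLeft_identity
      ((m (i X) (m (i Y) (a Z V U))).comp ((m (i X) (a Y _ U)).comp
        (a X _ U)))).bicategoricalComp ?_
    refine (((hD.unitCell_pent X Y _ U).whiskerRight_identity
      (m (a _ Z V) (i U))).whiskerLeft_identity (m (i X) (m (i Y) (a Z V U)))).bicategoricalComp ?_
    refine ((hD.assoc_identity (i X) (i Y) (a Z V U)).inv.whiskerRight
      _).unitCell.bicategoricalComp ?_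
    refine (((IsIdentityTwo.map₂ (T.firstOrder K) (hD.tensorId X Y) (.id _)).whiskerRight
      _).whiskerLeft _).unitCell.bicategoricalComp ?_
    exact ((hD.unitCell_pent _ Z V U).whiskerLeft_identity (a X Y _)).bicategoricalComp
      (IsIdentityTwo.id _).unitCell
  · refine (IsIdentityTwo.id _).unitCell.bicategoricalComp ?_
    refine (((hD.assoc_identity (i X) (a Y Z V) (i U)).whiskerRight
      _).whiskerLeft _).unitCell.bicategoricalComp ?_
    refine ((hD.unitCell_paste₃₂ (i X) (m (i Y) (a Z V U)) (i X) (a Y _ U) (i X) (a _ V U)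
      (((IsIdentityTwo.leftUnitor_hom (𝟙 X)).whiskerLeft (𝟙 X)).unitCell_map₂
        (hD.unitCell_pent Y Z V U) (e X))).whiskerRight_identity
      ((a X _ U).comp ((m (a X _ V) (i U)).comp
        (m (m (a X Y Z) (i V)) (i U))))).bicategoricalComp ?_
    refine (((hD.unitCell_pent X _ V U).whiskerRight_identity
      (m (m (a X Y Z) (i V)) (i U))).whiskerLeft_identity (m (i X) (a Y Z _))).bicategoricalComp ?_
    refine ((hD.assoc_identity (a X Y Z) (i V) (i U)).whiskerLeft
      _).unitCell.bicategoricalComp ?_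
    refine (((IsIdentityTwo.map₂ (T.firstOrder K) (.id _) (hD.tensorId V U)).whiskerRight
      _).whiskerLeft _).unitCell.bicategoricalComp ?_
    exact ((hD.unitCell_pent X Y Z _).whiskerRight_identity (a _ V U)).bicategoricalComp
      (IsIdentityTwo.id _).unitCell
  · simp only [zero_add, add_zero, add_assoc]

end UnitaryLift

end Lift
end GrayDeformation

namespace GrayDeformation

/-! ### The axioms for ω at first order. -/

section IdentityLift

variable {K : Type uK} [CommRing K] {C : Type u} [Bicategory.{w, v} C] [Bicategory.Strict C]
  [∀ X Y : C, Preadditive (X ⟶ Y)] [∀ X Y : C, Linear K (X ⟶ Y)] [LinearComposition K C]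
  {T : TensorFunctor C} [T.IsBilinear K] {A : AssociatorCells T}
  {D D' : SemigroupalStructure (T.firstOrder K) (A.firstOrder K)}
  {ψ : ∀ X Y : FirstOrderExt K C, (T.firstOrder K).obj X Y ⟶ (T.firstOrder K).obj X Y}

/-- The structure 2-isomorphisms of a semigroupal structure on the identity 2-functor of the first
order extension reduce to identities modulo `ε`, and are identities on identities. -/
structure UnitaryIdentityLift (P : IdentitySemigroupalData D D' ψ) : Prop where
  psi (X Y : FirstOrderExt K C) : IsIdentityOne (ψ X Y)
  nat {X X' Y Y' : FirstOrderExt K C} (f : X ⟶ X') (g : Y ⟶ Y') :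
    IsIdentityTwo (FirstOrderHom₂.zero (P.nat f g).hom)
  nat_identity {X X' Y Y' : FirstOrderExt K C} {f : X ⟶ X'} {g : Y ⟶ Y'} (hf : IsIdentityOne f)
    (hg : IsIdentityOne g) : IsIdentityTwo (P.nat f g).hom
  omega (X Y Z : FirstOrderExt K C) : IsIdentityTwo (FirstOrderHom₂.zero (P.omega X Y Z).hom)

namespace UnitaryIdentityLift

variable {P : IdentitySemigroupalData D D' ψ} (hP : UnitaryIdentityLift P)
include hP

theorem unitCell_nat {X X' Y Y' : FirstOrderExt K C} (f : X ⟶ X') (g : Y ⟶ Y') :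
    UnitCell (P.nat f g).hom (cell₁ K (P.nat f g).hom) := ⟨hP.nat f g, rfl⟩

theorem unitCell_omega (X Y Z : FirstOrderExt K C) :
    UnitCell (P.omega X Y Z).hom (cell₁ K (P.omega X Y Z).hom) := ⟨hP.omega X Y Z, rfl⟩

variable (hD : UnitaryLift D.toSemigroupalData) (hD' : UnitaryLift D'.toSemigroupalData)
  {S : SemigroupalStructure T A} (hS : S.IsGray)
include hD hD' hS

/-- The four occurrences of ψ become δ_v of its first order term, and the two whiskered ω become the
map `phi` from the pentagonator complex. -/
theorem omega_naturality_iff {X X' Y Y' Z Z' : FirstOrderExt K C}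
    (f : X ⟶ X') (g : Y ⟶ Y') (h : Z ⟶ Z') :
    ((P.omega X Y Z).hom ▷ (T.firstOrder K).map ((T.firstOrder K).map f g) h ⊗≫
        ((A.firstOrder K).a X Y Z ≫ (T.firstOrder K).map (ψ X Y) (𝟙 Z)) ◁ (P.nat ((T.firstOrder K).map f g) h).hom ⊗≫
        (A.firstOrder K).a X Y Z ◁ D'.paste₂₂ (P.nat f g).hom ((λ_ h).hom ≫ (ρ_ h).inv) ▷
          ψ ((T.firstOrder K).obj X' Y') Z' ⊗≫
        (D'.assoc f g h).hom ▷ ((T.firstOrder K).map (ψ X' Y') (𝟙 Z') ≫ ψ ((T.firstOrder K).obj X' Y') Z') ⊗≫ 𝟙 _ =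
      𝟙 _ ⊗≫
        ((T.firstOrder K).map (𝟙 X) (ψ Y Z) ≫ ψ X ((T.firstOrder K).obj Y Z)) ◁ (D.assoc f g h).hom ⊗≫
        (T.firstOrder K).map (𝟙 X) (ψ Y Z) ◁ (P.nat f ((T.firstOrder K).map g h)).hom ▷ (A.firstOrder K).a X' Y' Z' ⊗≫
        D'.paste₂₂ ((λ_ f).hom ≫ (ρ_ f).inv) (P.nat g h).hom ▷
          (ψ X' ((T.firstOrder K).obj Y' Z') ≫ (A.firstOrder K).a X' Y' Z') ⊗≫
        (T.firstOrder K).map f ((T.firstOrder K).map g h) ◁ (P.omega X' Y' Z').hom) ↔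
      hor K (cell₁ K (P.omega X Y Z).hom) (cellId K (T.map (T.map f.of g.of) h.of)) +
        cell₁ K (P.nat ((T.firstOrder K).map f g) h).hom +
        ten K T (cell₁ K (P.nat f g).hom) (cellId K h.of) +
        cell₁ K (D'.assoc f g h).hom =
      cell₁ K (D.assoc f g h).hom +
        cell₁ K (P.nat f ((T.firstOrder K).map g h)).hom +
        ten K T (cellId K f.of) (cell₁ K (P.nat g h).hom) +
        hor K (cellId K (T.map f.of (T.map g.of h.of))) (cell₁ K (P.omega X' Y' Z').hom) := by
  have a := hS.firstOrder_a (K := K)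
  have m {X X' Y Y' : FirstOrderExt K C} {f : X ⟶ X'} {g : Y ⟶ Y'} (hf : IsIdentityOne f) hg :=
    hS.firstOrder_map (K := K) hf (g := g) hg
  have i := IsIdentityOne.id (C := FirstOrderExt K C)
  have p := hP.psi
  have e {X Y : FirstOrderExt K C} {e : X ⟶ X} (he : IsIdentityOne e) (f : X ⟶ Y) :
      cellId K (FirstOrderHom.of (e ≫ f)) = cellId K f.of := cellId_identity_comp he.of f.of
  refine (UnitCell.eq_iff
    (v := hor K (cell₁ K (P.omega X Y Z).hom) (cellId K (T.map (T.map f.of g.of) h.of)) +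
        (cell₁ K (P.nat ((T.firstOrder K).map f g) h).hom +
        (ten K T (cell₁ K (P.nat f g).hom) (cellId K h.of) +
        (cell₁ K (D'.assoc f g h).hom + 0))))
    (v' := 0 + (cell₁ K (D.assoc f g h).hom +
        (cell₁ K (P.nat f ((T.firstOrder K).map g h)).hom +
        (ten K T (cellId K f.of) (cell₁ K (P.nat g h).hom) +
        hor K (cellId K (T.map f.of (T.map g.of h.of))) (cell₁ K (P.omega X' Y' Z').hom)))))
    ?_ ?_).trans ?_
  · refine ((hP.unitCell_omega X Y Z).whiskerRight
      ((T.firstOrder K).map ((T.firstOrder K).map f g) h)).bicategoricalComp ?_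
    refine ((hP.unitCell_nat ((T.firstOrder K).map f g) h).whiskerLeft_identity
      ((a X Y Z).comp (m (p X Y) (i Z)))).bicategoricalComp ?_
    refine (((hD'.unitCell_paste₂₂ (p X Y) (i Z) (p X' Y') (i Z')
      ((hP.unitCell_nat f g).map₂_identity ((IsIdentityTwo.leftUnitor_hom h).comp
        (.rightUnitor_inv h)) (e (i Z) h))).whiskerRight_identity (p _ Z')).whiskerLeft_identity
      (a X Y Z)).bicategoricalComp ?_
    exact ((hD'.unitCell_assoc f g h).whiskerRight_identity
      ((m (p X' Y') (i Z')).comp (p _ Z'))).bicategoricalComp (IsIdentityTwo.id _).unitCell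
  · refine (IsIdentityTwo.id _).unitCell.bicategoricalComp ?_
    refine ((hD.unitCell_assoc f g h).whiskerLeft_identity
      ((m (i X) (p Y Z)).comp (p X _))).bicategoricalComp ?_
    refine (((hP.unitCell_nat f ((T.firstOrder K).map g h)).whiskerRight_identity
      (a X' Y' Z')).whiskerLeft_identity (m (i X) (p Y Z))).bicategoricalComp ?_
    refine ((hD'.unitCell_paste₂₂ (i X) (p Y Z) (i X') (p Y' Z')
      (((IsIdentityTwo.leftUnitor_hom f).comp (.rightUnitor_inv f)).unitCell_map₂
        (hP.unitCell_nat g h) (e (i X) f))).whiskerRight_identity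
      ((p X' _).comp (a X' Y' Z'))).bicategoricalComp ?_
    exact (hP.unitCell_omega X' Y' Z').whiskerLeft
      ((T.firstOrder K).map f ((T.firstOrder K).map g h))
  · simp only [zero_add, add_zero, add_assoc]

/-- Here ψ enters only at identity 1-morphisms and drops out; what remains compares the two
pentagonators with the five faces of ω. -/
theorem omega_coherence_iff (X Y Z W : FirstOrderExt K C) :
    (𝟙 ((T.firstOrder K).map (𝟙 X) ((T.firstOrder K).map (𝟙 Y) (ψ Z W)) ≫ (T.firstOrder K).map (𝟙 X) (ψ Y ((T.firstOrder K).obj Z W)) ≫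
        ψ X ((T.firstOrder K).obj Y ((T.firstOrder K).obj Z W)) ≫ (T.firstOrder K).map (𝟙 X) ((A.firstOrder K).a Y Z W) ≫ (A.firstOrder K).a X ((T.firstOrder K).obj Y Z) W ≫
        (T.firstOrder K).map ((A.firstOrder K).a X Y Z) (𝟙 W)) ⊗≫
      ((T.firstOrder K).map (𝟙 X) ((T.firstOrder K).map (𝟙 Y) (ψ Z W)) ≫ (T.firstOrder K).map (𝟙 X) (ψ Y ((T.firstOrder K).obj Z W)) ≫
        ψ X ((T.firstOrder K).obj Y ((T.firstOrder K).obj Z W))) ◁ (D.pent X Y Z W).hom ⊗≫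
      (T.firstOrder K).map (𝟙 X) ((T.firstOrder K).map (𝟙 Y) (ψ Z W)) ◁ (P.omega X Y ((T.firstOrder K).obj Z W)).hom ▷
        (A.firstOrder K).a ((T.firstOrder K).obj X Y) Z W ⊗≫
      (D'.assoc (𝟙 X) (𝟙 Y) (ψ Z W)).inv ▷
        ((T.firstOrder K).map (ψ X Y) (𝟙 ((T.firstOrder K).obj Z W)) ≫ ψ ((T.firstOrder K).obj X Y) ((T.firstOrder K).obj Z W) ≫
          (A.firstOrder K).a ((T.firstOrder K).obj X Y) Z W) ⊗≫
      (A.firstOrder K).a X Y ((T.firstOrder K).obj Z W) ◁ P.chi X Y Z W ▷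
        (ψ ((T.firstOrder K).obj X Y) ((T.firstOrder K).obj Z W) ≫ (A.firstOrder K).a ((T.firstOrder K).obj X Y) Z W) ⊗≫
      ((A.firstOrder K).a X Y ((T.firstOrder K).obj Z W) ≫ (T.firstOrder K).map (ψ X Y) ((T.firstOrder K).map (𝟙 Z) (𝟙 W))) ◁
        (P.omega ((T.firstOrder K).obj X Y) Z W).hom ⊗≫
      (A.firstOrder K).a X Y ((T.firstOrder K).obj Z W) ◁ (D'.assoc (ψ X Y) (𝟙 Z) (𝟙 W)).inv ▷
        ((T.firstOrder K).map (ψ ((T.firstOrder K).obj X Y) Z) (𝟙 W) ≫ ψ ((T.firstOrder K).obj ((T.firstOrder K).obj X Y) Z) W) ⊗≫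
      𝟙 ((A.firstOrder K).a X Y ((T.firstOrder K).obj Z W) ≫ (A.firstOrder K).a ((T.firstOrder K).obj X Y) Z W ≫ (T.firstOrder K).map ((T.firstOrder K).map (ψ X Y) (𝟙 Z)) (𝟙 W) ≫
        (T.firstOrder K).map (ψ ((T.firstOrder K).obj X Y) Z) (𝟙 W) ≫ ψ ((T.firstOrder K).obj ((T.firstOrder K).obj X Y) Z) W) =
    𝟙 _ ⊗≫
      ((T.firstOrder K).map (𝟙 X) ((T.firstOrder K).map (𝟙 Y) (ψ Z W)) ≫ (T.firstOrder K).map (𝟙 X) (ψ Y ((T.firstOrder K).obj Z W))) ◁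
        (P.nat (𝟙 X) ((A.firstOrder K).a Y Z W)).hom ▷ ((A.firstOrder K).a X ((T.firstOrder K).obj Y Z) W ≫ (T.firstOrder K).map ((A.firstOrder K).a X Y Z) (𝟙 W)) ⊗≫
      D'.paste₃₃ (𝟙 (𝟙 X ≫ 𝟙 X ≫ 𝟙 X)) (P.omega Y Z W).hom ▷
        (ψ X ((T.firstOrder K).obj ((T.firstOrder K).obj Y Z) W) ≫ (A.firstOrder K).a X ((T.firstOrder K).obj Y Z) W ≫ (T.firstOrder K).map ((A.firstOrder K).a X Y Z) (𝟙 W)) ⊗≫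
      ((T.firstOrder K).map (𝟙 X) ((A.firstOrder K).a Y Z W) ≫ (T.firstOrder K).map (𝟙 X) ((T.firstOrder K).map (ψ Y Z) (𝟙 W))) ◁
        (P.omega X ((T.firstOrder K).obj Y Z) W).hom ▷ (T.firstOrder K).map ((A.firstOrder K).a X Y Z) (𝟙 W) ⊗≫
      (T.firstOrder K).map (𝟙 X) ((A.firstOrder K).a Y Z W) ◁ (D'.assoc (𝟙 X) (ψ Y Z) (𝟙 W)).inv ▷
        ((T.firstOrder K).map (ψ X ((T.firstOrder K).obj Y Z)) (𝟙 W) ≫ ψ ((T.firstOrder K).obj X ((T.firstOrder K).obj Y Z)) W ≫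
          (T.firstOrder K).map ((A.firstOrder K).a X Y Z) (𝟙 W)) ⊗≫
      ((T.firstOrder K).map (𝟙 X) ((A.firstOrder K).a Y Z W) ≫ (A.firstOrder K).a X ((T.firstOrder K).obj Y Z) W ≫
          (T.firstOrder K).map ((T.firstOrder K).map (𝟙 X) (ψ Y Z)) (𝟙 W) ≫ (T.firstOrder K).map (ψ X ((T.firstOrder K).obj Y Z)) (𝟙 W)) ◁
        (P.nat ((A.firstOrder K).a X Y Z) (𝟙 W)).hom ⊗≫
      ((T.firstOrder K).map (𝟙 X) ((A.firstOrder K).a Y Z W) ≫ (A.firstOrder K).a X ((T.firstOrder K).obj Y Z) W) ◁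
        D'.paste₃₃ (P.omega X Y Z).hom (𝟙 (𝟙 W ≫ 𝟙 W ≫ 𝟙 W)) ▷
        ψ ((T.firstOrder K).obj ((T.firstOrder K).obj X Y) Z) W ⊗≫
      (D'.pent X Y Z W).hom ▷ ((T.firstOrder K).map ((T.firstOrder K).map (ψ X Y) (𝟙 Z)) (𝟙 W) ≫
        (T.firstOrder K).map (ψ ((T.firstOrder K).obj X Y) Z) (𝟙 W) ≫ ψ ((T.firstOrder K).obj ((T.firstOrder K).obj X Y) Z) W) ⊗≫
      𝟙 _) ↔
      cell₁ K (D.pent X Y Z W).hom + cell₁ K (P.omega X Y ((T.firstOrder K).obj Z W)).hom +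
        cell₁ K (P.omega ((T.firstOrder K).obj X Y) Z W).hom =
      ten K T (cellId K (𝟙 X.as)) (cell₁ K (P.omega Y Z W).hom) +
        cell₁ K (P.omega X ((T.firstOrder K).obj Y Z) W).hom +
        ten K T (cell₁ K (P.omega X Y Z).hom) (cellId K (𝟙 W.as)) +
        cell₁ K (D'.pent X Y Z W).hom := by
  have a := hS.firstOrder_a (K := K)
  have m {X X' Y Y' : FirstOrderExt K C} {f : X ⟶ X'} {g : Y ⟶ Y'} (hf : IsIdentityOne f) hg :=
    hS.firstOrder_map (K := K) hf (g := g) hg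
  have i := IsIdentityOne.id (C := FirstOrderExt K C)
  have p := hP.psi
  have e (Y : FirstOrderExt K C) :
      cellId K (FirstOrderHom.of (𝟙 Y ≫ 𝟙 Y ≫ 𝟙 Y)) = cellId K (𝟙 Y.as) :=
    (cellId_identity_comp (i Y).of _).trans (cellId_identity_comp (i Y).of _)
  -- χ is pasted from ψ at identity 1-morphisms, from `⊗₀`, and from `⊗̂` with a pair of identities.
  have hchi : IsIdentityTwo (P.chi X Y Z W) :=
    (hD'.unitCell_paste₂₂ (m (i X) (i Y)) (p Z W) (i _) (p Z W)
      (((hP.nat_identity (i X) (i Y)).inv.comp ((hD.tensorId X Y).whiskerLeft _)).map₂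
        (T.firstOrder K) (((hD.tensorId Z W).inv.whiskerLeft _).comp
          (hP.nat_identity (i Z) (i W)))).unitCell).isIdentityTwo
  refine (UnitCell.eq_iff
    (v := 0 + (cell₁ K (D.pent X Y Z W).hom +
      (cell₁ K (P.omega X Y ((T.firstOrder K).obj Z W)).hom + (0 + (0 +
      (cell₁ K (P.omega ((T.firstOrder K).obj X Y) Z W).hom + (0 + 0)))))))
    (v' := 0 + (0 + (ten K T (cellId K (𝟙 X.as)) (cell₁ K (P.omega Y Z W).hom) +
      (cell₁ K (P.omega X ((T.firstOrder K).obj Y Z) W).hom + (0 + (0 +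
      (ten K T (cell₁ K (P.omega X Y Z).hom) (cellId K (𝟙 W.as)) +
      (cell₁ K (D'.pent X Y Z W).hom + 0)))))))) ?_ ?_).trans ?_
  · refine (IsIdentityTwo.id _).unitCell.bicategoricalComp ?_
    refine ((hD.unitCell_pent X Y Z W).whiskerLeft_identity ((m (i X) (m (i Y) (p Z W))).comp
      ((m (i X) (p Y _)).comp (p X _)))).bicategoricalComp ?_
    refine (((hP.unitCell_omega X Y _).whiskerRight_identity (a _ Z W)).whiskerLeft_identity
      (m (i X) (m (i Y) (p Z W)))).bicategoricalComp ?_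
    refine ((hD'.assoc_identity (i X) (i Y) (p Z W)).inv.whiskerRight
      _).unitCell.bicategoricalComp ?_
    refine ((hchi.whiskerRight _).whiskerLeft _).unitCell.bicategoricalComp ?_
    refine ((hP.unitCell_omega _ Z W).whiskerLeft_identity
      ((a X Y _).comp (m (p X Y) (m (i Z) (i W))))).bicategoricalComp ?_
    exact (((hD'.assoc_identity (p X Y) (i Z) (i W)).inv.whiskerRight
      _).whiskerLeft _).unitCell.bicategoricalComp (IsIdentityTwo.id _).unitCell
  · refine (IsIdentityTwo.id _).unitCell.bicategoricalComp ?_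
    refine (((hP.nat_identity (i X) (a Y Z W)).whiskerRight
      _).whiskerLeft _).unitCell.bicategoricalComp ?_
    refine ((hD'.unitCell_paste₃₃ (i X) (m (i Y) (p Z W)) (i X) (p Y _) (i X) (a Y Z W) (i X)
      (m (p Y Z) (i W)) ((IsIdentityTwo.id _).unitCell_map₂ (hP.unitCell_omega Y Z W)
        (e X))).whiskerRight_identity
      ((p X _).comp ((a X _ W).comp (m (a X Y Z) (i W))))).bicategoricalComp ?_
    refine (((hP.unitCell_omega X _ W).whiskerRight_identity
      (m (a X Y Z) (i W))).whiskerLeft_identity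
      ((m (i X) (a Y Z W)).comp (m (i X) (m (p Y Z) (i W))))).bicategoricalComp ?_
    refine (((hD'.assoc_identity (i X) (p Y Z) (i W)).inv.whiskerRight
      _).whiskerLeft _).unitCell.bicategoricalComp ?_
    refine ((hP.nat_identity (a X Y Z) (i W)).whiskerLeft _).unitCell.bicategoricalComp ?_
    refine (((hD'.unitCell_paste₃₃ (m (i X) (p Y Z)) (i W) (p X _) (i W) (a X Y Z) (i W)
      (m (p X Y) (i Z)) (i W) ((hP.unitCell_omega X Y Z).map₂_identity (IsIdentityTwo.id _)
        (e W))).whiskerRight_identity (p _ W)).whiskerLeft_identity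
      ((m (i X) (a Y Z W)).comp (a X _ W))).bicategoricalComp ?_
    exact ((hD'.unitCell_pent X Y Z W).whiskerRight_identity ((m (m (p X Y) (i Z)) (i W)).comp
      ((m (p _ Z) (i W)).comp (p _ W)))).bicategoricalComp (IsIdentityTwo.id _).unitCell
  · simp only [zero_add, add_zero, add_assoc]

end UnitaryIdentityLift

end IdentityLift
end GrayDeformation

namespace GrayDeformation

/-! ### Constant and ε-coefficients of arbitrary 2-morphisms of the extension. -/

section FirstOrderCoefficients

variable {K : Type uK} [CommRing K] {C : Type u} [Bicategory.{w, v} C]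
  [∀ X Y : C, Preadditive (X ⟶ Y)] [∀ X Y : C, Linear K (X ⟶ Y)] [LinearComposition K C]

variable {X Y Z : FirstOrderExt K C}

theorem FirstOrderHom₂.eq_iff_cell {f g : X ⟶ Y} {η θ : f ⟶ g} :
    η = θ ↔ cell₀ K η = cell₀ K θ ∧ cell₁ K η = cell₁ K θ :=
  ⟨fun h => h ▸ ⟨rfl, rfl⟩, fun h =>
    FirstOrderHom₂.ext (cell_injective K h.1) (cell_injective K h.2)⟩

theorem cell₀_comp {f g h : X ⟶ Y} (η : f ⟶ g) (θ : g ⟶ h) :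
    cell₀ K (η ≫ θ) = ver K (cell₀ K η) (cell₀ K θ) := (ver_cell _ _).symm

/-- The Leibniz rule of multiplication modulo ε²; horizontal composition and tensor product obey the
same rule. -/
theorem cell₁_comp {f g h : X ⟶ Y} (η : f ⟶ g) (θ : g ⟶ h) :
    cell₁ K (η ≫ θ) = ver K (cell₀ K η) (cell₁ K θ) + ver K (cell₁ K η) (cell₀ K θ) := by
  rw [ver_cell, ver_cell]
  exact map_add (cell K) _ _

theorem cell₀_whiskerLeft (f : X ⟶ Y) {g h : Y ⟶ Z} (η : g ⟶ h) :
    cell₀ K (f ◁ η) = hor K (cellId K (FirstOrderHom.of f)) (cell₀ K η) :=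
  (hor_cellId_cell _ _).symm

theorem cell₁_whiskerLeft (f : X ⟶ Y) {g h : Y ⟶ Z} (η : g ⟶ h) :
    cell₁ K (f ◁ η) = hor K (cellId K (FirstOrderHom.of f)) (cell₁ K η) :=
  (hor_cellId_cell _ _).symm

theorem cell₀_whiskerRight {f g : X ⟶ Y} (η : f ⟶ g) (h : Y ⟶ Z) :
    cell₀ K (η ▷ h) = hor K (cell₀ K η) (cellId K (FirstOrderHom.of h)) :=
  (hor_cell_cellId _ _).symm

theorem cell₁_whiskerRight {f g : X ⟶ Y} (η : f ⟶ g) (h : Y ⟶ Z) :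
    cell₁ K (η ▷ h) = hor K (cell₁ K η) (cellId K (FirstOrderHom.of h)) :=
  (hor_cell_cellId _ _).symm

theorem cell₀_hcomp {f f' : X ⟶ Y} {g g' : Y ⟶ Z} (η : f ⟶ f') (θ : g ⟶ g') :
    cell₀ K (hcomp η θ) = hor K (cell₀ K η) (cell₀ K θ) := (hor_cell _ _).symm

theorem cell₁_hcomp {f f' : X ⟶ Y} {g g' : Y ⟶ Z} (η : f ⟶ f') (θ : g ⟶ g') :
    cell₁ K (hcomp η θ) = hor K (cell₀ K η) (cell₁ K θ) + hor K (cell₁ K η) (cell₀ K θ) := by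
  rw [hor_cell, hor_cell]
  refine (map_add (cell K) _ _).trans (congrArg₂ (· + ·) rfl rfl)

theorem cell₀_comp_comp_identity {f g h i : X ⟶ Y} (η : f ⟶ g) (θ : g ⟶ h) {e : h ⟶ i}
    (he : IsIdentityTwo e) : cell₀ K (η ≫ θ ≫ e) = cell₀ K (η ≫ θ) := by
  obtain ⟨rfl, rfl⟩ := he
  rw [eqToHom_refl, Category.comp_id]

theorem cell₁_comp_comp_identity {f g h i : X ⟶ Y} (η : f ⟶ g) (θ : g ⟶ h) {e : h ⟶ i}
    (he : IsIdentityTwo e) : cell₁ K (η ≫ θ ≫ e) = cell₁ K (η ≫ θ) := by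
  obtain ⟨rfl, rfl⟩ := he
  rw [eqToHom_refl, Category.comp_id]

theorem cell₀_identity_comp {f g h : X ⟶ Y} {e : f ⟶ g} (he : IsIdentityTwo e) (η : g ⟶ h) :
    cell₀ K (e ≫ η) = cell₀ K η := by
  obtain ⟨rfl, rfl⟩ := he
  rw [eqToHom_refl, Category.id_comp]

theorem cell₁_identity_comp {f g h : X ⟶ Y} {e : f ⟶ g} (he : IsIdentityTwo e) (η : g ⟶ h) :
    cell₁ K (e ≫ η) = cell₁ K η := by
  obtain ⟨rfl, rfl⟩ := he
  rw [eqToHom_refl, Category.id_comp]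

theorem UnitCell.cell₀_comp {f g h : X ⟶ Y} {η : f ⟶ g} {v : CellSpace C} (hη : UnitCell η v)
    (θ : g ⟶ h) : cell₀ K (η ≫ θ) = cell₀ K θ := cell_identity_comp hη.1 _

theorem UnitCell.cell₁_comp {f g h : X ⟶ Y} {η : f ⟶ g} {v : CellSpace C} (hη : UnitCell η v)
    (θ : g ⟶ h) : cell₁ K (η ≫ θ) = cell₁ K θ + ver K v (cell₀ K θ) := by
  refine (map_add (cell K) _ _).trans ?_
  rw [cell_identity_comp hη.1, ← ver_cell, hη.2]

theorem UnitCell.cell₀_comp_left {f g h : X ⟶ Y} {θ : g ⟶ h} {v : CellSpace C}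
    (hθ : UnitCell θ v) (η : f ⟶ g) : cell₀ K (η ≫ θ) = cell₀ K η := cell_comp_identity _ hθ.1

theorem UnitCell.cell₁_comp_left {f g h : X ⟶ Y} {θ : g ⟶ h} {v : CellSpace C}
    (hθ : UnitCell θ v) (η : f ⟶ g) :
    cell₁ K (η ≫ θ) = ver K (cell₀ K η) v + cell₁ K η := by
  refine (map_add (cell K) _ _).trans ?_
  rw [cell_comp_identity _ hθ.1, ← ver_cell, hθ.2]

theorem cell₀_bicategoricalComp_identity {f g g' h : X ⟶ Y} [BicategoricalCoherence g g']
    [H : CoherentIdentity g g'] {η : f ⟶ g} {v : CellSpace C} (hη : UnitCell η v) (θ : g' ⟶ h) :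
    cell₀ K (η ⊗≫ θ) = cell₀ K θ :=
  (hη.cell₀_comp _).trans (H.isIdentity.unitCell.cell₀_comp _)

theorem cell₁_bicategoricalComp_identity {f g g' h : X ⟶ Y} [BicategoricalCoherence g g']
    [H : CoherentIdentity g g'] {η : f ⟶ g} {v : CellSpace C} (hη : UnitCell η v) (θ : g' ⟶ h) :
    cell₁ K (η ⊗≫ θ) = cell₁ K θ + ver K v (cell₀ K θ) := by
  refine (hη.cell₁_comp _).trans ?_
  rw [H.isIdentity.unitCell.cell₁_comp, H.isIdentity.unitCell.cell₀_comp, map_zero,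
    LinearMap.zero_apply, add_zero]

variable [Bicategory.Strict C]

theorem cell₀_whiskerLeft_identity {a : X ⟶ Y} (ha : IsIdentityOne a) {f g : Y ⟶ Z} (η : f ⟶ g) :
    cell₀ K (a ◁ η) = cell₀ K η := cell_whiskerLeft_identity ha.of _

theorem cell₁_whiskerLeft_identity {a : X ⟶ Y} (ha : IsIdentityOne a) {f g : Y ⟶ Z} (η : f ⟶ g) :
    cell₁ K (a ◁ η) = cell₁ K η := cell_whiskerLeft_identity ha.of _

theorem cell₀_whiskerRight_identity {f g : X ⟶ Y} (η : f ⟶ g) {a : Y ⟶ Z} (ha : IsIdentityOne a) :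
    cell₀ K (η ▷ a) = cell₀ K η := cell_whiskerRight_identity _ ha.of

theorem cell₁_whiskerRight_identity {f g : X ⟶ Y} (η : f ⟶ g) {a : Y ⟶ Z} (ha : IsIdentityOne a) :
    cell₁ K (η ▷ a) = cell₁ K η := cell_whiskerRight_identity _ ha.of

end FirstOrderCoefficients

/-! ### The tensor product as an associative bilinear operation. -/

section Tensor

variable {K : Type uK} [CommRing K] {C : Type u} [Bicategory.{w, v} C]
  [∀ X Y : C, Preadditive (X ⟶ Y)] [∀ X Y : C, Linear K (X ⟶ Y)] [LinearComposition K C]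
  {T : TensorFunctor C} [T.IsBilinear K] {A : AssociatorCells T}

theorem cell₀_map₂ {X X' Y Y' : FirstOrderExt K C} {f f' : X ⟶ X'} {g g' : Y ⟶ Y'} (τ : f ⟶ f')
    (σ : g ⟶ g') : cell₀ K ((T.firstOrder K).map₂ τ σ) = ten K T (cell₀ K τ) (cell₀ K σ) :=
  (ten_cell T _ _).symm

theorem cell₁_map₂ {X X' Y Y' : FirstOrderExt K C} {f f' : X ⟶ X'} {g g' : Y ⟶ Y'} (τ : f ⟶ f')
    (σ : g ⟶ g') : cell₁ K ((T.firstOrder K).map₂ τ σ) =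
      ten K T (cell₀ K τ) (cell₁ K σ) + ten K T (cell₁ K τ) (cell₀ K σ) := by
  rw [ten_cell, ten_cell]
  exact map_add (cell K) (T.map₂ _ _) (T.map₂ _ _)

theorem cell₀_id {X Y : FirstOrderExt K C} (f : X ⟶ Y) :
    cell₀ K (𝟙 f) = cellId K (FirstOrderHom.of f) := rfl

theorem cell₁_id {X Y : FirstOrderExt K C} (f : X ⟶ Y) : cell₁ K (𝟙 f) = 0 := map_zero _

namespace SemigroupalStructure

variable (S : SemigroupalStructure T A)

theorem tensorComp_naturality_cell {X X' X'' Y Y' Y'' : C} {f₁ f₂ : X ⟶ X'} {g₁ g₂ : Y ⟶ Y'}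
    {f₁' f₂' : X' ⟶ X''} {g₁' g₂' : Y' ⟶ Y''}
    (τ : f₁ ⟶ f₂) (σ : g₁ ⟶ g₂) (τ' : f₁' ⟶ f₂') (σ' : g₁' ⟶ g₂') :
    ver K (cell K (S.tensorComp f₁ g₁ f₁' g₁').hom)
        (ten K T (hor K (cell K τ) (cell K τ')) (hor K (cell K σ) (cell K σ'))) =
      ver K (hor K (ten K T (cell K τ) (cell K σ)) (ten K T (cell K τ') (cell K σ')))
        (cell K (S.tensorComp f₂ g₂ f₂' g₂').hom) := by
  rw [hor_cell, hor_cell, ten_cell, ten_cell, ten_cell, hor_cell, ver_cell, ver_cell,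
    S.tensorComp_naturality]

/-- This is the naturality of `â`, in which `â` and the 1-morphisms `a` are identities and can be
dropped. -/
theorem IsGray.map₂_assoc [Bicategory.Strict C] {S : SemigroupalStructure T A} (hS : S.IsGray)
    {X X' Y Y' Z Z' : C} {f₁ f₂ : X ⟶ X'} {g₁ g₂ : Y ⟶ Y'} {h₁ h₂ : Z ⟶ Z'}
    (τ : f₁ ⟶ f₂) (σ : g₁ ⟶ g₂) (η : h₁ ⟶ h₂) :
    cell K (T.map₂ (T.map₂ τ σ) η) = cell K (T.map₂ τ (T.map₂ σ η)) := by
  have h := congrArg (cell K) (S.assoc_naturality τ σ η)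
  rw [cell_identity_comp (hS.assoc _ _ _), cell_comp_identity _ (hS.assoc _ _ _),
    cell_whiskerLeft_identity (hS.a _ _ _), cell_whiskerRight_identity _ (hS.a _ _ _)] at h
  exact h.symm

theorem IsGray.ten_assoc [Bicategory.Strict C] {S : SemigroupalStructure T A} (hS : S.IsGray)
    (a b c : CellSpace C) : ten K T (ten K T a b) c = ten K T a (ten K T b c) := by
  -- Both sides are written as trilinear maps, so that it suffices to compare them on cells.
  have h : (ten K T).compr₂ (ten K T) =
      (LinearMap.lcomp K _ (ten K T)).comp ((LinearMap.llcomp K _ _ _).comp (ten K T)) := by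
    refine CellSpace.ext fun τ => CellSpace.ext fun σ => CellSpace.ext fun η => ?_
    simp only [LinearMap.compr₂_apply, LinearMap.comp_apply, LinearMap.lcomp_apply',
      LinearMap.llcomp_apply]
    rw [ten_cell, ten_cell, ten_cell, ten_cell, hS.map₂_assoc]
  exact congrArg (fun L => L a b c) h

end SemigroupalStructure

end Tensor

/-! ### The axioms of `⊗̂` at first order. -/

section Axioms

variable {K : Type uK} [CommRing K] {C : Type u} [Bicategory.{w, v} C] [Bicategory.Strict C]
  [∀ X Y : C, Preadditive (X ⟶ Y)] [∀ X Y : C, Linear K (X ⟶ Y)] [LinearComposition K C]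
  {T : TensorFunctor C} [T.IsBilinear K] {A : AssociatorCells T}

/-- The tensor product 2-isomorphisms of the first order extension reduce to those of `S`. -/
def ReducesTo (S : SemigroupalStructure T A)
    (D : SemigroupalData (T.firstOrder K) (A.firstOrder K)) : Prop :=
  ∀ {X X' X'' Y Y' Y'' : FirstOrderExt K C} (f : X ⟶ X') (g : Y ⟶ Y') (f' : X' ⟶ X'')
    (g' : Y' ⟶ Y''), FirstOrderHom₂.zero (D.tensorComp f g f' g').hom =
      (S.tensorComp (FirstOrderHom.of f) (FirstOrderHom.of g) (FirstOrderHom.of f')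
        (FirstOrderHom.of g')).hom

variable {D : SemigroupalData (T.firstOrder K) (A.firstOrder K)}
  {S : SemigroupalStructure T A}

namespace ReducesTo

variable (h₀ : ReducesTo S D)
include h₀

theorem cell₀_tensorComp {X X' X'' Y Y' Y'' : FirstOrderExt K C} (f : X ⟶ X') (g : Y ⟶ Y')
    (f' : X' ⟶ X'') (g' : Y' ⟶ Y'') : cell₀ K (D.tensorComp f g f' g').hom =
      cell K (S.tensorComp f.of g.of f'.of g'.of).hom := congrArg (cell K) (h₀ f g f' g')

/-- If ε falls on one of the 2-morphisms, the resulting terms are instances of the undeformed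
naturality. Only the terms with ε on `⊗̂` remain, so naturality need only be tested on constant
2-morphisms. -/
theorem tensorComp_naturality_iff {X X' X'' Y Y' Y'' : FirstOrderExt K C} {f₁ f₂ : X ⟶ X'}
    {g₁ g₂ : Y ⟶ Y'} {f₁' f₂' : X' ⟶ X''} {g₁' g₂' : Y' ⟶ Y''}
    (τ : f₁ ⟶ f₂) (σ : g₁ ⟶ g₂) (τ' : f₁' ⟶ f₂') (σ' : g₁' ⟶ g₂') :
    (D.tensorComp f₁ g₁ f₁' g₁').hom ≫ (T.firstOrder K).map₂ (hcomp τ τ') (hcomp σ σ') =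
      hcomp ((T.firstOrder K).map₂ τ σ) ((T.firstOrder K).map₂ τ' σ') ≫
        (D.tensorComp f₂ g₂ f₂' g₂').hom ↔
      ver K (cell₁ K (D.tensorComp f₁ g₁ f₁' g₁').hom)
        (ten K T (hor K (cell₀ K τ) (cell₀ K τ')) (hor K (cell₀ K σ) (cell₀ K σ'))) =
      ver K (hor K (ten K T (cell₀ K τ) (cell₀ K σ)) (ten K T (cell₀ K τ') (cell₀ K σ')))
        (cell₁ K (D.tensorComp f₂ g₂ f₂' g₂').hom) := by
  rw [FirstOrderHom₂.eq_iff_cell]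
  simp only [cell₀_comp, cell₁_comp, cell₀_map₂, cell₁_map₂, cell₀_hcomp, cell₁_hcomp,
    h₀.cell₀_tensorComp, map_add, LinearMap.add_apply, S.tensorComp_naturality_cell, true_and]
  -- The surplus Leibniz terms are now the same on both sides and cancel in the difference.
  constructor
  · intro h
    rw [← sub_eq_zero] at h ⊢
    rw [← h]
    abel
  · intro h
    rw [← sub_eq_zero] at h ⊢
    rw [← h]
    abel

/-- The constant coefficient is the undeformed axiom and the associators are identities; the rest is
the Leibniz rule for two composable instances of `⊗̂` on each side. -/
theorem tensorComp_assoc_iff {X X' X'' X''' Y Y' Y'' Y''' : FirstOrderExt K C} (f : X ⟶ X')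
    (g : Y ⟶ Y') (f' : X' ⟶ X'') (g' : Y' ⟶ Y'') (f'' : X'' ⟶ X''') (g'' : Y'' ⟶ Y''') :
    (D.tensorComp f g f' g').hom ▷ (T.firstOrder K).map f'' g'' ≫
        (D.tensorComp (f ≫ f') (g ≫ g') f'' g'').hom ≫
        (T.firstOrder K).map₂ (α_ f f' f'').hom (α_ g g' g'').hom =
      (α_ _ _ _).hom ≫ (T.firstOrder K).map f g ◁ (D.tensorComp f' g' f'' g'').hom ≫
        (D.tensorComp f g (f' ≫ f'') (g' ≫ g'')).hom ↔
      ver K (hor K (cell K (S.tensorComp f.of g.of f'.of g'.of).hom)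
          (cellId K (T.map f''.of g''.of)))
          (cell₁ K (D.tensorComp (f ≫ f') (g ≫ g') f'' g'').hom) +
        ver K (hor K (cell₁ K (D.tensorComp f g f' g').hom) (cellId K (T.map f''.of g''.of)))
          (cell K (S.tensorComp (f.of ≫ f'.of) (g.of ≫ g'.of) f''.of g''.of).hom) =
      ver K (hor K (cellId K (T.map f.of g.of))
          (cell K (S.tensorComp f'.of g'.of f''.of g''.of).hom))
          (cell₁ K (D.tensorComp f g (f' ≫ f'') (g' ≫ g'')).hom) +
        ver K (hor K (cellId K (T.map f.of g.of)) (cell₁ K (D.tensorComp f' g' f'' g'').hom))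
          (cell K (S.tensorComp f.of g.of (f'.of ≫ f''.of) (g'.of ≫ g''.of)).hom) := by
  have hα := IsIdentityTwo.map₂ (T.firstOrder K) (IsIdentityTwo.associator_hom f f' f'')
    (IsIdentityTwo.associator_hom g g' g'')
  have hS := congrArg (cell K)
    (S.tensorComp_assoc f.of g.of f'.of g'.of f''.of g''.of)
  rw [cell_identity_comp (.associator_hom _ _ _), cell_comp_comp_identity _ _
    (.map₂ T (.associator_hom _ _ _) (.associator_hom _ _ _)), ← ver_cell, ← ver_cell,
    ← hor_cell_cellId, ← hor_cellId_cell] at hS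
  rw [FirstOrderHom₂.eq_iff_cell, cell₀_comp_comp_identity _ _ hα,
    cell₁_comp_comp_identity _ _ hα, cell₀_identity_comp (.associator_hom _ _ _),
    cell₁_identity_comp (.associator_hom _ _ _)]
  simp only [cell₀_comp, cell₁_comp, cell₀_whiskerLeft, cell₁_whiskerLeft, cell₀_whiskerRight,
    cell₁_whiskerRight, h₀.cell₀_tensorComp]
  exact and_iff_right hS

end ReducesTo

end Axioms
end GrayDeformation

namespace GrayDeformation

/-! ### The axioms of `â` and of ψ at first order. -/

section Axioms

variable {K : Type uK} [CommRing K] {C : Type u} [Bicategory.{w, v} C] [Bicategory.Strict C]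
  [∀ X Y : C, Preadditive (X ⟶ Y)] [∀ X Y : C, Linear K (X ⟶ Y)]

theorem cell_bicategoricalComp_identity {X Y : C} {f g g' h : X ⟶ Y} [BicategoricalCoherence g g']
    [H : CoherentIdentity g g'] {η : f ⟶ g} (hη : IsIdentityTwo η) (θ : g' ⟶ h) :
    cell K (η ⊗≫ θ) = cell K θ :=
  (cell_identity_comp hη _).trans (cell_identity_comp H.isIdentity _)

variable [LinearComposition K C] {T : TensorFunctor C} [T.IsBilinear K] {A : AssociatorCells T}

section

variable (S : SemigroupalStructure T A)

variable (K) in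
/-- The structural 2-isomorphism `⊗̂`, as a cell. -/
noncomputable abbrev SemigroupalStructure.tensorCell {X X' X'' Y Y' Y'' : C} (f : X ⟶ X')
    (g : Y ⟶ Y') (f' : X' ⟶ X'') (g' : Y' ⟶ Y'') : CellSpace C :=
  cell K (S.tensorComp f g f' g').hom

variable (K) in
/-- The structural 2-isomorphism of the threefold tensor product, as a cell. -/
noncomputable abbrev SemigroupalStructure.tensorCell₃ {X X' X'' Y Y' Y'' Z Z' Z'' : C} (f : X ⟶ X')
    (g : Y ⟶ Y') (h : Z ⟶ Z') (f' : X' ⟶ X'') (g' : Y' ⟶ Y'') (h' : Z' ⟶ Z'') : CellSpace C :=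
  ver K (S.tensorCell K f (T.map g h) f' (T.map g' h'))
    (ten K T (cellId K (f ≫ f')) (S.tensorCell K g h g' h'))

end

/-- With `â` and `a` identities, compatibility of `â` with composition says that `⊗̂` of a threefold
product does not depend on the bracketing. -/
theorem SemigroupalStructure.IsGray.tensorCell₃_eq {S : SemigroupalStructure T A} (hS : S.IsGray)
    {X X' X'' Y Y' Y'' Z Z' Z'' : C} (f : X ⟶ X')
    (g : Y ⟶ Y') (h : Z ⟶ Z') (f' : X' ⟶ X'') (g' : Y' ⟶ Y'') (h' : Z' ⟶ Z'') :
    ver K (S.tensorCell K (T.map f g) h (T.map f' g') h')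
      (ten K T (S.tensorCell K f g f' g') (cellId K (h ≫ h'))) =
      S.tensorCell₃ K f g h f' g' h' := by
  have e := congrArg (cell K) (S.assoc_comp f g h f' g' h')
  rw [cell_comp_identity _ (hS.assoc _ _ _), cell_whiskerLeft_identity (hS.a _ _ _),
    cell_bicategoricalComp_identity (.id _),
    cell_bicategoricalComp_identity ((hS.assoc _ _ _).whiskerRight _),
    cell_bicategoricalComp_identity ((hS.assoc _ _ _).whiskerLeft _),
    cell_whiskerRight_identity _ (hS.a _ _ _), ← ver_cell, ← ver_cell, ← ten_cell, ← ten_cell] at e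
  exact e

theorem SemigroupalStructure.IsGray.cellId_map_assoc {S : SemigroupalStructure T A} (hS : S.IsGray)
    {X X' Y Y' Z Z' : C} (f : X ⟶ X') (g : Y ⟶ Y') (h : Z ⟶ Z') :
    cellId K (T.map (T.map f g) h) = cellId K (T.map f (T.map g h)) :=
  cellId_congr (hS.tensor_assoc _ _ _).symm (hS.tensor_assoc _ _ _).symm (hS.map_assoc f g h)

section

variable {D : SemigroupalData (T.firstOrder K) (A.firstOrder K)}
  {S : SemigroupalStructure T A} (hS : S.IsGray) (hD : UnitaryLift D)
include hS hD

theorem UnitaryLift.assoc_naturality_iff {X X' Y Y' Z Z' : FirstOrderExt K C} {f₁ f₂ : X ⟶ X'}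
    {g₁ g₂ : Y ⟶ Y'} {h₁ h₂ : Z ⟶ Z'} (τ : f₁ ⟶ f₂) (σ : g₁ ⟶ g₂) (η : h₁ ⟶ h₂) :
    (D.assoc f₁ g₁ h₁).hom ≫ (T.firstOrder K).map₂ τ ((T.firstOrder K).map₂ σ η) ▷
        (A.firstOrder K).a X' Y' Z' =
      (A.firstOrder K).a X Y Z ◁ (T.firstOrder K).map₂ ((T.firstOrder K).map₂ τ σ) η ≫
        (D.assoc f₂ g₂ h₂).hom ↔
      ver K (cell₁ K (D.assoc f₁ g₁ h₁).hom)
          (ten K T (cell₀ K τ) (ten K T (cell₀ K σ) (cell₀ K η))) =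
        ver K (ten K T (cell₀ K τ) (ten K T (cell₀ K σ) (cell₀ K η)))
          (cell₁ K (D.assoc f₂ g₂ h₂).hom) := by
  have a := hS.firstOrder_a (K := K)
  rw [FirstOrderHom₂.eq_iff_cell, (hD.unitCell_assoc f₁ g₁ h₁).cell₀_comp,
    (hD.unitCell_assoc f₁ g₁ h₁).cell₁_comp, (hD.unitCell_assoc f₂ g₂ h₂).cell₀_comp_left,
    (hD.unitCell_assoc f₂ g₂ h₂).cell₁_comp_left, cell₀_whiskerLeft_identity (a _ _ _),
    cell₁_whiskerLeft_identity (a _ _ _), cell₀_whiskerRight_identity _ (a _ _ _),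
    cell₁_whiskerRight_identity _ (a _ _ _)]
  simp only [cell₀_map₂, cell₁_map₂, map_add, LinearMap.add_apply, hS.ten_assoc, true_and]
  -- The terms with ε on a 2-morphism have been made equal by associativity of `ten` and are
  -- cancelled here.
  rw [add_comm, ← add_assoc (ten K T (cell₀ K τ) _), add_left_inj]

/-- The constant coefficient is the independence of threefold `⊗̂` from the bracketing. The
coefficient of ε collects δ_h of the term of `â` and δ_v of the term of `⊗̂`, which together form
the component in bidegree (1,2). -/
theorem UnitaryLift.assoc_comp_iff (h₀ : ReducesTo S D) {X X' X'' Y Y' Y'' Z Z' Z'' : FirstOrderExt K C}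
    (f : X ⟶ X') (g : Y ⟶ Y') (h : Z ⟶ Z') (f' : X' ⟶ X'') (g' : Y' ⟶ Y'') (h' : Z' ⟶ Z'') :
    (A.firstOrder K).a X Y Z ◁
          ((D.tensorComp ((T.firstOrder K).map f g) h ((T.firstOrder K).map f' g') h').hom ≫
          (T.firstOrder K).map₂ (D.tensorComp f g f' g').hom (𝟙 (h ≫ h'))) ≫
        (D.assoc (f ≫ f') (g ≫ g') (h ≫ h')).hom =
      𝟙 _ ⊗≫ (D.assoc f g h).hom ▷ (T.firstOrder K).map ((T.firstOrder K).map f' g') h' ⊗≫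
        (T.firstOrder K).map f ((T.firstOrder K).map g h) ◁ (D.assoc f' g' h').hom ⊗≫
        ((D.tensorComp f ((T.firstOrder K).map g h) f' ((T.firstOrder K).map g' h')).hom ≫
          (T.firstOrder K).map₂ (𝟙 (f ≫ f')) (D.tensorComp g h g' h').hom) ▷
            (A.firstOrder K).a X'' Y'' Z'' ↔
      ver K (S.tensorCell₃ K f.of g.of h.of f'.of g'.of h'.of)
          (cell₁ K (D.assoc (f ≫ f') (g ≫ g') (h ≫ h')).hom) +
        (ver K (S.tensorCell K (T.map f.of g.of) h.of (T.map f'.of g'.of) h'.of)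
          (ten K T (cell₁ K (D.tensorComp f g f' g').hom) (cellId K (h.of ≫ h'.of))) +
        ver K (cell₁ K (D.tensorComp ((T.firstOrder K).map f g) h
            ((T.firstOrder K).map f' g') h').hom)
          (ten K T (S.tensorCell K f.of g.of f'.of g'.of) (cellId K (h.of ≫ h'.of)))) =
      ver K (S.tensorCell K f.of (T.map g.of h.of) f'.of (T.map g'.of h'.of))
          (ten K T (cellId K (f.of ≫ f'.of)) (cell₁ K (D.tensorComp g h g' h').hom)) +
        ver K (cell₁ K (D.tensorComp f ((T.firstOrder K).map g h) f'
            ((T.firstOrder K).map g' h')).hom)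
          (ten K T (cellId K (f.of ≫ f'.of)) (S.tensorCell K g.of h.of g'.of h'.of)) +
        ver K (hor K (cellId K (T.map f.of (T.map g.of h.of)))
          (cell₁ K (D.assoc f' g' h').hom)) (S.tensorCell₃ K f.of g.of h.of f'.of g'.of h'.of) +
        ver K (hor K (cell₁ K (D.assoc f g h).hom) (cellId K (T.map f'.of (T.map g'.of h'.of))))
          (S.tensorCell₃ K f.of g.of h.of f'.of g'.of h'.of) := by
  have a := hS.firstOrder_a (K := K)
  rw [FirstOrderHom₂.eq_iff_cell, (hD.unitCell_assoc _ _ _).cell₀_comp_left,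
    (hD.unitCell_assoc _ _ _).cell₁_comp_left, cell₀_whiskerLeft_identity (a _ _ _),
    cell₁_whiskerLeft_identity (a _ _ _),
    cell₀_bicategoricalComp_identity (IsIdentityTwo.id _).unitCell,
    cell₁_bicategoricalComp_identity (IsIdentityTwo.id _).unitCell,
    cell₀_bicategoricalComp_identity ((hD.unitCell_assoc f g h).whiskerRight _),
    cell₁_bicategoricalComp_identity ((hD.unitCell_assoc f g h).whiskerRight _),
    cell₀_bicategoricalComp_identity ((hD.unitCell_assoc f' g' h').whiskerLeft _),
    cell₁_bicategoricalComp_identity ((hD.unitCell_assoc f' g' h').whiskerLeft _),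
    cell₀_whiskerRight_identity _ (a _ _ _),
    cell₁_whiskerRight_identity _ (a _ _ _)]
  have e₁ := hS.cellId_map_assoc (K := K) f'.of g'.of h'.of
  have e₂ := hS.tensorCell₃_eq (K := K) f.of g.of h.of f'.of g'.of h'.of
  simp only [cell₀_comp, cell₁_comp, cell₀_map₂, cell₁_map₂, cell₀_id, cell₁_id, map_zero,
    LinearMap.zero_apply, add_zero, zero_add, h₀.cell₀_tensorComp]
  refine (and_iff_right e₂).trans ?_
  refine Eq.congr ?_ ?_
  · exact congrArg (fun x => ver K x _ + _) e₂
  · exact congrArg (fun x => _ + ver K (hor K _ x) _) e₁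

end

section

variable {D D' : SemigroupalStructure (T.firstOrder K) (A.firstOrder K)}
  {ψ : ∀ X Y : FirstOrderExt K C, (T.firstOrder K).obj X Y ⟶ (T.firstOrder K).obj X Y}
  {P : IdentitySemigroupalData D D' ψ} (hP : UnitaryIdentityLift P)
include hP

theorem UnitaryIdentityLift.nat_naturality_iff {X X' Y Y' : FirstOrderExt K C} {f₁ f₂ : X ⟶ X'}
    {g₁ g₂ : Y ⟶ Y'} (τ : f₁ ⟶ f₂) (σ : g₁ ⟶ g₂) :
    (P.nat f₁ g₁).hom ≫ (T.firstOrder K).map₂ τ σ ▷ ψ X' Y' =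
      ψ X Y ◁ (T.firstOrder K).map₂ τ σ ≫ (P.nat f₂ g₂).hom ↔
      ver K (cell₁ K (P.nat f₁ g₁).hom) (ten K T (cell₀ K τ) (cell₀ K σ)) =
        ver K (ten K T (cell₀ K τ) (cell₀ K σ)) (cell₁ K (P.nat f₂ g₂).hom) := by
  rw [FirstOrderHom₂.eq_iff_cell, (hP.unitCell_nat f₁ g₁).cell₀_comp,
    (hP.unitCell_nat f₁ g₁).cell₁_comp, (hP.unitCell_nat f₂ g₂).cell₀_comp_left,
    (hP.unitCell_nat f₂ g₂).cell₁_comp_left, cell₀_whiskerLeft_identity (hP.psi _ _),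
    cell₁_whiskerLeft_identity (hP.psi _ _), cell₀_whiskerRight_identity _ (hP.psi _ _),
    cell₁_whiskerRight_identity _ (hP.psi _ _), cell₀_map₂, add_comm, add_left_inj]
  exact and_iff_right rfl

/-- Up to rearrangement this says that the terms of the two `⊗̂` differ by minus δ_h of the term of
ψ. -/
theorem UnitaryIdentityLift.nat_comp_iff {S : SemigroupalStructure T A}
    (h₀ : ReducesTo S D.toSemigroupalData) (h₀' : ReducesTo S D'.toSemigroupalData)
    {X X' X'' Y Y' Y'' : FirstOrderExt K C}
    (f : X ⟶ X') (g : Y ⟶ Y') (f' : X' ⟶ X'') (g' : Y' ⟶ Y'') :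
    ψ X Y ◁ (D.tensorComp f g f' g').hom ≫ (P.nat (f ≫ f') (g ≫ g')).hom =
      𝟙 _ ⊗≫ (P.nat f g).hom ▷ (T.firstOrder K).map f' g' ⊗≫
        (T.firstOrder K).map f g ◁ (P.nat f' g').hom ⊗≫
        (D'.tensorComp f g f' g').hom ▷ ψ X'' Y'' ↔
      ver K (S.tensorCell K f.of g.of f'.of g'.of) (cell₁ K (P.nat (f ≫ f') (g ≫ g')).hom) +
        cell₁ K (D.tensorComp f g f' g').hom =
      cell₁ K (D'.tensorComp f g f' g').hom +
        ver K (hor K (cellId K (T.map f.of g.of)) (cell₁ K (P.nat f' g').hom))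
          (S.tensorCell K f.of g.of f'.of g'.of) +
        ver K (hor K (cell₁ K (P.nat f g).hom) (cellId K (T.map f'.of g'.of)))
          (S.tensorCell K f.of g.of f'.of g'.of) := by
  rw [FirstOrderHom₂.eq_iff_cell, (hP.unitCell_nat _ _).cell₀_comp_left,
    (hP.unitCell_nat _ _).cell₁_comp_left, cell₀_whiskerLeft_identity (hP.psi _ _),
    cell₁_whiskerLeft_identity (hP.psi _ _),
    cell₀_bicategoricalComp_identity (IsIdentityTwo.id _).unitCell,
    cell₁_bicategoricalComp_identity (IsIdentityTwo.id _).unitCell,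
    cell₀_bicategoricalComp_identity ((hP.unitCell_nat f g).whiskerRight _),
    cell₁_bicategoricalComp_identity ((hP.unitCell_nat f g).whiskerRight _),
    cell₀_bicategoricalComp_identity ((hP.unitCell_nat f' g').whiskerLeft _),
    cell₁_bicategoricalComp_identity ((hP.unitCell_nat f' g').whiskerLeft _),
    cell₀_whiskerRight_identity _ (hP.psi _ _),
    cell₁_whiskerRight_identity _ (hP.psi _ _), h₀.cell₀_tensorComp, h₀'.cell₀_tensorComp]
  simp only [map_zero, LinearMap.zero_apply, add_zero]
  exact and_iff_right trivial

end

end Axioms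
-- The horizontal differential in low degrees.
section Formulas
variable {K : Type uK} [CommRing K] {C : Type u} [Bicategory.{w, v} C]
  [∀ X Y : C, Preadditive (X ⟶ Y)] [∀ X Y : C, Linear K (X ⟶ Y)]
variable {B : Type u} [Bicategory.{w,v} B]

namespace LaxData

variable {F : LaxData B C}

/-- The value of a cochain of degree 0 at a 1-morphism. -/
def Cochain.eval₀ (φ : F.Cochain 0) {X Y : B} (f : X ⟶ Y) : F.map f ⟶ F.map f :=
  φ X Y (.single f)

/-- The value of a cochain of degree 1 at a pair of composable 1-morphisms. -/
def Cochain.eval₁ (φ : F.Cochain 1) {X Y Z : B} (f : X ⟶ Y) (f' : Y ⟶ Z) :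
    F.map f ≫ F.map f' ⟶ F.map (f ≫ f') :=
  φ X Z (.cons f' (.single f))

theorem Cochain.ext₀ {φ φ' : F.Cochain 0}
    (h : ∀ {X Y : B} (f : X ⟶ Y), cell K (φ.eval₀ f) = cell K (φ'.eval₀ f)) : φ = φ' := by
  funext X Y c
  cases c with
  | single f => exact cell_injective K (h f)

theorem Cochain.ext₁ {φ φ' : F.Cochain 1}
    (h : ∀ {X Y Z : B} (f : X ⟶ Y) (f' : Y ⟶ Z),
      cell K (φ.eval₁ f f') = cell K (φ'.eval₁ f f')) : φ = φ' := by
  funext X Y c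
  cases c with
  | cons f' c =>
    cases c with
    | single f => exact cell_injective K (h f f')

variable [LinearComposition K C]

theorem cell_delta {m : ℕ} (φ : F.Cochain m) {X Y : B} (c : Chain B (m + 1) X Y) :
    cell K (F.delta K m φ X Y c) = cell K (F.firstTerm K m φ X Y c) +
      ∑ j : Fin (m + 1), (-1 : K) ^ (j.val + 1) • cell K (F.mergeTerm K m j φ X Y c) +
      (-1 : K) ^ (m + 2) • cell K (F.lastTerm K m φ X Y c) := by
  simp [delta]

theorem cell_eval₁_delta (φ : F.Cochain 0) {X Y Z : B} (f : X ⟶ Y) (f' : Y ⟶ Z) :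
    cell K (Cochain.eval₁ (F.delta K 0 φ) f f') =
      ver K (hor K (cell K (φ.eval₀ f)) (cellId K (F.map f'))) (cell K (F.mapComp f f')) -
      ver K (cell K (F.mapComp f f')) (cell K (φ.eval₀ (f ≫ f'))) +
      ver K (hor K (cellId K (F.map f)) (cell K (φ.eval₀ f'))) (cell K (F.mapComp f f')) := by
  have h₀ : F.firstTerm K 0 φ X Z (.cons f' (.single f)) =
      φ.eval₀ f ▷ F.map f' ≫ F.mapComp f f' := rfl
  have h₁ : F.mergeTerm K 0 0 φ X Z (.cons f' (.single f)) =
      F.mapComp f f' ≫ φ.eval₀ (f ≫ f') := by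
    refine congrArg (F.mapComp f f' ≫ ·) ?_
    exact (congrArg _ (F.map₂_id _)).trans (Category.comp_id _)
  have h₂ : F.lastTerm K 0 φ X Z (.cons f' (.single f)) =
      F.map f ◁ φ.eval₀ f' ≫ F.mapComp f f' := by
    refine (Category.id_comp _).trans (congrArg (_ ≫ ·) ?_)
    exact (congrArg _ (F.map₂_id _)).trans (Category.comp_id _)
  refine (cell_delta (K := K) φ (.cons f' (.single f))).trans ?_
  rw [Fin.sum_univ_one]
  rw [hor_cellId_cell (K := K), hor_cell_cellId, ver_cell, ver_cell, ver_cell]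
  refine (congrArg₂ (· + ·) (congrArg₂ (· + ·) (congrArg (cell K) h₀)
    (congrArg _ (congrArg (cell K) h₁))) (congrArg _ (congrArg (cell K) h₂))).trans ?_
  simp [sub_eq_add_neg]
  rfl

/-- Reassociating a chain introduces an associator of `B`, which is not assumed strict; the
hypothesis `hF` makes its image under `F` invisible. -/
theorem cell_delta_one [Bicategory.Strict C] (φ : F.Cochain 1) {X Y Z W : B} (f : X ⟶ Y) (f' : Y ⟶ Z)
    (f'' : Z ⟶ W) (hF : IsIdentityTwo (F.map₂ (α_ f f' f'').inv)) :
    cell K (F.delta K 1 φ X W (.cons f'' (.cons f' (.single f)))) =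
      ver K (hor K (cell K (φ.eval₁ f f')) (cellId K (F.map f''))) (cell K (F.mapComp (f ≫ f') f'')) -
      ver K (hor K (cellId K (F.map f)) (cell K (F.mapComp f' f''))) (cell K (φ.eval₁ f (f' ≫ f''))) +
      ver K (hor K (cell K (F.mapComp f f')) (cellId K (F.map f''))) (cell K (φ.eval₁ (f ≫ f') f'')) -
      ver K (hor K (cellId K (F.map f)) (cell K (φ.eval₁ f' f'')))
        (cell K (F.mapComp f (f' ≫ f''))) := by
  have e₀ : cell K (φ.eval₁ f f' ▷ F.map f'' ≫ F.mapComp (f ≫ f') f'') =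
      ver K (hor K (cell K (φ.eval₁ f f')) (cellId K (F.map f'')))
        (cell K (F.mapComp (f ≫ f') f'')) := by
    rw [hor_cell_cellId, ver_cell]
  have e₁ : cell K (((α_ (F.map f) (F.map f') (F.map f'')).hom ≫
        F.map f ◁ F.mapComp f' f'') ≫ φ.eval₁ f (f' ≫ f'') ≫ F.map₂ (α_ f f' f'').inv) =
      ver K (hor K (cellId K (F.map f)) (cell K (F.mapComp f' f'')))
        (cell K (φ.eval₁ f (f' ≫ f''))) := by
    refine (congrArg (cell K) (Category.assoc (α_ (F.map f) (F.map f') (F.map f'')).hom _ _)).trans ?_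
    rw [cell_identity_comp (.associator_hom _ _ _),
      cell_comp_comp_identity _ _ hF, hor_cellId_cell, ver_cell]
  have e₂ : cell K (F.mapComp f f' ▷ F.map f'' ≫ φ.eval₁ (f ≫ f') f'' ≫
        F.map₂ (𝟙 (f ≫ f') ▷ f'')) =
      ver K (hor K (cell K (F.mapComp f f')) (cellId K (F.map f'')))
        (cell K (φ.eval₁ (f ≫ f') f'')) := by
    rw [id_whiskerRight, F.map₂_id, cell_comp_comp_identity _ _ (.id _), hor_cell_cellId, ver_cell]
  have e₃ : cell K ((𝟙 (F.map f ≫ F.map f') ▷ F.map f'' ≫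
        (α_ (F.map f) (F.map f') (F.map f'')).hom) ≫ F.map f ◁ φ.eval₁ f' f'' ≫
        F.mapComp f (f' ≫ f'') ≫ F.map₂ ((α_ f f' f'').inv ≫ 𝟙 (f ≫ f') ▷ f'')) =
      ver K (hor K (cellId K (F.map f)) (cell K (φ.eval₁ f' f'')))
        (cell K (F.mapComp f (f' ≫ f''))) := by
    rw [cell_identity_comp (((IsIdentityTwo.id _).whiskerRight _).comp (.associator_hom _ _ _)),
      id_whiskerRight, Category.comp_id, cell_comp_comp_identity _ _ hF, hor_cellId_cell, ver_cell]
  refine (cell_delta φ _).trans ?_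
  rw [Fin.sum_univ_two]
  refine (congrArg₂ (· + ·) (congrArg₂ (· + ·) e₀ (congrArg₂ (· + ·) (congrArg _ e₁)
    (congrArg _ e₂))) (congrArg _ e₃)).trans ?_
  simp only [Fin.val_zero, Fin.val_one, zero_add, pow_one, neg_smul, one_smul, one_add_one_eq_two,
    even_two, Even.neg_pow, one_pow, sub_eq_add_neg]
  -- The last face of a chain of three 1-morphisms carries the sign (-1)³.
  have : (-1 : K) ^ (1 + 2) = -1 := by norm_num
  rw [this, neg_smul, one_smul]
  abel

end LaxData

end Formulas
-- The vertical differential, the pentagonator differential and `phi` in low degrees.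
section TensorFormulas
variable {K : Type uK} [CommRing K] {C : Type u} [Bicategory.{w, v} C]
  [∀ X Y : C, Preadditive (X ⟶ Y)] [∀ X Y : C, Linear K (X ⟶ Y)]
variable {T : TensorFunctor C} {A : AssociatorCells T}

/-- The common shape of δ_v and δ_pent. It pushes a linear evaluation through the sum while the
iterated tensor products stay folded. -/
theorem apply_alternatingSum {M N P : Type*} [AddCommGroup M] [AddCommGroup N] [AddCommGroup P]
    [Module K M] [Module K N] [Module K P] {k m : ℕ} (L : N →ₗ[K] P) (a c : M →ₗ[K] N)
    (b : Fin k → M →ₗ[K] N) (x : M) :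
    L ((a + ∑ i : Fin k, (-1 : K) ^ (i.val + 1) • b i + (-1 : K) ^ m • c) x) =
      L (a x) + ∑ i : Fin k, (-1 : K) ^ (i.val + 1) • L (b i x) + (-1 : K) ^ m • L (c x) := by
  simp

theorem id_whiskerRight_comp {B : Type u} [Bicategory.{w, v} B] {X Y Z : B} (f : X ⟶ Y) (g : Y ⟶ Z)
    {h : X ⟶ Z} (η : f ≫ g ⟶ h) : 𝟙 f ▷ g ≫ η = η := by
  simp

theorem id_whiskerRight_comp_id {B : Type u} [Bicategory.{w, v} B] {X Y Z : B} (f : X ⟶ Y)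
    (g : Y ⟶ Z) : 𝟙 f ▷ g ≫ 𝟙 (f ≫ g) = 𝟙 (f ≫ g) := by
  simp

omit [∀ X Y : C, Preadditive (X ⟶ Y)] in
theorem map₂_id_whiskerRight_comp_id {B : Type u} [Bicategory.{w, v} B] (F : LaxData B C)
    {X Y Z : B} (f : X ⟶ Y) (g : Y ⟶ Z) :
    F.map₂ (𝟙 f ▷ g ≫ 𝟙 (f ≫ g)) = 𝟙 (F.map (f ≫ g)) := by
  rw [id_whiskerRight_comp_id, F.map₂_id]

/-- Evaluation of cochains at a chain. -/
def LaxData.evalₗ (K : Type uK) [CommRing K] [∀ X Y : C, Linear K (X ⟶ Y)] {B : Type u}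
    [Bicategory.{w, v} B] (F : LaxData B C) {m : ℕ} (X Y : B)
    (c : Chain B m X Y) : F.Cochain m →ₗ[K] ((F.onChain c).comp ⟶ F.map c.comp) where
  toFun φ := φ X Y c
  map_add' _ _ := rfl
  map_smul' _ _ := rfl

namespace SemigroupalData
variable (S : SemigroupalData T A)

variable {S} in
/-- The value of a cochain of bidegree `(0, 1)`. -/
def eval₂ (φ : S.DoubleCochain 0 1) {X X' Y Y' : C} (f : X ⟶ X') (g : Y ⟶ Y') :
    T.map f g ⟶ T.map f g :=
  φ ((X, Y) : C × C) ((X', Y') : C × C) (.single (Prod.mkHom f g))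

variable {S} in
/-- The value of a cochain of bidegree `(0, 2)`. -/
def eval₃ (φ : S.DoubleCochain 0 2) {X X' Y Y' Z Z' : C} (f : X ⟶ X') (g : Y ⟶ Y') (h : Z ⟶ Z') :
    T.map f (T.map g h) ⟶ T.map f (T.map g h) :=
  φ ((X, Y, Z) : C × (C × C)) ((X', Y', Z') : C × (C × C)) (.single (Prod.mkHom f (Prod.mkHom g h)))

variable {S} in
/-- The value of a cochain of bidegree `(0, 3)`. -/
def eval₄ (φ : S.DoubleCochain 0 3) {X X' Y Y' Z Z' W W' : C} (f : X ⟶ X') (g : Y ⟶ Y')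
    (h : Z ⟶ Z') (k : W ⟶ W') :
    T.map f (T.map g (T.map h k)) ⟶ T.map f (T.map g (T.map h k)) :=
  φ ((X, Y, Z, W) : C × (C × (C × C))) ((X', Y', Z', W') : C × (C × (C × C)))
    (.single (Prod.mkHom f (Prod.mkHom g (Prod.mkHom h k))))

variable {S} in
/-- The value of a cochain of bidegree `(1, 1)`. -/
def evalComp₂ (φ : S.DoubleCochain 1 1) {X X' X'' Y Y' Y'' : C} (f : X ⟶ X') (g : Y ⟶ Y')
    (f' : X' ⟶ X'') (g' : Y' ⟶ Y'') :
    T.map f g ≫ T.map f' g' ⟶ T.map (f ≫ f') (g ≫ g') :=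
  φ ((X, Y) : C × C) ((X'', Y'') : C × C)
    (.cons (Y := ((X', Y') : C × C)) (Prod.mkHom f' g') (.single (Prod.mkHom f g)))

variable {S} in
/-- The value of a cochain of bidegree `(1, 2)`. -/
def evalComp₃ (φ : S.DoubleCochain 1 2) {X X' X'' Y Y' Y'' Z Z' Z'' : C} (f : X ⟶ X') (g : Y ⟶ Y')
    (h : Z ⟶ Z') (f' : X' ⟶ X'') (g' : Y' ⟶ Y'') (h' : Z' ⟶ Z'') :
    T.map f (T.map g h) ≫ T.map f' (T.map g' h') ⟶ T.map (f ≫ f') (T.map (g ≫ g') (h ≫ h')) :=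
  φ ((X, Y, Z) : C × (C × C)) ((X'', Y'', Z'') : C × (C × C))
    (.cons (Y := ((X', Y', Z') : C × (C × C))) (Prod.mkHom f' (Prod.mkHom g' h'))
      (.single (Prod.mkHom f (Prod.mkHom g h))))

variable {S} in
/-- The member of a family of 2-morphisms at a triple of objects. -/
def pent₃ (p : S.PentCochain 2) (X Y Z : C) :
    𝟙 (T.obj X (T.obj Y Z)) ⟶ 𝟙 (T.obj X (T.obj Y Z)) :=
  p ((X, Y, Z) : C × (C × C))

variable {S} in
/-- The member of a family of 2-morphisms at a quadruple of objects. -/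
def pent₄ (p : S.PentCochain 3) (X Y Z W : C) :
    𝟙 (T.obj X (T.obj Y (T.obj Z W))) ⟶ 𝟙 (T.obj X (T.obj Y (T.obj Z W))) :=
  p ((X, Y, Z, W) : C × (C × (C × C)))

variable {S} in
/-- The member of a family of 2-morphisms at a quintuple of objects. -/
def pent₅ (p : S.PentCochain 4) (X Y Z V U : C) :
    𝟙 (T.obj X (T.obj Y (T.obj Z (T.obj V U)))) ⟶ 𝟙 (T.obj X (T.obj Y (T.obj Z (T.obj V U)))) :=
  p ((X, Y, Z, V, U) : C × (C × (C × (C × C))))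

variable [LinearComposition K C]

/-- The unitors are identities, so `phi` is the commutator of the family with whiskering by `f ⊗ g ⊗
h`. -/
theorem cell_eval₃_phi [Bicategory.Strict C] (p : S.PentCochain 2) {X X' Y Y' Z Z' : C}
    (f : X ⟶ X') (g : Y ⟶ Y') (h : Z ⟶ Z') :
    cell K (eval₃ (S.phi K 2 p) f g h) =
      hor K (cellId K (T.map f (T.map g h))) (cell K (pent₃ p X' Y' Z')) -
      hor K (cell K (pent₃ p X Y Z)) (cellId K (T.map f (T.map g h))) := by
  have h₁ (F : T.obj X (T.obj Y Z) ⟶ T.obj X' (T.obj Y' Z')) (p : 𝟙 _ ⟶ 𝟙 _) (p' : 𝟙 _ ⟶ 𝟙 _) :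
    cell K ((ρ_ F).inv ≫ F ◁ p' ≫ (ρ_ F).hom - (λ_ F).inv ≫ p ▷ F ≫ (λ_ F).hom) =
      hor K (cellId K F) (cell K p') - hor K (cell K p) (cellId K F) := by
    rw [map_sub, cell_identity_comp (.rightUnitor_inv _), cell_identity_comp (.leftUnitor_inv _),
      cell_comp_identity _ (.rightUnitor_hom _), cell_comp_identity _ (.leftUnitor_hom _),
      hor_cellId_cell, hor_cell_cellId]
  exact h₁ _ _ _

theorem cell_eval₄_phi [Bicategory.Strict C] (p : S.PentCochain 3) {X X' Y Y' Z Z' W W' : C}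
    (f : X ⟶ X') (g : Y ⟶ Y') (h : Z ⟶ Z') (k : W ⟶ W') :
    cell K (eval₄ (S.phi K 3 p) f g h k) =
      hor K (cellId K (T.map f (T.map g (T.map h k)))) (cell K (pent₄ p X' Y' Z' W')) -
      hor K (cell K (pent₄ p X Y Z W)) (cellId K (T.map f (T.map g (T.map h k)))) := by
  have h₁ (F : T.obj X (T.obj Y (T.obj Z W)) ⟶ T.obj X' (T.obj Y' (T.obj Z' W'))) (p : 𝟙 _ ⟶ 𝟙 _)
      (p' : 𝟙 _ ⟶ 𝟙 _) :
    cell K ((ρ_ F).inv ≫ F ◁ p' ≫ (ρ_ F).hom - (λ_ F).inv ≫ p ▷ F ≫ (λ_ F).hom) =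
      hor K (cellId K F) (cell K p') - hor K (cell K p) (cellId K F) := by
    rw [map_sub, cell_identity_comp (.rightUnitor_inv _), cell_identity_comp (.leftUnitor_inv _),
      cell_comp_identity _ (.rightUnitor_hom _), cell_comp_identity _ (.leftUnitor_hom _),
      hor_cellId_cell, hor_cell_cellId]
  exact h₁ _ _ _

end SemigroupalData

namespace SemigroupalStructure.IsGray

open SemigroupalData

variable [Bicategory.Strict C] {S : SemigroupalStructure T A} (hS : S.IsGray)
  [LinearComposition K C] [T.IsBilinear K]

omit [Bicategory.Strict C] [LinearComposition K C] in
include hS in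
theorem cell_pentLeft (X Y : C) (p : 𝟙 Y ⟶ 𝟙 Y) :
    cell K (S.pentLeft K X Y p) = ten K T (cellId K (𝟙 X)) (cell K p) := by
  have : S.pentLeft K X Y p = (S.tensorId X Y).inv ≫ T.map₂ (𝟙 (𝟙 X)) p ≫ (S.tensorId X Y).hom := rfl
  rw [this, cell_identity_comp (hS.tensorId X Y).inv, cell_comp_identity _ (hS.tensorId X Y),
    ← ten_cell]

omit [Bicategory.Strict C] [LinearComposition K C] in
include hS in
theorem cell_pentRight (X Y : C) (p : 𝟙 X ⟶ 𝟙 X) :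
    cell K (S.pentRight K X Y p) = ten K T (cell K p) (cellId K (𝟙 Y)) := by
  have : S.pentRight K X Y p = (S.tensorId X Y).inv ≫ T.map₂ p (𝟙 (𝟙 Y)) ≫ (S.tensorId X Y).hom := rfl
  rw [this, cell_identity_comp (hS.tensorId X Y).inv, cell_comp_identity _ (hS.tensorId X Y),
    ← ten_cell]

omit [LinearComposition K C] in
theorem cell_deltaPent {n : ℕ} (p : S.PentCochain n) (X : Tup C (n + 1)) :
    cell K (hS.deltaPent K n p X) =
      cell K (S.pentLeft K X.1 ((S.tens n).obj X.2) (p X.2)) +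
      ∑ i : Fin (n + 1), (-1 : K) ^ (i.val + 1) • cell K (p ((S.face n i).obj X)) +
      (-1 : K) ^ (n + 2) • cell K (S.pentRight K ((S.tens n).obj ((unsnoc C n).obj X).1)
        ((unsnoc C n).obj X).2 (p ((unsnoc C n).obj X).1)) := by
  refine (apply_alternatingSum (K := K) (N := 𝟙 ((S.tens (n + 1)).obj X) ⟶ 𝟙 ((S.tens (n + 1)).obj X))
    (cell K) _ _ _ p).trans ?_
  refine congrArg₂ (· + ·) (congrArg₂ (· + ·) rfl (Finset.sum_congr rfl fun i _ =>
    congrArg _ (cell_castHom₂ ..))) (congrArg _ (cell_castHom₂ ..))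

omit [LinearComposition K C] in
theorem cell_deltaPent₂ (p : S.PentCochain 2) (X Y Z W : C) :
    cell K (pent₄ (hS.deltaPent K 2 p) X Y Z W) =
      ten K T (cellId K (𝟙 X)) (cell K (pent₃ p Y Z W)) - cell K (pent₃ p (T.obj X Y) Z W) +
      cell K (pent₃ p X (T.obj Y Z) W) - cell K (pent₃ p X Y (T.obj Z W)) +
      ten K T (cell K (pent₃ p X Y Z)) (cellId K (𝟙 W)) := by
  refine (hS.cell_deltaPent (K := K) p ((X, Y, Z, W) : C × (C × (C × C)))).trans ?_
  rw [cell_pentLeft (K := K) hS, cell_pentRight hS, Fin.sum_univ_three]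
  simp [pow_succ, sub_eq_add_neg, add_assoc]
  rfl

omit [LinearComposition K C] in
theorem cell_deltaPent₃ (p : S.PentCochain 3) (X Y Z V U : C) :
    cell K (pent₅ (hS.deltaPent K 3 p) X Y Z V U) =
      ten K T (cellId K (𝟙 X)) (cell K (pent₄ p Y Z V U)) - cell K (pent₄ p (T.obj X Y) Z V U) +
      cell K (pent₄ p X (T.obj Y Z) V U) - cell K (pent₄ p X Y (T.obj Z V) U) +
      cell K (pent₄ p X Y Z (T.obj V U)) -
      ten K T (cell K (pent₄ p X Y Z V)) (cellId K (𝟙 U)) := by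
  refine (hS.cell_deltaPent (K := K) p ((X, Y, Z, V, U) : C × (C × (C × (C × C))))).trans ?_
  rw [cell_pentLeft (K := K) hS, cell_pentRight hS, Fin.sum_univ_four]
  simp [pow_succ, sub_eq_add_neg, add_assoc]
  rfl

omit [LinearComposition K C] in
-- The shape of both outer faces of δ_v: `t` and `t'` are comparison cells of projections, which are
-- identities.
theorem cell_comp_map₂_comp {X X' Y Y' : C} {k : T.obj X Y ⟶ T.obj X' Y'} {f f' f'' : X ⟶ X'}
    {g g' g'' : Y ⟶ Y'} (s : k ⟶ T.map f g) (τ : f ⟶ f') {t : f' ⟶ f''} (η : g ⟶ g')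
    {t' : g' ⟶ g''} (ht : IsIdentityTwo t) (ht' : IsIdentityTwo t') :
    cell K (s ≫ T.map₂ (τ ≫ t) (η ≫ t')) = ver K (cell K s) (ten K T (cell K τ) (cell K η)) := by
  rw [T.map₂_comp, cell_comp_comp_identity _ _ (ht.map₂ T ht'), ten_cell, ver_cell]

omit [LinearComposition K C] in
theorem cell_id_comp_map₂_comp {X X' Y Y' : C} {f f' f'' : X ⟶ X'}
    {g g' g'' : Y ⟶ Y'} (τ : f ⟶ f') {t : f' ⟶ f''} (η : g ⟶ g')
    {t' : g' ⟶ g''} (ht : IsIdentityTwo t) (ht' : IsIdentityTwo t') :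
    cell K (𝟙 _ ≫ T.map₂ (τ ≫ t) (η ≫ t')) = ten K T (cell K τ) (cell K η) := by
  rw [cell_comp_map₂_comp _ _ _ ht ht', ten_cell, ver_cell, Category.id_comp]

omit [LinearComposition K C] in
theorem cell_eval₀_deltaV {n : ℕ} (φ : S.DoubleCochain 0 n) {X Y : Tup C (n + 1)} (f : X ⟶ Y) :
    cell K (LaxData.Cochain.eval₀ (hS.deltaV K 0 n φ) f) =
      ten K T (cellId K f.1) (cell K (LaxData.Cochain.eval₀ φ f.2)) +
      ∑ i : Fin (n + 1), (-1 : K) ^ (i.val + 1) •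
        cell K (LaxData.Cochain.eval₀ φ ((S.face n i).map f)) +
      (-1 : K) ^ (n + 2) • ten K T (cell K (LaxData.Cochain.eval₀ φ ((unsnoc C n).map f).1))
        (cellId K ((unsnoc C n).map f).2) := by
  refine (apply_alternatingSum (K := K) (N := S.DoubleCochain 0 (n + 1))
    ((cell K).comp (LaxData.evalₗ K (S.tens (n + 1)) X Y (.single f))) _ _ _ φ).trans ?_
  refine congrArg₂ (· + ·) (congrArg₂ (· + ·) ?_ (Finset.sum_congr rfl fun i _ =>
    congrArg _ ((cell_castHom₂ ..).trans ?_))) (congrArg _ ((cell_castHom₂ ..).trans ?_))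
  · exact cell_id_comp_map₂_comp _ _ (.id _) ⟨rfl, (S.tens n).map₂_id _⟩
  · refine congrArg _ ((congrArg _ ((S.tens n).map₂_id _)).trans (Category.comp_id _))
  · refine (congrArg (cell K) ((congrArg (_ ≫ ·) ((S.tensorLax (S.tens n) (LaxData.id C)).map₂_id
      ((unsnoc C n).map f))).trans (Category.comp_id _))).trans ?_
    exact cell_id_comp_map₂_comp _ _ ⟨rfl, (S.tens n).map₂_id _⟩ (.id _)

omit [LinearComposition K C] in
theorem cell_deltaV_zero_one (φ : S.DoubleCochain 0 1) {X X' Y Y' Z Z' : C} (f : X ⟶ X')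
    (g : Y ⟶ Y') (h : Z ⟶ Z') :
    cell K (eval₃ (hS.deltaV K 0 1 φ) f g h) =
      ten K T (cellId K f) (cell K (eval₂ φ g h)) - cell K (eval₂ φ (T.map f g) h) +
      cell K (eval₂ φ f (T.map g h)) - ten K T (cell K (eval₂ φ f g)) (cellId K h) := by
  refine (hS.cell_eval₀_deltaV (K := K) φ (X := ((X, Y, Z) : C × (C × C)))
    (Y := ((X', Y', Z') : C × (C × C))) (Prod.mkHom f (Prod.mkHom g h))).trans ?_
  rw [Fin.sum_univ_two]
  simp [pow_succ, sub_eq_add_neg, add_assoc]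
  rfl

omit [LinearComposition K C] in
theorem cell_deltaV_zero_two (φ : S.DoubleCochain 0 2) {X X' Y Y' Z Z' W W' : C} (f : X ⟶ X')
    (g : Y ⟶ Y') (h : Z ⟶ Z') (k : W ⟶ W') :
    cell K (eval₄ (hS.deltaV K 0 2 φ) f g h k) =
      ten K T (cellId K f) (cell K (eval₃ φ g h k)) - cell K (eval₃ φ (T.map f g) h k) +
      cell K (eval₃ φ f (T.map g h) k) - cell K (eval₃ φ f g (T.map h k)) +
      ten K T (cell K (eval₃ φ f g h)) (cellId K k) := by
  refine (hS.cell_eval₀_deltaV (K := K) φ (X := ((X, Y, Z, W) : C × (C × (C × C))))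
    (Y := ((X', Y', Z', W') : C × (C × (C × C))))
    (Prod.mkHom f (Prod.mkHom g (Prod.mkHom h k)))).trans ?_
  rw [Fin.sum_univ_three]
  simp [pow_succ, sub_eq_add_neg, add_assoc]
  rfl

omit [LinearComposition K C] in
theorem cell_eval₁_rightTensor {B : Type u} [Bicategory.{w, v} B] (F : LaxData B C)
    (φ : F.Cochain 1) {X Y Z : B × C} (f : X ⟶ Y) (f' : Y ⟶ Z) :
    cell K (LaxData.Cochain.eval₁ (S.rightTensor K F (LaxData.id C) 1 φ) f f') =
      ver K (cell K (S.tensorComp (F.map f.1) f.2 (F.map f'.1) f'.2).hom)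
        (ten K T (cell K (LaxData.Cochain.eval₁ φ f.1 f'.1)) (cellId K (f.2 ≫ f'.2))) := by
  refine (cell_comp_map₂_comp (K := K) (T := T) _ _ _ ?_ ?_).trans ?_
  · exact ⟨rfl, map₂_id_whiskerRight_comp_id F f.1 f'.1⟩
  · exact ⟨rfl, id_whiskerRight_comp_id _ _⟩
  refine congrArg₂ (fun a b => ver K a b) (cell_identity_comp ((IsIdentityTwo.id _).whiskerRight _) _)
    (congrArg (fun a => ten K T _ a) (congrArg (cell K) (id_whiskerRight_comp_id _ _)))

omit [LinearComposition K C] in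
-- Merging two tensor factors before applying φ leaves a product of composites of merged morphisms
-- in the target; the constraint `mapComp` of the face, built from `⊗̂`, is pasted on to correct it.
theorem cell_eval₁_deltaV {n : ℕ} (φ : S.DoubleCochain 1 n) {X Y Z : Tup C (n + 1)} (f : X ⟶ Y)
    (f' : Y ⟶ Z) :
    cell K (LaxData.Cochain.eval₁ (hS.deltaV K 1 n φ) f f') =
      ver K (cell K (S.tensorComp f.1 ((S.tens n).map f.2) f'.1 ((S.tens n).map f'.2)).hom)
        (ten K T (cellId K (f.1 ≫ f'.1)) (cell K (LaxData.Cochain.eval₁ φ f.2 f'.2))) +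
      ∑ i : Fin (n + 1), (-1 : K) ^ (i.val + 1) •
        ver K (cell K (LaxData.Cochain.eval₁ φ ((S.face n i).map f) ((S.face n i).map f')))
          (cell K ((S.tens n).map₂ ((S.face n i).mapComp f f'))) +
      (-1 : K) ^ (n + 2) •
        ver K (cell K (LaxData.Cochain.eval₁ (S.rightTensor K (S.tens n) (LaxData.id C) 1 φ)
          ((unsnoc C n).map f) ((unsnoc C n).map f')))
        (cell K ((S.tensorLax (S.tens n) (LaxData.id C)).map₂ ((unsnoc C n).mapComp f f'))) := by
  refine (apply_alternatingSum (K := K) (N := S.DoubleCochain 1 (n + 1))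
    ((cell K).comp (LaxData.evalₗ K (S.tens (n + 1)) X Z (.cons f' (.single f)))) _ _ _ φ).trans ?_
  refine congrArg₂ (· + ·) (congrArg₂ (· + ·) ?_ (Finset.sum_congr rfl fun i _ =>
    congrArg _ ((cell_castHom₂ ..).trans ?_))) (congrArg _ ((cell_castHom₂ ..).trans ?_))
  · refine (cell_comp_map₂_comp (K := K) (T := T) _ _ _ ?_ ?_).trans ?_
    · exact ⟨rfl, id_whiskerRight_comp_id _ _⟩
    · exact ⟨rfl, map₂_id_whiskerRight_comp_id (S.tens n) f.2 f'.2⟩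
    refine congrArg₂ (fun a b => ver K a b) (cell_identity_comp ((IsIdentityTwo.id _).whiskerRight _) _)
      (congrArg (fun a => ten K T a _) (congrArg (cell K) (id_whiskerRight_comp_id _ _)))
  · exact (congrArg (cell K) (congrArg (_ ≫ ·) (congrArg ((S.tens n).map₂ ·)
      (id_whiskerRight_comp _ _ _)))).trans (ver_cell _ _).symm
  · exact (congrArg (cell K) (congrArg (_ ≫ ·) (congrArg
      ((S.tensorLax (S.tens n) (LaxData.id C)).map₂ ·) (id_whiskerRight_comp _ _ _)))).trans
      (ver_cell _ _).symm

omit [LinearComposition K C] in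
theorem cell_deltaV_one_one (φ : S.DoubleCochain 1 1) {X X' X'' Y Y' Y'' Z Z' Z'' : C} (f : X ⟶ X')
    (g : Y ⟶ Y') (h : Z ⟶ Z') (f' : X' ⟶ X'') (g' : Y' ⟶ Y'') (h' : Z' ⟶ Z'') :
    cell K (evalComp₃ (hS.deltaV K 1 1 φ) f g h f' g' h') =
      ver K (cell K (S.tensorComp f (T.map g h) f' (T.map g' h')).hom)
        (ten K T (cellId K (f ≫ f')) (cell K (evalComp₂ φ g h g' h'))) -
      ver K (cell K (evalComp₂ φ (T.map f g) h (T.map f' g') h'))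
        (ten K T (cell K (S.tensorComp f g f' g').hom) (cellId K (h ≫ h'))) +
      ver K (cell K (evalComp₂ φ f (T.map g h) f' (T.map g' h')))
        (ten K T (cellId K (f ≫ f')) (cell K (S.tensorComp g h g' h').hom)) -
      ver K (cell K (S.tensorComp (T.map f g) h (T.map f' g') h').hom)
        (ten K T (cell K (evalComp₂ φ f g f' g')) (cellId K (h ≫ h'))) := by
  have e {X X' X'' Y Y' Y'' : C} (f : X ⟶ X') (g : Y ⟶ Y') (f' : X' ⟶ X'') (g' : Y' ⟶ Y'') :
    (S.tensorComp f g f' g').hom ≫ T.map₂ (𝟙 (f ≫ f')) (𝟙 (g ≫ g')) = (S.tensorComp f g f' g').hom := by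
      rw [T.map₂_id, Category.comp_id]
  refine (hS.cell_eval₁_deltaV (K := K) φ (X := ((X, Y, Z) : C × (C × C)))
    (Y := ((X', Y', Z') : C × (C × C))) (Z := ((X'', Y'', Z'') : C × (C × C)))
    (Prod.mkHom f (Prod.mkHom g h)) (Prod.mkHom f' (Prod.mkHom g' h'))).trans ?_
  rw [Fin.sum_univ_two]
  -- The constraint cells of the two inner faces: `⊗̂` on the merged pair, tensored with an identity
  -- on the remaining factor.
  have e₁ : cell K ((S.tens 1).map₂ ((S.face 1 0).mapComp (X := ((X, Y, Z) : C × (C × C)))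
      (Y := ((X', Y', Z') : C × (C × C))) (Z := ((X'', Y'', Z'') : C × (C × C)))
      (Prod.mkHom f (Prod.mkHom g h)) (Prod.mkHom f' (Prod.mkHom g' h')))) =
      ten K T (cell K (S.tensorComp f g f' g').hom) (cellId K (h ≫ h')) :=
    (ten_cell T _ _).symm
  have e₂ : cell K ((S.tens 1).map₂ ((S.face 1 1).mapComp (X := ((X, Y, Z) : C × (C × C)))
      (Y := ((X', Y', Z') : C × (C × C))) (Z := ((X'', Y'', Z'') : C × (C × C)))
      (Prod.mkHom f (Prod.mkHom g h)) (Prod.mkHom f' (Prod.mkHom g' h')))) =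
      ten K T (cellId K (f ≫ f')) (cell K (S.tensorComp g h g' h').hom) :=
    (congrArg (cell K) (congrArg (T.map₂ (𝟙 (f ≫ f')) ·) (e g h g' h'))).trans (ten_cell T _ _).symm
  have e₃ := (ver_cell (K := K) _ _).trans ((congrArg (cell K) ((congrArg (_ ≫ ·)
    ((S.tensorLax (S.tens 1) (LaxData.id C)).map₂_id _)).trans (Category.comp_id _))).trans
    (cell_eval₁_rightTensor (K := K) (S := S) (S.tens 1) φ (X := (((X, Y), Z) : (C × C) × C))
      (Y := (((X', Y'), Z') : (C × C) × C)) (Z := (((X'', Y''), Z'') : (C × C) × C))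
      (Prod.mkHom (Prod.mkHom f g) h) (Prod.mkHom (Prod.mkHom f' g') h')))
  rw [e₁, e₂]
  refine (congrArg₂ (· + ·) rfl (congrArg _ e₃)).trans ?_
  simp [pow_succ, sub_eq_add_neg, add_assoc]
  rfl

end SemigroupalStructure.IsGray
end TensorFormulas
-- Natural special cochains in low degrees, in terms of cells.
section Special
variable {K : Type uK} [CommRing K] {C : Type u} [Bicategory.{w, v} C]
  [∀ X Y : C, Preadditive (X ⟶ Y)] [∀ X Y : C, Linear K (X ⟶ Y)]
variable {B : Type u} [Bicategory.{w, v} B] {F : LaxData B C}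

namespace LaxData

theorem mem_specialCochains_zero_iff {φ : F.Cochain 0} : φ ∈ F.specialCochains K 0 ↔
    (∀ {X Y : B} {f f' : X ⟶ Y} (τ : f ⟶ f'),
      ver K (cell K (φ.eval₀ f)) (cell K (F.map₂ τ)) =
        ver K (cell K (F.map₂ τ)) (cell K (φ.eval₀ f'))) ∧
    ∀ X : B, cell K (φ.eval₀ (𝟙 X)) = 0 := by
  refine and_congr ⟨fun h X Y f f' τ => ?_, fun h X Y c c' s => ?_⟩ ⟨fun h X => ?_, fun h X Y c hc => ?_⟩
  · rw [ver_cell, ver_cell]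
    exact congrArg (cell K) (h X Y _ _ (.single τ))
  · cases s with
    | single τ =>
      have := h τ
      rw [ver_cell, ver_cell] at this
      exact cell_injective K this
  · exact (congrArg (cell K) (h X X _ (.single X))).trans (map_zero _)
  · cases hc with
    | single X => exact cell_injective K ((h X).trans (map_zero _).symm)

variable [LinearComposition K C]

/-- A chain of two 1-morphisms contains an identity either at its head or at its tail, which gives
the two vanishing conditions. -/
theorem mem_specialCochains_one_iff {φ : F.Cochain 1} : φ ∈ F.specialCochains K 1 ↔
    (∀ {X Y Z : B} {f₁ f₂ : X ⟶ Y} {f₁' f₂' : Y ⟶ Z} (τ : f₁ ⟶ f₂) (τ' : f₁' ⟶ f₂'),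
      ver K (cell K (φ.eval₁ f₁ f₁')) (cell K (F.map₂ (hcomp τ τ'))) =
        ver K (hor K (cell K (F.map₂ τ)) (cell K (F.map₂ τ'))) (cell K (φ.eval₁ f₂ f₂'))) ∧
    (∀ {X Y : B} (f : X ⟶ Y), cell K (φ.eval₁ f (𝟙 Y)) = 0) ∧
    ∀ {X Y : B} (f : X ⟶ Y), cell K (φ.eval₁ (𝟙 X) f) = 0 := by
  refine and_congr ⟨fun h X Y Z f₁ f₂ f₁' f₂' τ τ' => ?_, fun h X Y c c' s => ?_⟩
    ⟨fun h => ⟨fun {X Y} f => ?_, fun {X Y} f => ?_⟩, fun h X Y c hc => ?_⟩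
  · rw [hor_cell, ver_cell, ver_cell]
    exact congrArg (cell K) (h X Z _ _ (.cons τ' (.single τ)))
  · cases s with
    | cons τ' s =>
      cases s with
      | single τ =>
        have := h τ τ'
        rw [hor_cell, ver_cell, ver_cell] at this
        exact cell_injective K this
  · exact (congrArg (cell K) (h X Y _ (.head (.single f)))).trans (map_zero _)
  · exact (congrArg (cell K) (h X Y _ (.tail f (.single X)))).trans (map_zero _)
  · cases hc with
    | head c =>
      cases c with
      | single f => exact cell_injective K ((h.1 f).trans (map_zero _).symm)
    | tail f hc =>
      cases hc with
      | single X => exact cell_injective K ((h.2 f).trans (map_zero _).symm)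

end LaxData

variable {T : TensorFunctor C} {A : AssociatorCells T} {S : SemigroupalData T A} [T.IsBilinear K]
open SemigroupalData

/-- An identity of a product 2-category is a tuple of identities, so nothing is required when only
one of the two factors is an identity. -/
theorem mem_specialCochains_eval₂ {φ : S.DoubleCochain 0 1} : φ ∈ (S.tens 1).specialCochains K 0 ↔
    (∀ {X X' Y Y' : C} {f₁ f₂ : X ⟶ X'} {g₁ g₂ : Y ⟶ Y'} (τ : f₁ ⟶ f₂) (σ : g₁ ⟶ g₂),
      ver K (cell K (eval₂ φ f₁ g₁)) (ten K T (cell K τ) (cell K σ)) =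
        ver K (ten K T (cell K τ) (cell K σ)) (cell K (eval₂ φ f₂ g₂))) ∧
    ∀ X Y : C, cell K (eval₂ φ (𝟙 X) (𝟙 Y)) = 0 := by
  refine LaxData.mem_specialCochains_zero_iff.trans (and_congr
    ⟨fun h X X' Y Y' f₁ f₂ g₁ g₂ τ σ => ?_, fun h X Y f f' τ => ?_⟩
    ⟨fun h X Y => h ((X, Y) : C × C), fun h X => h X.1 X.2⟩)
  · rw [ten_cell]
    exact h (X := ((X, Y) : C × C)) (Y := ((X', Y') : C × C)) (f := Prod.mkHom f₁ g₁)
      (f' := Prod.mkHom f₂ g₂) (Prod.mkHom τ σ)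
  · have (X Y : C × C) (f f' : X ⟶ Y) (τ : f ⟶ f') := h τ.1 τ.2
    simp only [ten_cell] at this
    exact this X Y f f' τ

theorem mem_specialCochains_eval₃ {φ : S.DoubleCochain 0 2} : φ ∈ (S.tens 2).specialCochains K 0 ↔
    (∀ {X X' Y Y' Z Z' : C} {f₁ f₂ : X ⟶ X'} {g₁ g₂ : Y ⟶ Y'} {h₁ h₂ : Z ⟶ Z'} (τ : f₁ ⟶ f₂)
      (σ : g₁ ⟶ g₂) (η : h₁ ⟶ h₂),
      ver K (cell K (eval₃ φ f₁ g₁ h₁)) (ten K T (cell K τ) (ten K T (cell K σ) (cell K η))) =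
        ver K (ten K T (cell K τ) (ten K T (cell K σ) (cell K η))) (cell K (eval₃ φ f₂ g₂ h₂))) ∧
    ∀ X Y Z : C, cell K (eval₃ φ (𝟙 X) (𝟙 Y) (𝟙 Z)) = 0 := by
  refine LaxData.mem_specialCochains_zero_iff.trans (and_congr
    ⟨fun h X X' Y Y' Z Z' f₁ f₂ g₁ g₂ h₁ h₂ τ σ η => ?_, fun h X Y f f' τ => ?_⟩
    ⟨fun h X Y Z => h ((X, Y, Z) : C × (C × C)), fun h X => h X.1 X.2.1 X.2.2⟩)
  · rw [ten_cell, ten_cell]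
    exact h (X := ((X, Y, Z) : C × (C × C))) (Y := ((X', Y', Z') : C × (C × C)))
      (f := Prod.mkHom f₁ (Prod.mkHom g₁ h₁)) (f' := Prod.mkHom f₂ (Prod.mkHom g₂ h₂))
      ⟨τ, ⟨σ, η⟩⟩
  · have (X Y : C × (C × C)) (f f' : X ⟶ Y) (τ : f ⟶ f') := h τ.1 τ.2.1 τ.2.2
    simp only [ten_cell] at this
    exact this X Y f f' τ

theorem mem_specialCochains_evalComp₂ [LinearComposition K C] {φ : S.DoubleCochain 1 1} :
    φ ∈ (S.tens 1).specialCochains K 1 ↔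
    (∀ {X X' X'' Y Y' Y'' : C} {f₁ f₂ : X ⟶ X'} {g₁ g₂ : Y ⟶ Y'} {f₁' f₂' : X' ⟶ X''}
      {g₁' g₂' : Y' ⟶ Y''} (τ : f₁ ⟶ f₂) (σ : g₁ ⟶ g₂) (τ' : f₁' ⟶ f₂') (σ' : g₁' ⟶ g₂'),
      ver K (cell K (evalComp₂ φ f₁ g₁ f₁' g₁'))
        (ten K T (hor K (cell K τ) (cell K τ')) (hor K (cell K σ) (cell K σ'))) =
      ver K (hor K (ten K T (cell K τ) (cell K σ)) (ten K T (cell K τ') (cell K σ')))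
        (cell K (evalComp₂ φ f₂ g₂ f₂' g₂'))) ∧
    (∀ {X X' Y Y' : C} (f : X ⟶ X') (g : Y ⟶ Y'),
      cell K (evalComp₂ φ f g (𝟙 X') (𝟙 Y')) = 0) ∧
    ∀ {X X' Y Y' : C} (f : X ⟶ X') (g : Y ⟶ Y'), cell K (evalComp₂ φ (𝟙 X) (𝟙 Y) f g) = 0 := by
  refine LaxData.mem_specialCochains_one_iff.trans (and_congr
    ⟨fun h X X' X'' Y Y' Y'' f₁ f₂ g₁ g₂ f₁' f₂' g₁' g₂' τ σ τ' σ' => ?_,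
      fun h X Y Z f₁ f₂ f₁' f₂' τ τ' => ?_⟩
    (and_congr ⟨fun h X X' Y Y' f g => ?_, fun h X Y f => h f.1 f.2⟩
      ⟨fun h X X' Y Y' f g => ?_, fun h X Y f => h f.1 f.2⟩))
  · rw [hor_cell, hor_cell, ten_cell, ten_cell, ten_cell]
    exact h (X := ((X, Y) : C × C)) (Y := ((X', Y') : C × C)) (Z := ((X'', Y'') : C × C))
      (f₁ := Prod.mkHom f₁ g₁) (f₂ := Prod.mkHom f₂ g₂) (f₁' := Prod.mkHom f₁' g₁')
      (f₂' := Prod.mkHom f₂' g₂') (Prod.mkHom τ σ) (Prod.mkHom τ' σ')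
  · have (X Y Z : C × C) (f₁ f₂ : X ⟶ Y) (f₁' f₂' : Y ⟶ Z) (τ : f₁ ⟶ f₂) (τ' : f₁' ⟶ f₂') :=
      h τ.1 τ.2 τ'.1 τ'.2
    simp only [hor_cell, ten_cell] at this
    have := this X Y Z f₁ f₂ f₁' f₂' τ τ'
    rw [hor_cell]
    exact this
  · exact h (X := ((X, Y) : C × C)) (Y := ((X', Y') : C × C)) (Prod.mkHom f g)
  · exact h (X := ((X, Y) : C × C)) (Y := ((X', Y') : C × C)) (Prod.mkHom f g)

end Special
-- The cocycle condition in degree 2, made explicit.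
section Cocycles
variable {K : Type uK} [CommRing K] {C : Type u} [Bicategory.{w, v} C] [Bicategory.Strict C]
  [∀ X Y : C, Preadditive (X ⟶ Y)] [∀ X Y : C, Linear K (X ⟶ Y)] [LinearComposition K C]
  {T : TensorFunctor C} [T.IsBilinear K] {A : AssociatorCells T} {S : SemigroupalStructure T A}

namespace SemigroupalData
variable {S : SemigroupalData T A}

theorem DoubleCochain.ext₃ {φ φ' : S.DoubleCochain 0 2}
    (h : ∀ {X X' Y Y' Z Z' : C} (f : X ⟶ X') (g : Y ⟶ Y') (h : Z ⟶ Z'),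
      cell K (eval₃ φ f g h) = cell K (eval₃ φ' f g h)) : φ = φ' :=
  LaxData.Cochain.ext₀ (K := K) fun f => h f.1 f.2.1 f.2.2

theorem DoubleCochain.ext₄ {φ φ' : S.DoubleCochain 0 3}
    (h : ∀ {X X' Y Y' Z Z' W W' : C} (f : X ⟶ X') (g : Y ⟶ Y') (h : Z ⟶ Z') (k : W ⟶ W'),
      cell K (eval₄ φ f g h k) = cell K (eval₄ φ' f g h k)) : φ = φ' :=
  LaxData.Cochain.ext₀ (K := K) fun f => h f.1 f.2.1 f.2.2.1 f.2.2.2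

theorem DoubleCochain.extComp₂ {φ φ' : S.DoubleCochain 1 1}
    (h : ∀ {X X' X'' Y Y' Y'' : C} (f : X ⟶ X') (g : Y ⟶ Y') (f' : X' ⟶ X'') (g' : Y' ⟶ Y''),
      cell K (evalComp₂ φ f g f' g') = cell K (evalComp₂ φ' f g f' g')) : φ = φ' :=
  LaxData.Cochain.ext₁ (K := K) fun f f' => h f.1 f.2 f'.1 f'.2

theorem DoubleCochain.extComp₃ {φ φ' : S.DoubleCochain 1 2}
    (h : ∀ {X X' X'' Y Y' Y'' Z Z' Z'' : C} (f : X ⟶ X') (g : Y ⟶ Y') (h : Z ⟶ Z') (f' : X' ⟶ X'')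
      (g' : Y' ⟶ Y'') (h' : Z' ⟶ Z''),
      cell K (evalComp₃ φ f g h f' g' h') = cell K (evalComp₃ φ' f g h f' g' h')) : φ = φ' :=
  LaxData.Cochain.ext₁ (K := K) fun f f' => h f.1 f.2.1 f.2.2 f'.1 f'.2.1 f'.2.2

theorem PentCochain.ext₄ {p p' : S.PentCochain 3}
    (h : ∀ X Y Z W : C, cell K (pent₄ p X Y Z W) = cell K (pent₄ p' X Y Z W)) : p = p' :=
  funext fun X => cell_injective K (h X.1 X.2.1 X.2.2.1 X.2.2.2)

theorem PentCochain.ext₅ {p p' : S.PentCochain 4}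
    (h : ∀ X Y Z V U : C, cell K (pent₅ p X Y Z V U) = cell K (pent₅ p' X Y Z V U)) : p = p' :=
  funext fun X => cell_injective K (h X.1 X.2.1 X.2.2.1 X.2.2.2.1 X.2.2.2.2)

end SemigroupalData

open SemigroupalData

namespace SemigroupalStructure
variable (S)

theorem cell_delta_zero_one (φ : S.DoubleCochain 0 1) {X X' X'' Y Y' Y'' : C} (f : X ⟶ X')
    (g : Y ⟶ Y') (f' : X' ⟶ X'') (g' : Y' ⟶ Y'') :
    cell K (evalComp₂ ((S.tens 1).delta K 0 φ) f g f' g') =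
      ver K (hor K (cell K (eval₂ φ f g)) (cellId K (T.map f' g'))) (S.tensorCell K f g f' g') -
      ver K (S.tensorCell K f g f' g') (cell K (eval₂ φ (f ≫ f') (g ≫ g'))) +
      ver K (hor K (cellId K (T.map f g)) (cell K (eval₂ φ f' g'))) (S.tensorCell K f g f' g') := by
  have e : cell K ((S.tens 1).mapComp (X := ((X, Y) : C × C)) (Y := ((X', Y') : C × C))
      (Z := ((X'', Y'') : C × C)) (Prod.mkHom f g) (Prod.mkHom f' g')) =
      S.tensorCell K f g f' g' :=
    congrArg (cell K) ((congrArg (_ ≫ ·) (T.map₂_id _ _)).trans (Category.comp_id _))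
  rw [← e]
  exact LaxData.cell_eval₁_delta (K := K) (F := S.tens 1) φ (X := ((X, Y) : C × C))
    (Y := ((X', Y') : C × C)) (Z := ((X'', Y'') : C × C)) (Prod.mkHom f g) (Prod.mkHom f' g')

theorem cell_delta_zero_two (φ : S.DoubleCochain 0 2) {X X' X'' Y Y' Y'' Z Z' Z'' : C} (f : X ⟶ X')
    (g : Y ⟶ Y') (h : Z ⟶ Z') (f' : X' ⟶ X'') (g' : Y' ⟶ Y'') (h' : Z' ⟶ Z'') :
    cell K (evalComp₃ ((S.tens 2).delta K 0 φ) f g h f' g' h') =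
      ver K (hor K (cell K (eval₃ φ f g h)) (cellId K (T.map f' (T.map g' h'))))
        (S.tensorCell₃ K f g h f' g' h') -
      ver K (S.tensorCell₃ K f g h f' g' h') (cell K (eval₃ φ (f ≫ f') (g ≫ g') (h ≫ h'))) +
      ver K (hor K (cellId K (T.map f (T.map g h))) (cell K (eval₃ φ f' g' h')))
        (S.tensorCell₃ K f g h f' g' h') := by
  have e : cell K ((S.tens 2).mapComp (X := ((X, Y, Z) : C × (C × C)))
      (Y := ((X', Y', Z') : C × (C × C))) (Z := ((X'', Y'', Z'') : C × (C × C)))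
      (Prod.mkHom f (Prod.mkHom g h)) (Prod.mkHom f' (Prod.mkHom g' h'))) =
      S.tensorCell₃ K f g h f' g' h' := by
    refine (congrArg (cell K) (congrArg (_ ≫ ·) (congrArg (T.map₂ (𝟙 (f ≫ f')) ·)
      ((congrArg (_ ≫ ·) (T.map₂_id _ _)).trans (Category.comp_id _))))).trans ?_
    rw [tensorCell₃, tensorCell, tensorCell, cellId, ten_cell, ver_cell]
    rfl
  rw [← e]
  exact LaxData.cell_eval₁_delta (K := K) (F := S.tens 2) φ (X := ((X, Y, Z) : C × (C × C)))
    (Y := ((X', Y', Z') : C × (C × C))) (Z := ((X'', Y'', Z'') : C × (C × C)))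
    (Prod.mkHom f (Prod.mkHom g h)) (Prod.mkHom f' (Prod.mkHom g' h'))

theorem cell_delta_one_one (φ : S.DoubleCochain 1 1) {X X' X'' X''' Y Y' Y'' Y''' : C} (f : X ⟶ X')
    (g : Y ⟶ Y') (f' : X' ⟶ X'') (g' : Y' ⟶ Y'') (f'' : X'' ⟶ X''') (g'' : Y'' ⟶ Y''') :
    cell K ((S.tens 1).delta K 1 φ ((X, Y) : C × C) ((X''', Y''') : C × C)
      (.cons (Y := ((X'', Y'') : C × C)) (Prod.mkHom f'' g'')
        (.cons (Y := ((X', Y') : C × C)) (Prod.mkHom f' g') (.single (Prod.mkHom f g))))) =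
      ver K (hor K (cell K (evalComp₂ φ f g f' g')) (cellId K (T.map f'' g'')))
        (S.tensorCell K (f ≫ f') (g ≫ g') f'' g'') -
      ver K (hor K (cellId K (T.map f g)) (S.tensorCell K f' g' f'' g''))
        (cell K (evalComp₂ φ f g (f' ≫ f'') (g' ≫ g''))) +
      ver K (hor K (S.tensorCell K f g f' g') (cellId K (T.map f'' g'')))
        (cell K (evalComp₂ φ (f ≫ f') (g ≫ g') f'' g'')) -
      ver K (hor K (cellId K (T.map f g)) (cell K (evalComp₂ φ f' g' f'' g'')))
        (S.tensorCell K f g (f' ≫ f'') (g' ≫ g'')) := by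
  have e {X X' X'' Y Y' Y'' : C} (f : X ⟶ X') (g : Y ⟶ Y') (f' : X' ⟶ X'') (g' : Y' ⟶ Y'') :
      cell K ((S.tens 1).mapComp (X := ((X, Y) : C × C)) (Y := ((X', Y') : C × C))
      (Z := ((X'', Y'') : C × C)) (Prod.mkHom f g) (Prod.mkHom f' g')) =
      S.tensorCell K f g f' g' :=
    congrArg (cell K) ((congrArg (_ ≫ ·) (T.map₂_id _ _)).trans (Category.comp_id _))
  rw [← e, ← e, ← e, ← e]
  exact LaxData.cell_delta_one (K := K) (F := S.tens 1) φ (X := ((X, Y) : C × C))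
    (Y := ((X', Y') : C × C)) (Z := ((X'', Y'') : C × C)) (W := ((X''', Y''') : C × C))
    (Prod.mkHom f g) (Prod.mkHom f' g') (Prod.mkHom f'' g'')
    ((IsIdentityTwo.associator_inv f f' f'').map₂ T (.associator_inv g g' g''))

variable (K) in
/-- The conditions for `(b, q, t)` to be a cocycle of degree 2 of the unitary deformation complex,
in terms of the space of all 2-morphisms. -/
structure IsCocycle (b : S.DoubleCochain 0 2) (q : S.PentCochain 3) (t : S.DoubleCochain 1 1) :
    Prop where
  tensor_mem : t ∈ (S.tens 1).specialCochains K 1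
  assoc_mem : b ∈ (S.tens 2).specialCochains K 0
  tensor {X X' X'' X''' Y Y' Y'' Y''' : C} (f : X ⟶ X')
    (g : Y ⟶ Y') (f' : X' ⟶ X'') (g' : Y' ⟶ Y'') (f'' : X'' ⟶ X''') (g'' : Y'' ⟶ Y''') :
    ver K (hor K (S.tensorCell K f g f' g') (cellId K (T.map f'' g'')))
        (cell K (evalComp₂ t (f ≫ f') (g ≫ g') f'' g'')) +
      ver K (hor K (cell K (evalComp₂ t f g f' g')) (cellId K (T.map f'' g'')))
        (S.tensorCell K (f ≫ f') (g ≫ g') f'' g'') =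
      ver K (hor K (cellId K (T.map f g)) (S.tensorCell K f' g' f'' g''))
        (cell K (evalComp₂ t f g (f' ≫ f'') (g' ≫ g''))) +
      ver K (hor K (cellId K (T.map f g)) (cell K (evalComp₂ t f' g' f'' g'')))
        (S.tensorCell K f g (f' ≫ f'') (g' ≫ g''))
  assoc {X X' X'' Y Y' Y'' Z Z' Z'' : C} (f : X ⟶ X')
    (g : Y ⟶ Y') (h : Z ⟶ Z') (f' : X' ⟶ X'') (g' : Y' ⟶ Y'') (h' : Z' ⟶ Z'') :
    ver K (S.tensorCell₃ K f g h f' g' h') (cell K (eval₃ b (f ≫ f') (g ≫ g') (h ≫ h'))) +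
        (ver K (S.tensorCell K (T.map f g) h (T.map f' g') h')
          (ten K T (cell K (evalComp₂ t f g f' g')) (cellId K (h ≫ h'))) +
        ver K (cell K (evalComp₂ t (T.map f g) h (T.map f' g') h'))
          (ten K T (S.tensorCell K f g f' g') (cellId K (h ≫ h')))) =
      ver K (S.tensorCell K f (T.map g h) f' (T.map g' h'))
          (ten K T (cellId K (f ≫ f')) (cell K (evalComp₂ t g h g' h'))) +
        ver K (cell K (evalComp₂ t f (T.map g h) f' (T.map g' h')))
          (ten K T (cellId K (f ≫ f')) (S.tensorCell K g h g' h')) +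
        ver K (hor K (cellId K (T.map f (T.map g h))) (cell K (eval₃ b f' g' h')))
          (S.tensorCell₃ K f g h f' g' h') +
        ver K (hor K (cell K (eval₃ b f g h)) (cellId K (T.map f' (T.map g' h'))))
          (S.tensorCell₃ K f g h f' g' h')
  pent {X X' Y Y' Z Z' W W' : C} (f : X ⟶ X') (g : Y ⟶ Y') (h : Z ⟶ Z') (k : W ⟶ W') :
    hor K (cell K (pent₄ q X Y Z W)) (cellId K (T.map (T.map (T.map f g) h) k)) +
        cell K (eval₃ b (T.map f g) h k) + cell K (eval₃ b f g (T.map h k)) =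
      ten K T (cell K (eval₃ b f g h)) (cellId K k) + cell K (eval₃ b f (T.map g h) k) +
        ten K T (cellId K f) (cell K (eval₃ b g h k)) +
        hor K (cellId K (T.map f (T.map g (T.map h k)))) (cell K (pent₄ q X' Y' Z' W'))
  pent_K₅ (X Y Z V U : C) :
    ten K T (cell K (pent₄ q X Y Z V)) (cellId K (𝟙 U)) + cell K (pent₄ q X Y (T.obj Z V) U) +
        cell K (pent₄ q (T.obj X Y) Z V U) =
      ten K T (cellId K (𝟙 X)) (cell K (pent₄ q Y Z V U)) + cell K (pent₄ q X (T.obj Y Z) V U) +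
        cell K (pent₄ q X Y Z (T.obj V U))

end SemigroupalStructure

namespace SemigroupalData
variable {S : SemigroupalData T A}

/-- The component in `X^{1,1}` of a cochain of degree 2. -/
def TotalCochain.tensor (x : S.TotalCochain 2) : S.DoubleCochain 1 1 := x ⟨(1, 0), rfl⟩

/-- The component in `X^{0,2}` of a cochain of degree 2. -/
def TotalCochain.assoc (x : S.TotalCochain 2) : S.DoubleCochain 0 2 := (x ⟨(0, 1), rfl⟩).1

/-- The component in the pentagonator complex of a cochain of degree 2. -/
def TotalCochain.pent (x : S.TotalCochain 2) : S.PentCochain 3 := (x ⟨(0, 1), rfl⟩).2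

/-- The component in `X^{0,1}` of a cochain of degree 1. -/
def TotalCochain.nat (x : S.TotalCochain 1) : S.DoubleCochain 0 1 := (x ⟨(0, 0), rfl⟩).1

/-- The component in the pentagonator complex of a cochain of degree 1. -/
def TotalCochain.omega (x : S.TotalCochain 1) : S.PentCochain 2 := (x ⟨(0, 0), rfl⟩).2

/-- The cochain of degree 1 with given components. -/
def TotalCochain.mk₁ (ψ : S.DoubleCochain 0 1) (ω : S.PentCochain 2) : S.TotalCochain 1
  | ⟨(0, 0), _⟩ => (ψ, ω)
  | ⟨(0, n + 1), h⟩ => absurd h (by simp)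
  | ⟨(m + 1, n), h⟩ => absurd h (by simp; try omega)

theorem TotalCochain.ext₂ {x y : S.TotalCochain 2} (ht : x.tensor = y.tensor)
    (ha : x.assoc = y.assoc) (hp : x.pent = y.pent) : x = y := by
  funext ⟨⟨m, n⟩, h⟩
  have h' : m + (n + 1) = 2 := h
  obtain ⟨rfl, rfl⟩ | ⟨rfl, rfl⟩ : m = 0 ∧ n = 1 ∨ m = 1 ∧ n = 0 := by omega
  · exact Prod.ext ha hp
  · exact ht

theorem mem_unitaryCochains_one_iff {x : S.TotalCochain 1} :
    x ∈ S.unitaryCochains K 1 ↔ x.nat ∈ (S.tens 1).specialCochains K 0 := by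
  refine ⟨fun h => (h ⟨(0, 0), rfl⟩ trivial).1, fun hn => ?_⟩
  rintro ⟨⟨m, n⟩, h⟩ -
  have h' : m + (n + 1) = 1 := h
  obtain ⟨rfl, rfl⟩ : m = 0 ∧ n = 0 := by omega
  exact ⟨hn, trivial⟩

theorem mem_unitaryCochains_two_iff {x : S.TotalCochain 2} :
    x ∈ S.unitaryCochains K 2 ↔ x.tensor ∈ (S.tens 1).specialCochains K 1 ∧
      x.assoc ∈ (S.tens 2).specialCochains K 0 := by
  refine ⟨fun h => ⟨h ⟨(1, 0), rfl⟩ trivial, (h ⟨(0, 1), rfl⟩ trivial).1⟩, fun ⟨ht, ha⟩ => ?_⟩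
  rintro ⟨⟨m, n⟩, h⟩ -
  have h' : m + (n + 1) = 2 := h
  obtain ⟨rfl, rfl⟩ | ⟨rfl, rfl⟩ : m = 0 ∧ n = 1 ∨ m = 1 ∧ n = 0 := by omega
  · exact ⟨ha, trivial⟩
  · exact ht

end SemigroupalData

namespace SemigroupalStructure.IsGray

variable (hS : S.IsGray)

/-- The minus sign is (-1)ⁿ with n = 1, the row in which `x.nat` lies. -/
theorem deltaUnit_one_tensor (x : S.TotalCochain 1) :
    TotalCochain.tensor (hS.deltaUnit K 1 x) = -(S.tens 1).delta K 0 x.nat :=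
  (congrArg (fun r : K => r • (S.tens 1).delta K 0 x.nat) (pow_one _)).trans (neg_one_smul _ _)

theorem deltaUnit_one_assoc (x : S.TotalCochain 1) :
    TotalCochain.assoc (hS.deltaUnit K 1 x) = hS.deltaV K 0 1 x.nat + S.phi K 2 x.omega := rfl

theorem deltaUnit_one_pent (x : S.TotalCochain 1) :
    TotalCochain.pent (hS.deltaUnit K 1 x) = -hS.deltaPent K 2 x.omega := rfl

/-- One equation for each of the bidegrees (2,1), (1,2), (0,3), and one for the pentagonator part of
the first column; overall signs are discarded. -/
theorem deltaUnit_two_eq_zero_iff (x : S.TotalCochain 2) : hS.deltaUnit K 2 x = 0 ↔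
    (S.tens 1).delta K 1 x.tensor = 0 ∧
    (S.tens 2).delta K 0 x.assoc + hS.deltaV K 1 1 x.tensor = 0 ∧
    hS.deltaV K 0 2 x.assoc + S.phi K 3 x.pent = 0 ∧ hS.deltaPent K 3 x.pent = 0 := by
  have h₂₀ : hS.deltaUnit K 2 x ⟨(2, 0), rfl⟩ = -(S.tens 1).delta K 1 x.tensor :=
    (congrArg (fun r : K => r • (S.tens 1).delta K 1 x.tensor) (pow_one _)).trans
      (neg_one_smul _ _)
  have h₁₁ : hS.deltaUnit K 2 x ⟨(1, 1), rfl⟩ =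
      (S.tens 2).delta K 0 x.assoc + hS.deltaV K 1 1 x.tensor :=
    congrArg (· + hS.deltaV K 1 1 x.tensor)
      ((congrArg (fun r : K => r • (S.tens 2).delta K 0 x.assoc) (neg_one_sq)).trans (one_smul _ _))
  have h₀₂ : hS.deltaUnit K 2 x ⟨(0, 2), rfl⟩ =
      (hS.deltaV K 0 2 x.assoc + S.phi K 3 x.pent, -hS.deltaPent K 3 x.pent) := rfl
  refine ⟨fun h => ?_, fun ⟨ha, hb, hc, hd⟩ => ?_⟩
  · have h' := congrFun h
    refine ⟨neg_eq_zero.1 (h₂₀.symm.trans (h' _)), h₁₁.symm.trans (h' _),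
      congrArg Prod.fst (h₀₂.symm.trans (h' _)),
      neg_eq_zero.1 (congrArg Prod.snd (h₀₂.symm.trans (h' _)))⟩
  · funext ⟨⟨m, n⟩, h⟩
    have h' : m + (n + 1) = 3 := h
    -- The index (m, n) stands for bidegree (m, n + 1), so total degree 3 leaves three entries.
    obtain ⟨rfl, rfl⟩ | ⟨rfl, rfl⟩ | ⟨rfl, rfl⟩ :
      m = 0 ∧ n = 2 ∨ m = 1 ∧ n = 1 ∨ m = 2 ∧ n = 0 := by omega
    · exact h₀₂.trans (Prod.ext hc (neg_eq_zero.2 hd))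
    · exact h₁₁.trans hb
    · exact h₂₀.trans (neg_eq_zero.2 ha)

theorem cell_add_evalComp₃ {φ φ' : S.DoubleCochain 1 2} {X X' X'' Y Y' Y'' Z Z' Z'' : C} (f : X ⟶ X')
    (g : Y ⟶ Y') (h : Z ⟶ Z') (f' : X' ⟶ X'') (g' : Y' ⟶ Y'') (h' : Z' ⟶ Z'') :
    cell K (evalComp₃ (φ + φ') f g h f' g' h') =
      cell K (evalComp₃ φ f g h f' g' h') + cell K (evalComp₃ φ' f g h f' g' h') :=
  map_add (cell K) _ _

theorem cell_add_eval₄ {φ φ' : S.DoubleCochain 0 3} {X X' Y Y' Z Z' W W' : C} (f : X ⟶ X')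
    (g : Y ⟶ Y') (h : Z ⟶ Z') (k : W ⟶ W') :
    cell K (eval₄ (φ + φ') f g h k) = cell K (eval₄ φ f g h k) + cell K (eval₄ φ' f g h k) :=
  map_add (cell K) _ _

/-- The four vanishing conditions are the four equations of `IsCocycle` with all terms on one side;
expanding the differentials on cells leaves only a rearrangement of summands. -/
theorem mem_unitaryCocycles_iff (x : S.TotalCochain 2) :
    x ∈ hS.unitaryCocycles K 2 ↔ S.IsCocycle K x.assoc x.pent x.tensor := by
  rw [unitaryCocycles, Submodule.mem_inf, mem_unitaryCochains_two_iff, LinearMap.mem_ker,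
    hS.deltaUnit_two_eq_zero_iff]
  constructor
  · rintro ⟨⟨ht, ha⟩, h₁, h₂, h₃, h₄⟩
    refine ⟨ht, ha, fun {X X' X'' X''' Y Y' Y'' Y'''} f g f' g' f'' g'' => ?_, fun f g h f' g' h' => ?_, fun f g h k => ?_,
      fun X Y Z V U => ?_⟩
    · have h := S.cell_delta_one_one (K := K) x.tensor f g f' g' f'' g''
      rw [h₁] at h
      have h := (map_zero (cell K)).symm.trans h
      rw [eq_comm, ← sub_eq_zero] at h
      rw [← sub_eq_zero, ← h]
      abel
    · have e := cell_add_evalComp₃ (K := K) (φ := (S.tens 2).delta K 0 x.assoc)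
        (φ' := hS.deltaV K 1 1 x.tensor) f g h f' g' h'
      rw [h₂] at e
      have e := (map_zero (cell K)).symm.trans e
      rw [S.cell_delta_zero_two, hS.cell_deltaV_one_one, eq_comm, ← sub_eq_zero] at e
      rw [eq_comm, ← sub_eq_zero, ← e]
      abel
    · have e := cell_add_eval₄ (K := K) (φ := hS.deltaV K 0 2 x.assoc) (φ' := S.phi K 3 x.pent) f g h k
      rw [h₃] at e
      have e := (map_zero (cell K)).symm.trans e
      rw [hS.cell_deltaV_zero_two, cell_eval₄_phi, eq_comm, ← sub_eq_zero] at e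
      -- The modification axiom whiskers with a product bracketed to the left, the differential with
      -- one bracketed to the right; their identity cells coincide.
      rw [hS.cellId_map_assoc, hS.cellId_map_assoc, eq_comm, ← sub_eq_zero, ← e]
      abel
    · have e := hS.cell_deltaPent₃ (K := K) x.pent X Y Z V U
      rw [h₄] at e
      have e := (map_zero (cell K)).symm.trans e
      rw [eq_comm, ← sub_eq_zero] at e
      rw [eq_comm, ← sub_eq_zero, ← e]
      abel
  · intro H
    refine ⟨⟨H.tensor_mem, H.assoc_mem⟩, ?_, ?_, ?_, ?_⟩
    · funext X Y c
      cases c with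
      | cons f'' c =>
        cases c with
        | cons f' c =>
          cases c with
          | single f =>
            refine cell_injective K ((S.cell_delta_one_one (K := K) x.tensor f.1 f.2 f'.1 f'.2
              f''.1 f''.2).trans (Eq.trans ?_ (map_zero (cell K)).symm))
            rw [← sub_eq_zero.2 (H.tensor f.1 f.2 f'.1 f'.2 f''.1 f''.2)]
            abel
    · refine DoubleCochain.extComp₃ (K := K) fun f g h f' g' h' =>
        (cell_add_evalComp₃ f g h f' g' h').trans (Eq.trans ?_ (map_zero (cell K)).symm)
      rw [S.cell_delta_zero_two, hS.cell_deltaV_one_one,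
        ← sub_eq_zero.2 (H.assoc f g h f' g' h').symm]
      abel
    · refine DoubleCochain.ext₄ (K := K) fun f g h k =>
        (cell_add_eval₄ f g h k).trans (Eq.trans ?_ (map_zero (cell K)).symm)
      have e := H.pent f g h k
      rw [hS.cellId_map_assoc, hS.cellId_map_assoc] at e
      rw [hS.cell_deltaV_zero_two, cell_eval₄_phi, ← sub_eq_zero.2 e.symm]
      abel
    · refine PentCochain.ext₅ (K := K) fun X Y Z V U =>
        (hS.cell_deltaPent₃ x.pent X Y Z V U).trans (Eq.trans ?_ (map_zero (cell K)).symm)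
      rw [← sub_eq_zero.2 (H.pent_K₅ X Y Z V U).symm]
      abel

end SemigroupalStructure.IsGray

end Cocycles
-- First order terms of a deformation form a cocycle.
section Deformations
variable {K : Type uK} [CommRing K] {C : Type u} [Bicategory.{w, v} C] [Bicategory.Strict C]
  [∀ X Y : C, Preadditive (X ⟶ Y)] [∀ X Y : C, Linear K (X ⟶ Y)] [LinearComposition K C]
  {T : TensorFunctor C} [T.IsBilinear K] {A : AssociatorCells T} {S : SemigroupalStructure T A}
open SemigroupalData

namespace UnitaryDeformation

variable (D : UnitaryDeformation K S)

theorem reducesTo : ReducesTo S D.toSemigroupalData := fun f g f' g' =>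
  D.tensorComp_zero f.of g.of f'.of g'.of

variable (hS : S.IsGray)

section
include hS

theorem tensorId_isIdentityTwo (X Y : FirstOrderExt K C) : IsIdentityTwo (D.tensorId X Y).hom :=
  IsIdentityTwo.firstOrder ((D.tensorId_zero X.as Y.as).symm ▸ hS.tensorId X.as Y.as)
    (D.tensorId_one X.as Y.as)

/-- All unit conditions come from the undeformed `⊗₀` through the unit axioms of the deformed
structure itself. -/
theorem unitaryLift : UnitaryLift D.toSemigroupalData where
  tensorId := D.tensorId_isIdentityTwo hS
  tensorComp_right f g _ _ hf' hg' := D.toSemigroupalStructure.tensorComp_isIdentityTwo_of_right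
    (D.tensorId_isIdentityTwo hS) f g hf' hg'
  tensorComp_left hf hg f' g' := D.toSemigroupalStructure.tensorComp_isIdentityTwo_of_left
    (D.tensorId_isIdentityTwo hS) hf hg f' g'
  assoc_identity hf hg hh := D.toSemigroupalStructure.assoc_isIdentityTwo
    (D.tensorId_isIdentityTwo hS) hf hg hh
  assoc f g h := (D.assoc_zero f.of g.of h.of).symm ▸ hS.assoc f.of g.of h.of
  pent X Y Z W := (D.pent_zero X.as Y.as Z.as W.as).symm ▸ hS.pent X.as Y.as Z.as W.as

end

theorem cell_firstOrderTerm_tensor {X X' X'' Y Y' Y'' : FirstOrderExt K C} (f : X ⟶ X')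
    (g : Y ⟶ Y') (f' : X' ⟶ X'') (g' : Y' ⟶ Y'') :
    cell K (evalComp₂ (D.firstOrderTerm hS).tensor f.of g.of f'.of g'.of) =
      cell₁ K (D.tensorComp f g f' g').hom := rfl

theorem cell_firstOrderTerm_assoc {X X' Y Y' Z Z' : FirstOrderExt K C} (f : X ⟶ X')
    (g : Y ⟶ Y') (h : Z ⟶ Z') :
    cell K (eval₃ (D.firstOrderTerm hS).assoc f.of g.of h.of) = cell₁ K (D.assoc f g h).hom :=
  cell_castHom₂ ..

theorem cell_firstOrderTerm_pent (X Y Z W : FirstOrderExt K C) :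
    cell K (pent₄ (D.firstOrderTerm hS).pent X.as Y.as Z.as W.as) =
      cell₁ K (D.pent X Y Z W).hom :=
  cell_castHom₂ ..

/-- Each axiom of the deformation, read at first order, is one of the conditions of `IsCocycle`; the
unit axioms give specialness. -/
theorem firstOrderTerm_mem : D.firstOrderTerm hS ∈ hS.unitaryCocycles K 2 := by
  have hD := D.unitaryLift hS
  have i := IsIdentityOne.id (C := FirstOrderExt K C)
  rw [hS.mem_unitaryCocycles_iff]
  refine ⟨mem_specialCochains_evalComp₂.2 ⟨fun {X X' X'' Y Y' Y'' f₁ f₂ g₁ g₂ f₁' f₂' g₁' g₂'} τ σ τ' σ' => ?_, fun {X X' Y Y'} f g => ?_,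
    fun {X X' Y Y'} f g => ?_⟩, mem_specialCochains_eval₃.2 ⟨fun {X X' Y Y' Z Z' f₁ f₂ g₁ g₂ h₁ h₂} τ σ η => ?_, fun X Y Z => ?_⟩,
    fun {X X' X'' X''' Y Y' Y'' Y'''} f g f' g' f'' g'' => ?_, fun {X X' X'' Y Y' Y'' Z Z' Z''} f g h f' g' h' => ?_,
    fun {X X' Y Y' Z Z' W W'} f g h k => ?_, fun X Y Z V U => ?_⟩
  -- Constant 2-morphisms τ + 0ε suffice, since naturality of a cochain involves only 2-morphisms of
  -- `C`.
  · exact (ReducesTo.tensorComp_naturality_iff D.reducesTo (X := ⟨X⟩) (X' := ⟨X'⟩) (X'' := ⟨X''⟩) (Y := ⟨Y⟩)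
      (Y' := ⟨Y'⟩) (Y'' := ⟨Y''⟩) (f₁ := ⟨f₁⟩) (f₂ := ⟨f₂⟩) (g₁ := ⟨g₁⟩) (g₂ := ⟨g₂⟩)
      (f₁' := ⟨f₁'⟩) (f₂' := ⟨f₂'⟩) (g₁' := ⟨g₁'⟩) (g₂' := ⟨g₂'⟩) ⟨τ, 0⟩ ⟨σ, 0⟩ ⟨τ', 0⟩ ⟨σ', 0⟩).1
      (D.tensorComp_naturality _ _ _ _)
  · exact (hD.tensorComp_right (X := ⟨X⟩) (X' := ⟨X'⟩) (Y := ⟨Y⟩) (Y' := ⟨Y'⟩) ⟨f⟩ ⟨g⟩ (i ⟨X'⟩)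
      (i ⟨Y'⟩)).cell₁
  · exact (hD.tensorComp_left (X' := ⟨X⟩) (X'' := ⟨X'⟩) (Y' := ⟨Y⟩) (Y'' := ⟨Y'⟩) (i ⟨X⟩) (i ⟨Y⟩) ⟨f⟩
      ⟨g⟩).cell₁
  · have := (hD.assoc_naturality_iff hS (X := ⟨X⟩) (X' := ⟨X'⟩) (Y := ⟨Y⟩) (Y' := ⟨Y'⟩)
      (Z := ⟨Z⟩) (Z' := ⟨Z'⟩) (f₁ := ⟨f₁⟩) (f₂ := ⟨f₂⟩) (g₁ := ⟨g₁⟩) (g₂ := ⟨g₂⟩) (h₁ := ⟨h₁⟩) (h₂ := ⟨h₂⟩)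
      ⟨τ, 0⟩ ⟨σ, 0⟩ ⟨η, 0⟩).1 (D.assoc_naturality _ _ _)
    rw [← cell_firstOrderTerm_assoc D hS, ← cell_firstOrderTerm_assoc D hS] at this
    exact this
  · exact (D.cell_firstOrderTerm_assoc hS _ _ _).trans
      (hD.assoc_identity (i ⟨X⟩) (i ⟨Y⟩) (i ⟨Z⟩)).cell₁
  · exact (ReducesTo.tensorComp_assoc_iff D.reducesTo (X := ⟨X⟩) (X' := ⟨X'⟩) (X'' := ⟨X''⟩) (X''' := ⟨X'''⟩)
      (Y := ⟨Y⟩) (Y' := ⟨Y'⟩) (Y'' := ⟨Y''⟩) (Y''' := ⟨Y'''⟩) ⟨f⟩ ⟨g⟩ ⟨f'⟩ ⟨g'⟩ ⟨f''⟩ ⟨g''⟩).1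
      (D.tensorComp_assoc _ _ _ _ _ _)
  · have := (hD.assoc_comp_iff hS D.reducesTo (X := ⟨X⟩) (X' := ⟨X'⟩) (X'' := ⟨X''⟩)
      (Y := ⟨Y⟩) (Y' := ⟨Y'⟩) (Y'' := ⟨Y''⟩) (Z := ⟨Z⟩) (Z' := ⟨Z'⟩) (Z'' := ⟨Z''⟩)
      ⟨f⟩ ⟨g⟩ ⟨h⟩ ⟨f'⟩ ⟨g'⟩ ⟨h'⟩).1 (D.assoc_comp _ _ _ _ _ _)
    simp only [← cell_firstOrderTerm_assoc D hS] at this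
    exact this
  · have := (hD.pent_naturality_iff hS (X := ⟨X⟩) (X' := ⟨X'⟩)
      (Y := ⟨Y⟩) (Y' := ⟨Y'⟩) (Z := ⟨Z⟩) (Z' := ⟨Z'⟩) (W := ⟨W⟩) (W' := ⟨W'⟩)
      ⟨f⟩ ⟨g⟩ ⟨h⟩ ⟨k⟩).1 (D.pent_naturality _ _ _ _)
    simp only [← cell_firstOrderTerm_assoc D hS, ← cell_firstOrderTerm_pent D hS] at this
    exact this
  · have := (hD.pent_K₅_iff hS ⟨X⟩ ⟨Y⟩ ⟨Z⟩ ⟨V⟩ ⟨U⟩).1 (D.pent_K₅ _ _ _ _ _)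
    simp only [← cell_firstOrderTerm_pent D hS] at this
    exact this

end UnitaryDeformation

end Deformations
-- Every cocycle is realised by a deformation.
section Realization
variable {K : Type uK} [CommRing K] {C : Type u} [Bicategory.{w, v} C]
  [∀ X Y : C, Preadditive (X ⟶ Y)]

/-- The 2-isomorphism `η + x ε` of the first order extension. -/
def deformIso {X Y : FirstOrderExt K C} {f g : FirstOrderHom X Y} (η : f.of ≅ g.of)
    (x : f.of ⟶ g.of) : f ≅ g where
  hom := (⟨η.hom, x⟩ : FirstOrderHom₂ f g)
  inv := (⟨η.inv, -(η.inv ≫ x ≫ η.inv)⟩ : FirstOrderHom₂ g f)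
  hom_inv_id := FirstOrderHom₂.ext (by simp) (by simp)
  inv_hom_id := FirstOrderHom₂.ext (by simp) (by simp)

variable [Bicategory.Strict C] [∀ X Y : C, Linear K (X ⟶ Y)] [LinearComposition K C]
  {T : TensorFunctor C} [T.IsBilinear K] {A : AssociatorCells T} {S : SemigroupalStructure T A}
open SemigroupalData

namespace SemigroupalStructure.IsGray

variable (hS : S.IsGray)

variable (K) in
/-- The structural 2-isomorphisms of the first order extension with prescribed first order terms. -/
def deformedData (b : S.DoubleCochain 0 2) (q : S.PentCochain 3) (t : S.DoubleCochain 1 1) :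
    SemigroupalData (T.firstOrder K) (A.firstOrder K) where
  tensorComp f g f' g' := deformIso (S.tensorComp f.of g.of f'.of g'.of)
    (evalComp₂ t f.of g.of f'.of g'.of)
  tensorId X Y := deformIso (S.tensorId X.as Y.as) 0
  assoc {_ X' _ Y' _ Z'} f g h := deformIso (S.assoc f.of g.of h.of)
    (castHom₂ K rfl (hS.tensor_assoc _ _ _)
      (((hS.a _ _ _).comp_heq _).trans (hS.map_assoc f.of g.of h.of)).symm
      ((hS.a X'.as Y'.as Z'.as).heq_comp (T.map f.of (T.map g.of h.of))).symm
      (eval₃ b f.of g.of h.of))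
  pent X Y Z W := deformIso (S.pent X.as Y.as Z.as W.as)
    (castHom₂ K rfl ((hS.tensor_assoc _ _ _).trans (hS.tensor_assoc _ _ _))
      (hS.pent_src_heq X.as Y.as Z.as W.as).symm
      ((heq_of_eq (hS.pent X.as Y.as Z.as W.as).1.symm).trans
        (hS.pent_src_heq X.as Y.as Z.as W.as)).symm
      (pent₄ q X.as Y.as Z.as W.as))

variable (b : S.DoubleCochain 0 2) (q : S.PentCochain 3) (t : S.DoubleCochain 1 1)

theorem cell₁_deformedData_assoc {X X' Y Y' Z Z' : FirstOrderExt K C} (f : X ⟶ X')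
    (g : Y ⟶ Y') (h : Z ⟶ Z') :
    cell₁ K ((hS.deformedData K b q t).assoc f g h).hom = cell K (eval₃ b f.of g.of h.of) :=
  cell_castHom₂ ..

theorem cell₁_deformedData_pent (X Y Z W : FirstOrderExt K C) :
    cell₁ K ((hS.deformedData K b q t).pent X Y Z W).hom =
      cell K (pent₄ q X.as Y.as Z.as W.as) :=
  cell_castHom₂ ..

theorem reducesTo_deformedData : ReducesTo S (hS.deformedData K b q t) := fun _ _ _ _ => rfl

variable {b q t}

/-- Specialness is stated for literal identities; this extends it to 1-morphisms that are identities
only up to equality of objects. -/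
theorem cell_evalComp₂_of_right (ht : t ∈ (S.tens 1).specialCochains K 1)
    {X X' X'' Y Y' Y'' : C} (f : X ⟶ X')
    (g : Y ⟶ Y') {f' : X' ⟶ X''} {g' : Y' ⟶ Y''} (hf' : IsIdentityOne f') (hg' : IsIdentityOne g') :
    cell K (evalComp₂ t f g f' g') = 0 := by
  obtain ⟨rfl, hf'⟩ := hf'
  obtain ⟨rfl, hg'⟩ := hg'
  obtain rfl := eq_of_heq hf'
  obtain rfl := eq_of_heq hg'
  exact (mem_specialCochains_evalComp₂.1 ht).2.1 f g

theorem cell_evalComp₂_of_left (ht : t ∈ (S.tens 1).specialCochains K 1)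
    {X X' X'' Y Y' Y'' : C} {f : X ⟶ X'}
    {g : Y ⟶ Y'} (hf : IsIdentityOne f) (hg : IsIdentityOne g) (f' : X' ⟶ X'') (g' : Y' ⟶ Y'') :
    cell K (evalComp₂ t f g f' g') = 0 := by
  obtain ⟨rfl, hf⟩ := hf
  obtain ⟨rfl, hg⟩ := hg
  obtain rfl := eq_of_heq hf
  obtain rfl := eq_of_heq hg
  exact (mem_specialCochains_evalComp₂.1 ht).2.2 f' g'

theorem cell_eval₃_identity (hb : b ∈ (S.tens 2).specialCochains K 0)
    {X X' Y Y' Z Z' : C} {f : X ⟶ X'} {g : Y ⟶ Y'} {h : Z ⟶ Z'} (hf : IsIdentityOne f)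
    (hg : IsIdentityOne g) (hh : IsIdentityOne h) : cell K (eval₃ b f g h) = 0 := by
  obtain ⟨rfl, hf⟩ := hf
  obtain ⟨rfl, hg⟩ := hg
  obtain ⟨rfl, hh⟩ := hh
  obtain rfl := eq_of_heq hf
  obtain rfl := eq_of_heq hg
  obtain rfl := eq_of_heq hh
  exact (mem_specialCochains_eval₃.1 hb).2 _ _ _

/-- Specialness is what keeps `⊗̂` and `â` undeformed on identities, hence what makes the first
order form of the other axioms available. -/
theorem unitaryLift_deformedData (ht : t ∈ (S.tens 1).specialCochains K 1)
    (hb : b ∈ (S.tens 2).specialCochains K 0) : UnitaryLift (hS.deformedData K b q t) where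
  tensorId X Y := IsIdentityTwo.firstOrder (hS.tensorId X.as Y.as) rfl
  tensorComp_right f g _ _ hf' hg' := IsIdentityTwo.firstOrder
    (S.tensorComp_isIdentityTwo_of_right hS.tensorId _ _ hf'.of hg'.of)
    (cell_injective K ((cell_evalComp₂_of_right ht f.of g.of hf'.of hg'.of).trans
      (map_zero (cell K)).symm))
  tensorComp_left hf hg f' g' := IsIdentityTwo.firstOrder
    (S.tensorComp_isIdentityTwo_of_left hS.tensorId hf.of hg.of _ _)
    (cell_injective K ((cell_evalComp₂_of_left ht hf.of hg.of f'.of g'.of).trans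
      (map_zero (cell K)).symm))
  assoc_identity hf hg hh := IsIdentityTwo.firstOrder (hS.assoc _ _ _)
    (cell_injective K ((hS.cell₁_deformedData_assoc b q t _ _ _).trans
      ((cell_eval₃_identity hb hf.of hg.of hh.of).trans (map_zero (cell K)).symm)))
  assoc f g h := hS.assoc f.of g.of h.of
  pent X Y Z W := hS.pent X.as Y.as Z.as W.as

/-- The first order unitary deformation with prescribed first order terms. -/
def deformation (H : S.IsCocycle K b q t) : UnitaryDeformation K S where
  toSemigroupalData := hS.deformedData K b q t
  tensorComp_naturality τ σ τ' σ' :=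
    -- The 2-morphisms here may have ε-parts, but the criterion involves only their constant
    -- coefficients.
    (ReducesTo.tensorComp_naturality_iff (hS.reducesTo_deformedData b q t) τ σ τ' σ').2
      ((mem_specialCochains_evalComp₂.1 H.tensor_mem).1 τ.zero σ.zero τ'.zero σ'.zero)
  tensorComp_assoc f g f' g' f'' g'' :=
    (ReducesTo.tensorComp_assoc_iff (hS.reducesTo_deformedData b q t) f g f' g' f'' g'').2
      (H.tensor f.of g.of f'.of g'.of f''.of g''.of)
  tensorComp_id {X X' Y Y'} f g := by
    have hD := hS.unitaryLift_deformedData (q := q) H.tensor_mem H.assoc_mem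
    -- The first order term of `⊗̂` vanishes here, so both sides are identities with the same
    -- boundary.
    exact ((hD.tensorComp_right f g (.id _) (.id _)).comp
      ((IsIdentityTwo.rightUnitor_hom f).map₂ _ (.rightUnitor_hom g))).eq
      (((hD.tensorId X' Y').whiskerLeft _).comp (.rightUnitor_hom _))
  id_tensorComp {X X' Y Y'} f g := by
    have hD := hS.unitaryLift_deformedData (q := q) H.tensor_mem H.assoc_mem
    exact ((hD.tensorComp_left (.id _) (.id _) f g).comp
      ((IsIdentityTwo.leftUnitor_hom f).map₂ _ (.leftUnitor_hom g))).eq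
      (((hD.tensorId X Y).whiskerRight _).comp (.leftUnitor_hom _))
  assoc_naturality τ σ η := by
    have hD := hS.unitaryLift_deformedData (q := q) H.tensor_mem H.assoc_mem
    refine (hD.assoc_naturality_iff hS τ σ η).2 ?_
    rw [hS.cell₁_deformedData_assoc, hS.cell₁_deformedData_assoc]
    exact (mem_specialCochains_eval₃.1 H.assoc_mem).1 τ.zero σ.zero η.zero
  assoc_comp f g h f' g' h' := by
    have hD := hS.unitaryLift_deformedData (q := q) H.tensor_mem H.assoc_mem
    refine (hD.assoc_comp_iff hS (hS.reducesTo_deformedData b q t) f g h f' g' h').2 ?_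
    simp only [hS.cell₁_deformedData_assoc]
    exact H.assoc f.of g.of h.of f'.of g'.of h'.of
  assoc_id X Y Z := by
    have hD := hS.unitaryLift_deformedData (q := q) H.tensor_mem H.assoc_mem
    exact ((hD.assoc_identity (.id _) (.id _) (.id _)).comp
      (((((IsIdentityTwo.id _).map₂ _ (hD.tensorId Y Z)).comp (hD.tensorId X _)).whiskerRight _).comp
        (.leftUnitor_hom _))).eq
      (((((hD.tensorId X Y).map₂ _ (.id _)).comp (hD.tensorId _ Z)).whiskerLeft _).comp
        (.rightUnitor_hom _))
  pent_naturality f g h k := by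
    have hD := hS.unitaryLift_deformedData (q := q) H.tensor_mem H.assoc_mem
    refine (hD.pent_naturality_iff hS f g h k).2 ?_
    simp only [hS.cell₁_deformedData_assoc, hS.cell₁_deformedData_pent]
    exact H.pent f.of g.of h.of k.of
  pent_K₅ X Y Z V U := by
    have hD := hS.unitaryLift_deformedData (q := q) H.tensor_mem H.assoc_mem
    refine (hD.pent_K₅_iff hS X Y Z V U).2 ?_
    simp only [hS.cell₁_deformedData_pent]
    exact H.pent_K₅ X.as Y.as Z.as V.as U.as
  tensorComp_zero _ _ _ _ := rfl
  tensorId_zero _ _ := rfl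
  tensorId_one _ _ := rfl
  assoc_zero _ _ _ := rfl
  pent_zero _ _ _ _ := rfl

/-- Inserting the transported components of `x` as ε-coefficients and extracting them again cancels
the transports. -/
theorem exists_firstOrderTerm_eq {x : S.TotalCochain 2} (hx : x ∈ hS.unitaryCocycles K 2) :
    ∃ D : UnitaryDeformation K S, D.firstOrderTerm hS = x := by
  have H := (hS.mem_unitaryCocycles_iff x).1 hx
  refine ⟨hS.deformation H, TotalCochain.ext₂ (DoubleCochain.extComp₂ (K := K) fun f g f' g' => rfl)
    (DoubleCochain.ext₃ (K := K) fun {X X' Y Y' Z Z'} f g h => ?_)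
    (PentCochain.ext₄ (K := K) fun X Y Z W => ?_)⟩
  · exact ((hS.deformation H).cell_firstOrderTerm_assoc hS (X := ⟨X⟩) (X' := ⟨X'⟩)
      (Y := ⟨Y⟩) (Y' := ⟨Y'⟩) (Z := ⟨Z⟩) (Z' := ⟨Z'⟩) ⟨f⟩ ⟨g⟩ ⟨h⟩).trans
      (hS.cell₁_deformedData_assoc (X := ⟨X⟩) (X' := ⟨X'⟩)
      (Y := ⟨Y⟩) (Y' := ⟨Y'⟩) (Z := ⟨Z⟩) (Z' := ⟨Z'⟩) _ _ _ ⟨f⟩ ⟨g⟩ ⟨h⟩)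
  · exact ((hS.deformation H).cell_firstOrderTerm_pent hS ⟨X⟩ ⟨Y⟩ ⟨Z⟩ ⟨W⟩).trans
      (hS.cell₁_deformedData_pent _ _ _ ⟨X⟩ ⟨Y⟩ ⟨Z⟩ ⟨W⟩)

end SemigroupalStructure.IsGray
end Realization
-- Equivalences of deformations and coboundaries.
section Equivalences
variable {K : Type uK} [CommRing K] {C : Type u} [Bicategory.{w, v} C] [Bicategory.Strict C]
  [∀ X Y : C, Preadditive (X ⟶ Y)] [∀ X Y : C, Linear K (X ⟶ Y)] [LinearComposition K C]
  {T : TensorFunctor C} [T.IsBilinear K] {A : AssociatorCells T} {S : SemigroupalStructure T A}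
open SemigroupalData

namespace SemigroupalStructure.IsGray
variable (hS : S.IsGray)

theorem cell_eval₂_identity {φ : S.DoubleCochain 0 1} (hφ : φ ∈ (S.tens 1).specialCochains K 0)
    {X X' Y Y' : C} {f : X ⟶ X'} {g : Y ⟶ Y'} (hf : IsIdentityOne f)
    (hg : IsIdentityOne g) : cell K (eval₂ φ f g) = 0 := by
  obtain ⟨rfl, hf⟩ := hf
  obtain ⟨rfl, hg⟩ := hg
  obtain rfl := eq_of_heq hf
  obtain rfl := eq_of_heq hg
  exact (mem_specialCochains_eval₂.1 hφ).2 _ _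

include hS in
theorem omegaSource (X Y Z : C) : IsIdentityOne
    (T.map (𝟙 X) (𝟙 (T.obj Y Z)) ≫ 𝟙 (T.obj X (T.obj Y Z)) ≫ A.a X Y Z) :=
  (IsIdentityOne.map hS (.id _) (.id _)).comp ((IsIdentityOne.id _).comp (hS.a X Y Z))

include hS in
theorem omegaTarget (X Y Z : C) : IsIdentityOne
    (A.a X Y Z ≫ T.map (𝟙 (T.obj X Y)) (𝟙 Z) ≫ 𝟙 (T.obj (T.obj X Y) Z)) :=
  (hS.a X Y Z).comp ((IsIdentityOne.map hS (.id _) (.id _)).comp (IsIdentityOne.id _))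

variable {D D' : UnitaryDeformation K S}

/-- The equations on first order terms which express the equivalence of two deformations. -/
structure IsEquivalence (D D' : UnitaryDeformation K S) (ψ : S.DoubleCochain 0 1)
    (ω : S.PentCochain 2) : Prop where
  nat_mem : ψ ∈ (S.tens 1).specialCochains K 0
  nat {X X' X'' Y Y' Y'' : FirstOrderExt K C}
    (f : X ⟶ X') (g : Y ⟶ Y') (f' : X' ⟶ X'') (g' : Y' ⟶ Y'') :
    ver K (S.tensorCell K f.of g.of f'.of g'.of)
        (cell K (eval₂ ψ (f.of ≫ f'.of) (g.of ≫ g'.of))) +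
        cell₁ K (D.tensorComp f g f' g').hom =
      cell₁ K (D'.tensorComp f g f' g').hom +
        ver K (hor K (cellId K (T.map f.of g.of)) (cell K (eval₂ ψ f'.of g'.of)))
          (S.tensorCell K f.of g.of f'.of g'.of) +
        ver K (hor K (cell K (eval₂ ψ f.of g.of)) (cellId K (T.map f'.of g'.of)))
          (S.tensorCell K f.of g.of f'.of g'.of)
  omega {X X' Y Y' Z Z' : FirstOrderExt K C} (f : X ⟶ X') (g : Y ⟶ Y') (h : Z ⟶ Z') :
    hor K (cell K (pent₃ ω X.as Y.as Z.as)) (cellId K (T.map (T.map f.of g.of) h.of)) +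
        cell K (eval₂ ψ (T.map f.of g.of) h.of) +
        ten K T (cell K (eval₂ ψ f.of g.of)) (cellId K h.of) +
        cell₁ K (D'.assoc f g h).hom =
      cell₁ K (D.assoc f g h).hom +
        cell K (eval₂ ψ f.of (T.map g.of h.of)) +
        ten K T (cellId K f.of) (cell K (eval₂ ψ g.of h.of)) +
        hor K (cellId K (T.map f.of (T.map g.of h.of))) (cell K (pent₃ ω X'.as Y'.as Z'.as))
  coherence (X Y Z W : FirstOrderExt K C) :
    cell₁ K (D.pent X Y Z W).hom + cell K (pent₃ ω X.as Y.as (T.obj Z.as W.as)) +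
        cell K (pent₃ ω (T.obj X.as Y.as) Z.as W.as) =
      ten K T (cellId K (𝟙 X.as)) (cell K (pent₃ ω Y.as Z.as W.as)) +
        cell K (pent₃ ω X.as (T.obj Y.as Z.as) W.as) +
        ten K T (cell K (pent₃ ω X.as Y.as Z.as)) (cellId K (𝟙 W.as)) +
        cell₁ K (D'.pent X Y Z W).hom

/-- The three equations of `IsEquivalence` are the components of the coboundary equation in X^{1,1},
X^{0,2} and the pentagonator complex, with the terms distributed differently over the two sides. -/
theorem isEquivalence_iff {x : S.TotalCochain 1} : IsEquivalence D D' x.nat x.omega ↔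
    x ∈ S.unitaryCochains K 1 ∧
      D'.firstOrderTerm hS - D.firstOrderTerm hS = hS.deltaUnit K 1 x := by
  have hsub₁ (y y' : S.TotalCochain 2) {X X' X'' Y Y' Y'' : C} (f : X ⟶ X') (g : Y ⟶ Y')
      (f' : X' ⟶ X'') (g' : Y' ⟶ Y'') : cell K (evalComp₂ (y - y').tensor f g f' g') =
      cell K (evalComp₂ y.tensor f g f' g') - cell K (evalComp₂ y'.tensor f g f' g') :=
    map_sub (cell K) _ _
  have hsub₂ (y y' : S.TotalCochain 2) {X X' Y Y' Z Z' : C} (f : X ⟶ X') (g : Y ⟶ Y')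
      (h : Z ⟶ Z') : cell K (eval₃ (y - y').assoc f g h) =
      cell K (eval₃ y.assoc f g h) - cell K (eval₃ y'.assoc f g h) :=
    map_sub (cell K) _ _
  have hsub₃ (y y' : S.TotalCochain 2) (X Y Z W : C) : cell K (pent₄ (y - y').pent X Y Z W) =
      cell K (pent₄ y.pent X Y Z W) - cell K (pent₄ y'.pent X Y Z W) :=
    map_sub (cell K) _ _
  have hδ₁ {X X' X'' Y Y' Y'' : C} (f : X ⟶ X') (g : Y ⟶ Y')
      (f' : X' ⟶ X'') (g' : Y' ⟶ Y'') :
      cell K (evalComp₂ (TotalCochain.tensor (hS.deltaUnit K 1 x)) f g f' g') =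
      -cell K (evalComp₂ ((S.tens 1).delta K 0 x.nat) f g f' g') := by
    rw [hS.deltaUnit_one_tensor]
    exact map_neg (cell K) _
  have hδ₂ {X X' Y Y' Z Z' : C} (f : X ⟶ X') (g : Y ⟶ Y')
      (h : Z ⟶ Z') : cell K (eval₃ (TotalCochain.assoc (hS.deltaUnit K 1 x)) f g h) =
      cell K (eval₃ (hS.deltaV K 0 1 x.nat) f g h) + cell K (eval₃ (S.phi K 2 x.omega) f g h) :=
    map_add (cell K) _ _
  have hδ₃ (X Y Z W : C) : cell K (pent₄ (TotalCochain.pent (hS.deltaUnit K 1 x)) X Y Z W) =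
      -cell K (pent₄ (hS.deltaPent K 2 x.omega) X Y Z W) :=
    map_neg (cell K) _
  rw [mem_unitaryCochains_one_iff]
  constructor
  · intro H
    refine ⟨H.nat_mem, TotalCochain.ext₂ (DoubleCochain.extComp₂ (K := K)
      fun {X X' X'' Y Y' Y''} f g f' g' => ?_) (DoubleCochain.ext₃ (K := K)
      fun {X X' Y Y' Z Z'} f g h => ?_) (PentCochain.ext₄ (K := K) fun X Y Z W => ?_)⟩
    · have := H.nat (X := ⟨X⟩) (X' := ⟨X'⟩) (X'' := ⟨X''⟩) (Y := ⟨Y⟩) (Y' := ⟨Y'⟩) (Y'' := ⟨Y''⟩)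
        ⟨f⟩ ⟨g⟩ ⟨f'⟩ ⟨g'⟩
      have e (E : UnitaryDeformation K S) := E.cell_firstOrderTerm_tensor hS (X := ⟨X⟩) (X' := ⟨X'⟩)
        (X'' := ⟨X''⟩) (Y := ⟨Y⟩) (Y' := ⟨Y'⟩) (Y'' := ⟨Y''⟩) ⟨f⟩ ⟨g⟩ ⟨f'⟩ ⟨g'⟩
      rw [hsub₁, e, e, hδ₁, S.cell_delta_zero_one, ← sub_eq_zero, ← sub_eq_zero.2 this.symm]
      abel
    · have := H.omega (X := ⟨X⟩) (X' := ⟨X'⟩) (Y := ⟨Y⟩) (Y' := ⟨Y'⟩) (Z := ⟨Z⟩) (Z' := ⟨Z'⟩)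
        ⟨f⟩ ⟨g⟩ ⟨h⟩
      have e (E : UnitaryDeformation K S) := E.cell_firstOrderTerm_assoc hS (X := ⟨X⟩) (X' := ⟨X'⟩)
        (Y := ⟨Y⟩) (Y' := ⟨Y'⟩) (Z := ⟨Z⟩) (Z' := ⟨Z'⟩) ⟨f⟩ ⟨g⟩ ⟨h⟩
      simp only [hS.cellId_map_assoc] at this
      rw [hsub₂, e, e, hδ₂, hS.cell_deltaV_zero_one, cell_eval₃_phi, ← sub_eq_zero,
        ← sub_eq_zero.2 this]
      abel
    · have := H.coherence ⟨X⟩ ⟨Y⟩ ⟨Z⟩ ⟨W⟩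
      have e (E : UnitaryDeformation K S) :=
        E.cell_firstOrderTerm_pent hS ⟨X⟩ ⟨Y⟩ ⟨Z⟩ ⟨W⟩
      rw [hsub₃, e, e, hδ₃, hS.cell_deltaPent₂, ← sub_eq_zero, ← sub_eq_zero.2 this.symm]
      abel
  · rintro ⟨hx, e⟩
    refine ⟨hx, fun {X X' X'' Y Y' Y''} f g f' g' => ?_, fun {X X' Y Y' Z Z'} f g h => ?_,
      fun X Y Z W => ?_⟩
    · have := congrArg (fun y : S.TotalCochain 2 =>
        cell K (evalComp₂ y.tensor f.of g.of f'.of g'.of)) e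
      simp only [hsub₁, hδ₁, S.cell_delta_zero_one,
        UnitaryDeformation.cell_firstOrderTerm_tensor] at this
      rw [eq_comm, ← sub_eq_zero, ← sub_eq_zero.2 this]
      abel
    · have := congrArg (fun y : S.TotalCochain 2 => cell K (eval₃ y.assoc f.of g.of h.of)) e
      simp only [hsub₂, hδ₂, hS.cell_deltaV_zero_one, cell_eval₃_phi,
        UnitaryDeformation.cell_firstOrderTerm_assoc] at this
      rw [hS.cellId_map_assoc, ← sub_eq_zero, ← sub_eq_zero.2 this]
      abel
    · have := congrArg (fun y : S.TotalCochain 2 => cell K (pent₄ y.pent X.as Y.as Z.as W.as)) e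
      simp only [hsub₃, hδ₃, hS.cell_deltaPent₂,
        UnitaryDeformation.cell_firstOrderTerm_pent] at this
      rw [eq_comm, ← sub_eq_zero, ← sub_eq_zero.2 this]
      abel

variable {P : IdentitySemigroupalData D.toSemigroupalStructure D'.toSemigroupalStructure
  fun X Y => 𝟙 ((T.firstOrder K).obj X Y)}

include hS in
/-- The axioms of a semigroupal structure on the identity 2-functor, for 2-isomorphisms which are
trivial modulo `ε`. -/
theorem axioms_iff (hP : UnitaryIdentityLift P) {ψ : S.DoubleCochain 0 1} {ω : S.PentCochain 2}
    (hψ : ∀ {X X' Y Y' : FirstOrderExt K C} (f : X ⟶ X') (g : Y ⟶ Y'),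
      cell₁ K (P.nat f g).hom = cell K (eval₂ ψ f.of g.of))
    (hω : ∀ X Y Z : FirstOrderExt K C,
      cell₁ K (P.omega X Y Z).hom = cell K (pent₃ ω X.as Y.as Z.as)) :
    (∃ Q : IdentitySemigroupalStructure D.toSemigroupalStructure D'.toSemigroupalStructure
        fun X Y => 𝟙 ((T.firstOrder K).obj X Y), Q.toIdentitySemigroupalData = P) ↔
      IsEquivalence D D' ψ ω := by
  have hD := D.unitaryLift hS
  have hD' := D'.unitaryLift hS
  constructor
  · rintro ⟨Q, rfl⟩
    refine ⟨mem_specialCochains_eval₂.2 ⟨fun {X X' Y Y' f₁ f₂ g₁ g₂} τ σ => ?_, fun X Y => ?_⟩,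
      fun f g f' g' => ?_, fun f g h => ?_, fun X Y Z W => ?_⟩
    · have := (hP.nat_naturality_iff (X := ⟨X⟩) (X' := ⟨X'⟩) (Y := ⟨Y⟩) (Y' := ⟨Y'⟩) (f₁ := ⟨f₁⟩)
        (f₂ := ⟨f₂⟩) (g₁ := ⟨g₁⟩) (g₂ := ⟨g₂⟩) ⟨τ, 0⟩ ⟨σ, 0⟩).1 (Q.nat_naturality _ _)
      rw [hψ, hψ] at this
      exact this
    · exact (hψ (X := ⟨X⟩) (Y := ⟨Y⟩) (𝟙 _) (𝟙 _)).symm.trans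
        (hP.nat_identity (.id _) (.id _)).cell₁
    · have := (hP.nat_comp_iff D.reducesTo D'.reducesTo f g f' g').1 (Q.nat_comp f g f' g')
      simp only [hψ] at this
      exact this
    · have := (hP.omega_naturality_iff hD hD' hS f g h).1 (Q.omega_naturality f g h)
      simp only [hψ, hω] at this
      exact this
    · have := (hP.omega_coherence_iff hD hD' hS X Y Z W).1 (Q.omega_coherence X Y Z W)
      simp only [hω] at this
      exact this
  · intro H
    refine ⟨{ P with
      nat_naturality := fun τ σ => (hP.nat_naturality_iff τ σ).2 ?_
      nat_comp := fun f g f' g' => (hP.nat_comp_iff D.reducesTo D'.reducesTo f g f' g').2 ?_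
      nat_id := fun X Y => ?_
      omega_naturality := fun f g h => (hP.omega_naturality_iff hD hD' hS f g h).2 ?_
      omega_coherence := fun X Y Z W => (hP.omega_coherence_iff hD hD' hS X Y Z W).2 ?_ }, rfl⟩
    · rw [hψ, hψ]
      exact (mem_specialCochains_eval₂.1 H.nat_mem).1 τ.zero σ.zero
    · simp only [hψ]
      exact H.nat f g f' g'
    -- The unit axiom of ψ imposes no equation: ψ is trivial on identities and `⊗₀` is undeformed.
    · exact ((hP.nat_identity (.id X) (.id Y)).comp (((hD'.tensorId X Y).whiskerRight _).comp
        (.leftUnitor_hom _))).eq (((hD.tensorId X Y).whiskerLeft _).comp (.rightUnitor_hom _))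
    · simp only [hψ, hω]
      exact H.omega f g h
    · simp only [hω]
      exact H.coherence X Y Z W

include hS in
theorem omegaTarget_heq (X Y Z : C) :
    HEq (A.a X Y Z ≫ T.map (𝟙 (T.obj X Y)) (𝟙 Z) ≫ 𝟙 (T.obj (T.obj X Y) Z))
      (𝟙 (T.obj X (T.obj Y Z))) :=
  (hS.omegaTarget X Y Z).2

include hS in
theorem omegaSource_eq_omegaTarget (X Y Z : C) :
    T.map (𝟙 X) (𝟙 (T.obj Y Z)) ≫ 𝟙 (T.obj X (T.obj Y Z)) ≫ A.a X Y Z =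
      A.a X Y Z ≫ T.map (𝟙 (T.obj X Y)) (𝟙 Z) ≫ 𝟙 (T.obj (T.obj X Y) Z) :=
  eq_of_heq ((hS.omegaSource X Y Z).2.trans (hS.omegaTarget_heq X Y Z).symm)

variable (D D') in
/-- The 2-isomorphisms on the identity 2-functor with prescribed first order terms. -/
def identityData (ψ : S.DoubleCochain 0 1) (ω : S.PentCochain 2) :
    IdentitySemigroupalData D.toSemigroupalStructure D'.toSemigroupalStructure
      fun X Y => 𝟙 ((T.firstOrder K).obj X Y) where
  nat f g := deformIso (f := 𝟙 _ ≫ (T.firstOrder K).map f g)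
    (g := (T.firstOrder K).map f g ≫ 𝟙 _) (λ_ (T.map f.of g.of) ≪≫ (ρ_ (T.map f.of g.of)).symm)
    (castHom₂ K rfl rfl (heq_of_eq (Strict.id_comp (T.map f.of g.of)).symm)
      (heq_of_eq (Strict.comp_id (T.map f.of g.of)).symm) (eval₂ ψ f.of g.of))
  omega X Y Z := deformIso
    (f := (T.firstOrder K).map (𝟙 X) (𝟙 ((T.firstOrder K).obj Y Z)) ≫
      𝟙 ((T.firstOrder K).obj X ((T.firstOrder K).obj Y Z)) ≫ (A.firstOrder K).a X Y Z)
    (g := (A.firstOrder K).a X Y Z ≫ (T.firstOrder K).map (𝟙 ((T.firstOrder K).obj X Y)) (𝟙 Z) ≫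
      𝟙 ((T.firstOrder K).obj ((T.firstOrder K).obj X Y) Z))
    (eqToIso (hS.omegaSource_eq_omegaTarget X.as Y.as Z.as))
    (castHom₂ K rfl (hS.tensor_assoc _ _ _) (hS.omegaSource X.as Y.as Z.as).2.symm
      (hS.omegaTarget_heq X.as Y.as Z.as).symm (pent₃ ω X.as Y.as Z.as))

theorem cell₁_identityData_nat (ψ : S.DoubleCochain 0 1) (ω : S.PentCochain 2)
    {X X' Y Y' : FirstOrderExt K C} (f : X ⟶ X') (g : Y ⟶ Y') :
    cell₁ K ((hS.identityData D D' ψ ω).nat f g).hom = cell K (eval₂ ψ f.of g.of) :=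
  cell_castHom₂ ..

theorem cell₁_identityData_omega (ψ : S.DoubleCochain 0 1) (ω : S.PentCochain 2)
    (X Y Z : FirstOrderExt K C) :
    cell₁ K ((hS.identityData D D' ψ ω).omega X Y Z).hom = cell K (pent₃ ω X.as Y.as Z.as) :=
  cell_castHom₂ ..

include hS in
theorem omega_isIdentityTwo (X Y Z : C) : IsIdentityTwo
    (T.map (𝟙 X) (𝟙 (T.obj Y Z)) ◁ (λ_ (A.a X Y Z)).hom ≫
        (S.tensorId X (T.obj Y Z)).hom ▷ A.a X Y Z ≫ (λ_ (A.a X Y Z)).hom ≫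
        (ρ_ (A.a X Y Z)).inv ≫ A.a X Y Z ◁ (S.tensorId (T.obj X Y) Z).inv ≫
        A.a X Y Z ◁ (ρ_ (T.map (𝟙 (T.obj X Y)) (𝟙 Z))).inv) :=
  ((IsIdentityTwo.leftUnitor_hom _).whiskerLeft _).comp
    (((hS.tensorId _ _).whiskerRight _).comp ((IsIdentityTwo.leftUnitor_hom _).comp
      ((IsIdentityTwo.rightUnitor_inv _).comp (((hS.tensorId _ _).inv.whiskerLeft _).comp
        ((IsIdentityTwo.rightUnitor_inv _).whiskerLeft _)))))

theorem unitaryIdentityLift_identityData {ψ : S.DoubleCochain 0 1} (ω : S.PentCochain 2)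
    (hψ : ψ ∈ (S.tens 1).specialCochains K 0) :
    UnitaryIdentityLift (hS.identityData D D' ψ ω) where
  psi _ _ := .id _
  nat f g := (IsIdentityTwo.leftUnitor_hom (T.map f.of g.of)).comp
    (IsIdentityTwo.rightUnitor_inv (T.map f.of g.of))
  nat_identity {_ _ _ _ f g} hf hg := IsIdentityTwo.firstOrder
    ((IsIdentityTwo.leftUnitor_hom (T.map f.of g.of)).comp
      (IsIdentityTwo.rightUnitor_inv (T.map f.of g.of)))
    (cell_injective K ((hS.cell₁_identityData_nat ψ ω f g).trans
      ((cell_eval₂_identity hψ hf.of hg.of).trans (map_zero (cell K)).symm)))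
  omega X Y Z := .eqToHom (hS.omegaSource_eq_omegaTarget X.as Y.as Z.as)

include hS in
-- The assumptions give triviality modulo ε only. That ψ is exactly the identity on identities
-- follows by cancellation in its unit axiom, since `⊗₀` is undeformed in both structures.
theorem unitaryIdentityLift {Q : IdentitySemigroupalStructure D.toSemigroupalStructure
      D'.toSemigroupalStructure fun X Y => 𝟙 ((T.firstOrder K).obj X Y)}
    (h : ∀ {X X' Y Y' : C} (f : X ⟶ X') (g : Y ⟶ Y'),
      (Q.nat (X := ⟨X⟩) (X' := ⟨X'⟩) (Y := ⟨Y⟩) (Y' := ⟨Y'⟩) ⟨f⟩ ⟨g⟩).hom.zero =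
        (λ_ (T.map f g)).hom ≫ (ρ_ (T.map f g)).inv)
    (h' : ∀ X Y Z : C, (Q.omega ⟨X⟩ ⟨Y⟩ ⟨Z⟩).hom.zero =
      T.map (𝟙 X) (𝟙 (T.obj Y Z)) ◁ (λ_ (A.a X Y Z)).hom ≫
        (S.tensorId X (T.obj Y Z)).hom ▷ A.a X Y Z ≫ (λ_ (A.a X Y Z)).hom ≫
        (ρ_ (A.a X Y Z)).inv ≫ A.a X Y Z ◁ (S.tensorId (T.obj X Y) Z).inv ≫
        A.a X Y Z ◁ (ρ_ (T.map (𝟙 (T.obj X Y)) (𝟙 Z))).inv) :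
    UnitaryIdentityLift Q.toIdentitySemigroupalData where
  psi _ _ := .id _
  nat f g := (h f.of g.of).symm ▸ (IsIdentityTwo.leftUnitor_hom (T.map f.of g.of)).comp
    (IsIdentityTwo.rightUnitor_inv (T.map f.of g.of))
  nat_identity {X X' Y Y' f g} hf hg := by
    obtain ⟨rfl, hf⟩ := hf
    obtain ⟨rfl, hg⟩ := hg
    obtain rfl := eq_of_heq hf
    obtain rfl := eq_of_heq hg
    refine IsIdentityTwo.of_comp (θ := (D'.tensorId X Y).hom ▷ 𝟙 _ ≫ (λ_ _).hom) ?_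
      ((((D'.tensorId_isIdentityTwo hS X Y)).whiskerRight _).comp (.leftUnitor_hom _))
    rw [Q.nat_id]
    exact ((D.tensorId_isIdentityTwo hS X Y).whiskerLeft _).comp (.rightUnitor_hom _)
  omega X Y Z := (h' X.as Y.as Z.as).symm ▸ hS.omega_isIdentityTwo X.as Y.as Z.as

/-- An equivalence yields a degree 1 cochain through its ε-coefficients, and a degree 1 cochain
yields 2-isomorphisms with those coefficients; in both directions the axioms amount to the
coboundary equation. -/
theorem equivalent_iff : D.Equivalent D' ↔
    D'.firstOrderTerm hS - D.firstOrderTerm hS ∈ hS.unitaryCoboundaries K 1 := by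
  constructor
  · rintro ⟨Q, h, h'⟩
    -- The ε-coefficients of the given structure, moved along unit and associativity equalities to
    -- the boundaries used by cochains.
    let ψ : S.DoubleCochain 0 1 := fun (X Y : C × C) c => match c with
      | .single f => castHom₂ K rfl rfl (heq_of_eq (Strict.id_comp (T.map f.1 f.2)))
          (heq_of_eq (Strict.comp_id (T.map f.1 f.2)))
          (Q.nat (X := ⟨X.1⟩) (X' := ⟨Y.1⟩) (Y := ⟨X.2⟩) (Y' := ⟨Y.2⟩) ⟨f.1⟩ ⟨f.2⟩).hom.one
    let ω : S.PentCochain 2 := fun (X : C × (C × C)) =>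
      castHom₂ K rfl (hS.tensor_assoc X.1 X.2.1 X.2.2).symm (hS.omegaSource X.1 X.2.1 X.2.2).2
        (hS.omegaTarget_heq X.1 X.2.1 X.2.2) (Q.omega ⟨X.1⟩ ⟨X.2.1⟩ ⟨X.2.2⟩).hom.one
    have H := (hS.axioms_iff (hS.unitaryIdentityLift h h') (ψ := ψ) (ω := ω)
      (fun f g => (cell_castHom₂ ..).symm) (fun X Y Z => (cell_castHom₂ ..).symm)).1 ⟨Q, rfl⟩
    have H := (hS.isEquivalence_iff (x := TotalCochain.mk₁ ψ ω)).1 H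
    exact ⟨_, H.1, H.2.symm⟩
  · rintro ⟨x, hx, e⟩
    have H := (hS.isEquivalence_iff (x := x)).2 ⟨hx, e.symm⟩
    obtain ⟨Q, hQ⟩ := (hS.axioms_iff (hS.unitaryIdentityLift_identityData (D := D) (D' := D') x.omega H.nat_mem)
      (hS.cell₁_identityData_nat x.nat x.omega) (hS.cell₁_identityData_omega x.nat x.omega)).2 H
    refine ⟨Q, fun f g => ?_, fun X Y Z => ?_⟩
    · rw [hQ]
      rfl
    · rw [hQ]
      -- The constructed ω has constant coefficient `eqToHom`, whereas the definition of equivalence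
      -- prescribes a composite of constraints; both are identities with the same boundary.
      exact IsIdentityTwo.eq (.eqToHom (hS.omegaSource_eq_omegaTarget X Y Z)) (hS.omega_isIdentityTwo X Y Z)

end SemigroupalStructure.IsGray
end Equivalences
-- Associativity, interchange and endomorphisms of identities, on cells.
section CellCalculus
variable {K : Type uK} [CommRing K] {C : Type u} [Bicategory.{w, v} C]
  [∀ X Y : C, Preadditive (X ⟶ Y)] [∀ X Y : C, Linear K (X ⟶ Y)]

theorem hor_cellId_cellId [LinearComposition K C] {X Y Z : C} (f : X ⟶ Y) (g : Y ⟶ Z) :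
    hor K (cellId K f) (cellId K g) = cellId K (f ≫ g) := by
  rw [cellId, hor_cell_cellId]
  simp [cellId]

theorem ver_ten_cellId_left {T : TensorFunctor C} [T.IsBilinear K] {X X' Y Y' : C} (f : X ⟶ X')
    {g h i : Y ⟶ Y'} (σ : g ⟶ h) (σ' : h ⟶ i) :
    ver K (ten K T (cellId K f) (cell K σ)) (ten K T (cellId K f) (cell K σ')) =
      ten K T (cellId K f) (cell K (σ ≫ σ')) := by
  simp only [cellId, ten_cell, ver_cell, ← T.map₂_comp, Category.id_comp]

theorem ver_ten_cellId_right {T : TensorFunctor C} [T.IsBilinear K] {X X' Y Y' : C} (g : Y ⟶ Y')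
    {f f' f'' : X ⟶ X'} (τ : f ⟶ f') (τ' : f' ⟶ f'') :
    ver K (ten K T (cell K τ) (cellId K g)) (ten K T (cell K τ') (cellId K g)) =
      ten K T (cell K (τ ≫ τ')) (cellId K g) := by
  simp only [cellId, ten_cell, ver_cell, ← T.map₂_comp, Category.id_comp]

theorem ver_cell_of_not {X Y X' Y' : C} {f g : X ⟶ Y} {f' g' : X' ⟶ Y'} (η : f ⟶ g)
    (θ : f' ⟶ g') (h : ¬(X = X' ∧ Y = Y' ∧ HEq g f')) : ver K (cell K η) (cell K θ) = 0 := by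
  rw [ver, cellLift_cell, verComponent, dif_neg h]
  rfl

theorem hor_cell_of_ne [LinearComposition K C] {X Y X' Y' : C} {f g : X ⟶ Y} {f' g' : X' ⟶ Y'}
    (η : f ⟶ g) (θ : f' ⟶ g') (h : Y ≠ X') : hor K (cell K η) (cell K θ) = 0 := by
  rw [hor, cellLift_cell, horComponent, dif_neg h]
  rfl

/-- A bilinear operation on the direct sum of all the modules of 2-morphisms is associative if it is
so on 2-morphisms. -/
theorem assoc_of_cell {B : CellSpace C →ₗ[K] CellSpace C →ₗ[K] CellSpace C}
    (hB : ∀ {X Y X' Y' X'' Y'' : C} {f g : X ⟶ Y} {f' g' : X' ⟶ Y'} {f'' g'' : X'' ⟶ Y''}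
      (η : f ⟶ g) (θ : f' ⟶ g') (ζ : f'' ⟶ g''),
      B (B (cell K η) (cell K θ)) (cell K ζ) = B (cell K η) (B (cell K θ) (cell K ζ)))
    (a b c : CellSpace C) : B (B a b) c = B a (B b c) := by
  have h : B.compr₂ B = (LinearMap.lcomp K _ B).comp ((LinearMap.llcomp K _ _ _).comp B) :=
    CellSpace.ext fun τ => CellSpace.ext fun σ => CellSpace.ext fun η => hB τ σ η
  exact congrArg (fun L => L a b c) h

/-- Extension by zero preserves associativity because composability of adjacent factors depends only
on the boundary they share; if either pair fails to compose, both sides vanish. -/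
theorem ver_assoc (a b c : CellSpace C) : ver K (ver K a b) c = ver K a (ver K b c) := by
  refine assoc_of_cell (fun {X Y X' Y' X'' Y'' f g f' g' f'' g''} η θ ζ => ?_) a b c
  by_cases h : X = X' ∧ Y = Y' ∧ HEq g f' <;> by_cases h' : X' = X'' ∧ Y' = Y'' ∧ HEq g' f''
  · obtain ⟨rfl, rfl, h⟩ := h
    obtain ⟨rfl, rfl, h'⟩ := h'
    obtain rfl := eq_of_heq h
    obtain rfl := eq_of_heq h'
    simp only [ver_cell, Category.assoc]
  · obtain ⟨rfl, rfl, h⟩ := h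
    obtain rfl := eq_of_heq h
    rw [ver_cell, ver_cell_of_not _ _ h', ver_cell_of_not _ _ h', map_zero]
  · obtain ⟨rfl, rfl, h'⟩ := h'
    obtain rfl := eq_of_heq h'
    rw [ver_cell θ, ver_cell_of_not _ _ h, ver_cell_of_not _ _ h, map_zero, LinearMap.zero_apply]
  · rw [ver_cell_of_not _ _ h, ver_cell_of_not _ _ h', map_zero, map_zero, LinearMap.zero_apply]

theorem hcomp_assoc {X Y Z W : C} {f f' : X ⟶ Y} {g g' : Y ⟶ Z} {h h' : Z ⟶ W} (η : f ⟶ f')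
    (θ : g ⟶ g') (ζ : h ⟶ h') :
    hcomp (hcomp η θ) ζ ≫ (α_ f' g' h').hom = (α_ f g h).hom ≫ hcomp η (hcomp θ ζ) := by
  simp [hcomp]

theorem hor_assoc [Bicategory.Strict C] [LinearComposition K C] (a b c : CellSpace C) :
    hor K (hor K a b) c = hor K a (hor K b c) := by
  refine assoc_of_cell (fun {X Y X' Y' X'' Y'' f g f' g' f'' g''} η θ ζ => ?_) a b c
  by_cases h : Y = X' <;> by_cases h' : Y' = X''
  · obtain rfl := h
    obtain rfl := h'
    rw [hor_cell, hor_cell, hor_cell, hor_cell, ← cell_comp_identity _ (.associator_hom g g' g''),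
      hcomp_assoc, cell_identity_comp (.associator_hom _ _ _)]
  · obtain rfl := h
    rw [hor_cell, hor_cell_of_ne _ _ h', hor_cell_of_ne _ _ h', map_zero]
  · obtain rfl := h'
    rw [hor_cell θ, hor_cell_of_ne _ _ h, hor_cell_of_ne _ _ h, map_zero, LinearMap.zero_apply]
  · rw [hor_cell_of_ne _ _ h, hor_cell_of_ne _ _ h', map_zero, map_zero, LinearMap.zero_apply]

section
variable [LinearComposition K C]

/-- The interchange law, kept in the bilinear form used for cancellations. -/
theorem ver_hor_exchange {X Y Z : C} {f g : X ⟶ Y} {h k : Y ⟶ Z} (η : f ⟶ g) (θ : h ⟶ k) :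
    ver K (hor K (cell K η) (cellId K h)) (hor K (cellId K g) (cell K θ)) =
      ver K (hor K (cellId K f) (cell K θ)) (hor K (cell K η) (cellId K k)) := by
  simp only [hor_cell_cellId, hor_cellId_cell, ver_cell, whisker_exchange]

/-- One half of δ_h² = 0 for abstract constraints Θ, Θ₂. The terms in χ, the cochain on the partial
composite, cancel; what survives involves the constraints only through their full composite. -/
theorem delta_delta_first {X Y Z W : C} {F : X ⟶ Y} {F' : Y ⟶ Z} {F'' : Z ⟶ W} {G : X ⟶ Z}
    {H : X ⟶ W} (Θ : F ≫ F' ⟶ G) (Θ₂ : G ≫ F'' ⟶ H) (ψ : F ⟶ F) (ψ' : F' ⟶ F') (ψ'' : F'' ⟶ F'')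
    (χ : G ⟶ G) (ξ : H ⟶ H) :
    ver K (hor K (cell K Θ) (cellId K F''))
        (ver K (hor K (cell K χ) (cellId K F'')) (cell K Θ₂) - ver K (cell K Θ₂) (cell K ξ) +
          ver K (hor K (cellId K G) (cell K ψ'')) (cell K Θ₂)) +
      ver K (hor K (ver K (hor K (cell K ψ) (cellId K F')) (cell K Θ) -
        ver K (cell K Θ) (cell K χ) + ver K (hor K (cellId K F) (cell K ψ')) (cell K Θ))
        (cellId K F'')) (cell K Θ₂) =
    ver K (hor K (hor K (cell K ψ) (cellId K F')) (cellId K F''))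
        (ver K (hor K (cell K Θ) (cellId K F'')) (cell K Θ₂)) +
      ver K (hor K (hor K (cellId K F) (cell K ψ')) (cellId K F''))
        (ver K (hor K (cell K Θ) (cellId K F'')) (cell K Θ₂)) +
      ver K (hor K (cellId K (F ≫ F')) (cell K ψ''))
        (ver K (hor K (cell K Θ) (cellId K F'')) (cell K Θ₂)) -
      ver K (ver K (hor K (cell K Θ) (cellId K F'')) (cell K Θ₂)) (cell K ξ) := by
  simp only [hor_cell_cellId, hor_cellId_cell, ver_cell, map_add, map_sub, LinearMap.add_apply,
    LinearMap.sub_apply, comp_whiskerRight, Category.assoc, ← whisker_exchange_assoc]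
  abel

/-- The mirror image, composing the last two 1-morphisms first. The two halves match once the two
full constraints agree. -/
theorem delta_delta_last {X Y Z W : C} {F : X ⟶ Y} {F' : Y ⟶ Z} {F'' : Z ⟶ W} {G : Y ⟶ W}
    {H : X ⟶ W} (Θ : F' ≫ F'' ⟶ G) (Θ₂ : F ≫ G ⟶ H) (ψ : F ⟶ F) (ψ' : F' ⟶ F') (ψ'' : F'' ⟶ F'')
    (χ : G ⟶ G) (ξ : H ⟶ H) :
    ver K (hor K (cellId K F) (cell K Θ))
        (ver K (hor K (cell K ψ) (cellId K G)) (cell K Θ₂) - ver K (cell K Θ₂) (cell K ξ) +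
          ver K (hor K (cellId K F) (cell K χ)) (cell K Θ₂)) +
      ver K (hor K (cellId K F) (ver K (hor K (cell K ψ') (cellId K F'')) (cell K Θ) -
        ver K (cell K Θ) (cell K χ) + ver K (hor K (cellId K F') (cell K ψ'')) (cell K Θ)))
        (cell K Θ₂) =
    ver K (hor K (cell K ψ) (cellId K (F' ≫ F'')))
        (ver K (hor K (cellId K F) (cell K Θ)) (cell K Θ₂)) +
      ver K (hor K (cellId K F) (hor K (cell K ψ') (cellId K F'')))
        (ver K (hor K (cellId K F) (cell K Θ)) (cell K Θ₂)) +
      ver K (hor K (cellId K F) (hor K (cellId K F') (cell K ψ'')))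
        (ver K (hor K (cellId K F) (cell K Θ)) (cell K Θ₂)) -
      ver K (ver K (hor K (cellId K F) (cell K Θ)) (cell K Θ₂)) (cell K ξ) := by
  simp only [hor_cell_cellId, hor_cellId_cell, ver_cell, map_add, map_sub, LinearMap.add_apply,
    LinearMap.sub_apply, whiskerLeft_comp, Category.assoc, whisker_exchange_assoc]
  abel

theorem ver_hor_cellId_right_comm {X Y Z : C} {F F' : X ⟶ Y} {G G' : Y ⟶ Z} {a : F ⟶ F} {p : F ⟶ F'}
    {b : F' ⟶ F'} (q : G ⟶ G') (h : ver K (cell K a) (cell K p) = ver K (cell K p) (cell K b)) :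
    ver K (hor K (cell K a) (cellId K G)) (hor K (cell K p) (cell K q)) =
      ver K (hor K (cell K p) (cell K q)) (hor K (cell K b) (cellId K G')) := by
  rw [ver_cell, ver_cell] at h
  have h := cell_injective K h
  rw [hor_cell_cellId, hor_cell_cellId, hor_cell, ver_cell, ver_cell, hcomp, Category.assoc,
    whisker_exchange, ← comp_whiskerRight_assoc, ← comp_whiskerRight_assoc, h]

theorem ver_hor_cellId_left_comm {X Y Z : C} {F F' : X ⟶ Y} {G G' : Y ⟶ Z} (q : F ⟶ F') {a : G ⟶ G}
    {p : G ⟶ G'} {b : G' ⟶ G'} (h : ver K (cell K a) (cell K p) = ver K (cell K p) (cell K b)) :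
    ver K (hor K (cellId K F) (cell K a)) (hor K (cell K q) (cell K p)) =
      ver K (hor K (cell K q) (cell K p)) (hor K (cellId K F') (cell K b)) := by
  rw [ver_cell, ver_cell] at h
  have h := cell_injective K h
  rw [hor_cellId_cell, hor_cellId_cell, hor_cell, ver_cell, ver_cell, hcomp, Category.assoc,
    whisker_exchange_assoc, ← Bicategory.whiskerLeft_comp, ← Bicategory.whiskerLeft_comp, h]

variable {T : TensorFunctor C} [T.IsBilinear K]

theorem ver_ten_cellId_left_comm {X X' Y Y' : C} {f f' : X ⟶ X'} {G G' : Y ⟶ Y'} (τ : f ⟶ f')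
    {a : G ⟶ G} {p : G ⟶ G'} {b : G' ⟶ G'}
    (h : ver K (cell K a) (cell K p) = ver K (cell K p) (cell K b)) :
    ver K (ten K T (cellId K f) (cell K a)) (ten K T (cell K τ) (cell K p)) =
      ver K (ten K T (cell K τ) (cell K p)) (ten K T (cellId K f') (cell K b)) := by
  rw [ver_cell, ver_cell] at h
  have h := cell_injective K h
  simp only [cellId, ten_cell, ver_cell, ← T.map₂_comp, Category.id_comp, Category.comp_id, h]

theorem ver_ten_cellId_right_comm {X X' Y Y' : C} {f f' : X ⟶ X'} {G G' : Y ⟶ Y'} (τ : f ⟶ f')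
    {a : G ⟶ G} {p : G ⟶ G'} {b : G' ⟶ G'}
    (h : ver K (cell K a) (cell K p) = ver K (cell K p) (cell K b)) :
    ver K (ten K T (cell K a) (cellId K f)) (ten K T (cell K p) (cell K τ)) =
      ver K (ten K T (cell K p) (cell K τ)) (ten K T (cell K b) (cellId K f')) := by
  rw [ver_cell, ver_cell] at h
  have h := cell_injective K h
  simp only [cellId, ten_cell, ver_cell, ← T.map₂_comp, Category.id_comp, Category.comp_id, h]

section
variable [Bicategory.Strict C]

theorem hor_cell_cellId_one {X Y : C} {f g : X ⟶ Y} (η : f ⟶ g) :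
    hor K (cell K η) (cellId K (𝟙 Y)) = cell K η := by
  rw [hor_cell_cellId, cell_whiskerRight_identity _ (.id _)]

theorem hor_cellId_one_cell {X Y : C} {f g : X ⟶ Y} (η : f ⟶ g) :
    hor K (cellId K (𝟙 X)) (cell K η) = cell K η := by
  rw [hor_cellId_cell, cell_whiskerLeft_identity (.id _)]

/-- By interchange an endomorphism of an identity 1-morphism slides past every 2-morphism; in a
strict 2-category whiskering with that identity leaves no trace. -/
theorem ver_hor_endo_left {X Y : C} {f g : X ⟶ Y} (η : f ⟶ g) (ω : 𝟙 X ⟶ 𝟙 X) :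
    ver K (hor K (cell K ω) (cellId K f)) (cell K η) =
      ver K (cell K η) (hor K (cell K ω) (cellId K g)) := by
  have h := ver_hor_exchange (K := K) ω η
  rw [hor_cellId_one_cell] at h
  exact h

theorem ver_hor_endo_right {X Y : C} {f g : X ⟶ Y} (η : f ⟶ g) (ω : 𝟙 Y ⟶ 𝟙 Y) :
    ver K (hor K (cellId K f) (cell K ω)) (cell K η) =
      ver K (cell K η) (hor K (cellId K g) (cell K ω)) := by
  have h := ver_hor_exchange (K := K) η ω
  rw [hor_cell_cellId_one] at h
  exact h.symm

/-- Commutators with whiskering are derivations: the two occurrences of ω' at the middle object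
cancel, and those of ω and ω'' slide past Θ. -/
theorem delta_hor_endo {X Y Z : C} {F : X ⟶ Y} {F' : Y ⟶ Z} {H : X ⟶ Z} (Θ : F ≫ F' ⟶ H)
    (ω : 𝟙 X ⟶ 𝟙 X) (ω' : 𝟙 Y ⟶ 𝟙 Y) (ω'' : 𝟙 Z ⟶ 𝟙 Z) :
    ver K (hor K (hor K (cellId K F) (cell K ω') - hor K (cell K ω) (cellId K F)) (cellId K F'))
        (cell K Θ) -
      ver K (cell K Θ) (hor K (cellId K H) (cell K ω'') - hor K (cell K ω) (cellId K H)) +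
      ver K (hor K (cellId K F) (hor K (cellId K F') (cell K ω'') -
        hor K (cell K ω') (cellId K F'))) (cell K Θ) = 0 := by
  simp only [map_sub, LinearMap.sub_apply]
  rw [← ver_hor_endo_left, ← ver_hor_endo_right, hor_assoc, hor_assoc, hor_cellId_cellId,
    ← hor_assoc (cellId K F) (cellId K F'), hor_cellId_cellId]
  abel

end

end
end CellCalculus
-- Interaction of `⊗̂` with cells tensored by identities.
section TensorCalculus
variable {K : Type uK} [CommRing K] {C : Type u} [Bicategory.{w, v} C] [Bicategory.Strict C]
  [∀ X Y : C, Preadditive (X ⟶ Y)] [∀ X Y : C, Linear K (X ⟶ Y)] [LinearComposition K C]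
  {T : TensorFunctor C} [T.IsBilinear K] {A : AssociatorCells T} {S : SemigroupalStructure T A}
open SemigroupalData

theorem SemigroupalData.cell_eval₂_congr (φ : S.DoubleCochain 0 1) {X X' Y Y' P P' Q Q' : C}
    {f : X ⟶ X'} {g : Y ⟶ Y'} {p : P ⟶ P'} {q : Q ⟶ Q'} (hX : X = P) (hX' : X' = P') (hf : HEq f p)
    (hY : Y = Q) (hY' : Y' = Q') (hg : HEq g q) :
    cell K (eval₂ φ f g) = cell K (eval₂ φ p q) := by
  subst hX hX' hY hY'
  obtain rfl := eq_of_heq hf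
  obtain rfl := eq_of_heq hg
  rfl

namespace SemigroupalStructure

variable (S)

/-- Naturality of `⊗̂` with identities in three of its four arguments; the three variants below move
the nontrivial argument. -/
theorem ver_tensorCell_cellId_left {X X' X'' Y Y' Y'' : C} (f : X ⟶ X') (f' : X' ⟶ X'')
    {g : Y ⟶ Y'} {g' : Y' ⟶ Y''} (a : g ⟶ g) :
    ver K (S.tensorCell K f g f' g')
        (ten K T (cellId K (f ≫ f')) (hor K (cell K a) (cellId K g'))) =
      ver K (hor K (ten K T (cellId K f) (cell K a)) (cellId K (T.map f' g')))
        (S.tensorCell K f g f' g') := by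
  rw [← hor_cellId_cellId, ← ten_cellId]
  exact S.tensorComp_naturality_cell _ _ _ _

theorem ver_tensorCell_cellId_left' {X X' X'' Y Y' Y'' : C} (f : X ⟶ X') (f' : X' ⟶ X'')
    {g : Y ⟶ Y'} {g' : Y' ⟶ Y''} (a : g' ⟶ g') :
    ver K (S.tensorCell K f g f' g')
        (ten K T (cellId K (f ≫ f')) (hor K (cellId K g) (cell K a))) =
      ver K (hor K (cellId K (T.map f g)) (ten K T (cellId K f') (cell K a)))
        (S.tensorCell K f g f' g') := by
  rw [← hor_cellId_cellId, ← ten_cellId]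
  exact S.tensorComp_naturality_cell _ _ _ _

theorem ver_tensorCell_cellId_right {X X' X'' Y Y' Y'' : C} {f : X ⟶ X'} {f' : X' ⟶ X''}
    (g : Y ⟶ Y') (g' : Y' ⟶ Y'') (a : f ⟶ f) :
    ver K (S.tensorCell K f g f' g')
        (ten K T (hor K (cell K a) (cellId K f')) (cellId K (g ≫ g'))) =
      ver K (hor K (ten K T (cell K a) (cellId K g)) (cellId K (T.map f' g')))
        (S.tensorCell K f g f' g') := by
  rw [← hor_cellId_cellId, ← ten_cellId]
  exact S.tensorComp_naturality_cell _ _ _ _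

theorem ver_tensorCell_cellId_right' {X X' X'' Y Y' Y'' : C} {f : X ⟶ X'} {f' : X' ⟶ X''}
    (g : Y ⟶ Y') (g' : Y' ⟶ Y'') (a : f' ⟶ f') :
    ver K (S.tensorCell K f g f' g')
        (ten K T (hor K (cellId K f) (cell K a)) (cellId K (g ≫ g'))) =
      ver K (hor K (cellId K (T.map f g)) (ten K T (cell K a) (cellId K g')))
        (S.tensorCell K f g f' g') := by
  rw [← hor_cellId_cellId, ← ten_cellId]
  exact S.tensorComp_naturality_cell _ _ _ _

/-- Tensoring an expression of the shape of δ_h with an identity on the left gives an expression of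
the same shape, with constraint `⊗̂` followed by 1 ⊗ Θ. This is the outer face in δ_h δ_v = δ_v δ_h.
-/
theorem tensorComp_delta_left {X X' X'' Y Y' Y'' : C} (f : X ⟶ X') (f' : X' ⟶ X'')
    {g : Y ⟶ Y'} {g' : Y' ⟶ Y''} {h : Y ⟶ Y''} (a : g ⟶ g) (b : g' ⟶ g') (Θ : g ≫ g' ⟶ h)
    (c : h ⟶ h) :
    ver K (S.tensorCell K f g f' g') (ten K T (cellId K (f ≫ f'))
        (ver K (hor K (cell K a) (cellId K g')) (cell K Θ) - ver K (cell K Θ) (cell K c) +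
          ver K (hor K (cellId K g) (cell K b)) (cell K Θ))) =
      ver K (hor K (ten K T (cellId K f) (cell K a)) (cellId K (T.map f' g')))
        (ver K (S.tensorCell K f g f' g') (ten K T (cellId K (f ≫ f')) (cell K Θ))) -
      ver K (ver K (S.tensorCell K f g f' g') (ten K T (cellId K (f ≫ f')) (cell K Θ)))
        (ten K T (cellId K (f ≫ f')) (cell K c)) +
      ver K (hor K (cellId K (T.map f g)) (ten K T (cellId K f') (cell K b)))
        (ver K (S.tensorCell K f g f' g') (ten K T (cellId K (f ≫ f')) (cell K Θ))) := by
  rw [← ver_assoc (hor K _ (cellId K (T.map f' g'))), ← ver_tensorCell_cellId_left, ver_assoc,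
    ← ver_assoc (hor K (cellId K (T.map f g)) _), ← ver_tensorCell_cellId_left', ver_assoc,
    ver_assoc, ver_ten_cellId_left, hor_cell_cellId, hor_cellId_cell, ver_ten_cellId_left,
    ver_ten_cellId_left, ver_cell, ver_cell, ver_cell]
  simp only [map_add, map_sub]

theorem tensorComp_delta_right {X X' X'' Y Y' Y'' : C} {f : X ⟶ X'} {f' : X' ⟶ X''} {h : X ⟶ X''}
    (g : Y ⟶ Y') (g' : Y' ⟶ Y'') (a : f ⟶ f) (b : f' ⟶ f') (Θ : f ≫ f' ⟶ h) (c : h ⟶ h) :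
    ver K (S.tensorCell K f g f' g') (ten K T
        (ver K (hor K (cell K a) (cellId K f')) (cell K Θ) - ver K (cell K Θ) (cell K c) +
          ver K (hor K (cellId K f) (cell K b)) (cell K Θ)) (cellId K (g ≫ g'))) =
      ver K (hor K (ten K T (cell K a) (cellId K g)) (cellId K (T.map f' g')))
        (ver K (S.tensorCell K f g f' g') (ten K T (cell K Θ) (cellId K (g ≫ g')))) -
      ver K (ver K (S.tensorCell K f g f' g') (ten K T (cell K Θ) (cellId K (g ≫ g'))))
        (ten K T (cell K c) (cellId K (g ≫ g'))) +
      ver K (hor K (cellId K (T.map f g)) (ten K T (cell K b) (cellId K g')))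
        (ver K (S.tensorCell K f g f' g') (ten K T (cell K Θ) (cellId K (g ≫ g')))) := by
  rw [← ver_assoc (hor K _ (cellId K (T.map f' g'))), ← ver_tensorCell_cellId_right, ver_assoc,
    ← ver_assoc (hor K (cellId K (T.map f g)) _), ← ver_tensorCell_cellId_right', ver_assoc,
    ver_assoc, ver_ten_cellId_right, hor_cell_cellId, hor_cellId_cell, ver_ten_cellId_right,
    ver_ten_cellId_right, ver_cell, ver_cell, ver_cell]
  simp only [map_add, map_sub, LinearMap.add_apply, LinearMap.sub_apply]

theorem tensorCell_assoc {X X' X'' X''' Y Y' Y'' Y''' : C} (f : X ⟶ X')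
    (g : Y ⟶ Y') (f' : X' ⟶ X'') (g' : Y' ⟶ Y'') (f'' : X'' ⟶ X''') (g'' : Y'' ⟶ Y''') :
    ver K (hor K (S.tensorCell K f g f' g') (cellId K (T.map f'' g'')))
        (S.tensorCell K (f ≫ f') (g ≫ g') f'' g'') =
      ver K (hor K (cellId K (T.map f g)) (S.tensorCell K f' g' f'' g''))
        (S.tensorCell K f g (f' ≫ f'') (g' ≫ g'')) := by
  have h := congrArg (cell K) (S.tensorComp_assoc f g f' g' f'' g'')
  rw [cell_identity_comp (.associator_hom _ _ _), cell_comp_comp_identity _ _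
    (.map₂ T (.associator_hom _ _ _) (.associator_hom _ _ _)), ← ver_cell, ← ver_cell,
    ← hor_cell_cellId, ← hor_cellId_cell] at h
  exact h

variable {S} (hS : S.IsGray)

namespace IsGray
include hS

/-- Naturality of `⊗̂` for ω and an identity: the relevant instances of `⊗̂` have an identity pair
and disappear. The three variants below compare `phi` with the outer faces of δ_v in the same way.
-/
theorem hor_cellId_ten_right {X X' Y Y' : C} (f : X ⟶ X') (g : Y ⟶ Y') (ω : 𝟙 X' ⟶ 𝟙 X') :
    ten K T (hor K (cellId K f) (cell K ω)) (cellId K g) =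
      hor K (cellId K (T.map f g)) (ten K T (cell K ω) (cellId K (𝟙 Y'))) := by
  have h := S.tensorComp_naturality_cell (K := K) (𝟙 f) (𝟙 g) ω (𝟙 (𝟙 Y'))
  have hΘ := tensorComp_isIdentityTwo_of_right S hS.tensorId f g (.id X') (.id Y')
  rw [hor_cellId_cell, hor_cellId_cellId, ten_cell, ten_cellId, ten_cell, hor_cellId_cell,
    ver_cell, ver_cell, cell_identity_comp hΘ, cell_comp_identity _ hΘ, ← ten_cell, ← hor_cellId_cell,
    ← hor_cellId_cell, ← ten_cell] at h
  exact (congrArg (ten K T _ ·) (cellId_comp_identity (K := K) g (.id _)).symm).trans h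

theorem hor_cellId_ten_left {X X' Y Y' : C} (f : X ⟶ X') (g : Y ⟶ Y') (ω : 𝟙 Y' ⟶ 𝟙 Y') :
    ten K T (cellId K f) (hor K (cellId K g) (cell K ω)) =
      hor K (cellId K (T.map f g)) (ten K T (cellId K (𝟙 X')) (cell K ω)) := by
  have h := S.tensorComp_naturality_cell (K := K) (𝟙 f) (𝟙 g) (𝟙 (𝟙 X')) ω
  have hΘ := tensorComp_isIdentityTwo_of_right S hS.tensorId f g (.id X') (.id Y')
  rw [hor_cellId_cellId (K := K) f (𝟙 X'), hor_cellId_cell, ten_cell, ten_cellId, ten_cell, hor_cellId_cell,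
    ver_cell, ver_cell, cell_identity_comp hΘ, cell_comp_identity _ hΘ, ← ten_cell, ← hor_cellId_cell,
    ← hor_cellId_cell, ← ten_cell] at h
  exact (congrArg (ten K T · _) (cellId_comp_identity (K := K) f (.id _)).symm).trans h

theorem hor_ten_cellId_right {X X' Y Y' : C} (f : X ⟶ X') (g : Y ⟶ Y') (ω : 𝟙 X ⟶ 𝟙 X) :
    ten K T (hor K (cell K ω) (cellId K f)) (cellId K g) =
      hor K (ten K T (cell K ω) (cellId K (𝟙 Y))) (cellId K (T.map f g)) := by
  have h := S.tensorComp_naturality_cell (K := K) ω (𝟙 (𝟙 Y)) (𝟙 f) (𝟙 g)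
  have hΘ := tensorComp_isIdentityTwo_of_left S hS.tensorId (.id X) (.id Y) f g
  rw [hor_cell_cellId, hor_cellId_cellId, ten_cell, ten_cellId, ten_cell, hor_cell_cellId,
    ver_cell, ver_cell, cell_identity_comp hΘ, cell_comp_identity _ hΘ, ← ten_cell, ← hor_cell_cellId,
    ← hor_cell_cellId, ← ten_cell] at h
  exact (congrArg (ten K T _ ·) (cellId_identity_comp (K := K) (.id _) g).symm).trans h

theorem hor_ten_cellId_left {X X' Y Y' : C} (f : X ⟶ X') (g : Y ⟶ Y') (ω : 𝟙 Y ⟶ 𝟙 Y) :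
    ten K T (cellId K f) (hor K (cell K ω) (cellId K g)) =
      hor K (ten K T (cellId K (𝟙 X)) (cell K ω)) (cellId K (T.map f g)) := by
  have h := S.tensorComp_naturality_cell (K := K) (𝟙 (𝟙 X)) ω (𝟙 f) (𝟙 g)
  have hΘ := tensorComp_isIdentityTwo_of_left S hS.tensorId (.id X) (.id Y) f g
  rw [hor_cellId_cellId (K := K) (𝟙 X) f, hor_cell_cellId, ten_cell, ten_cellId, ten_cell, hor_cell_cellId,
    ver_cell, ver_cell, cell_identity_comp hΘ, cell_comp_identity _ hΘ, ← ten_cell, ← hor_cell_cellId,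
    ← hor_cell_cellId, ← ten_cell] at h
  exact (congrArg (ten K T · _) (cellId_identity_comp (K := K) (.id _) f).symm).trans h

end IsGray
end SemigroupalStructure
end TensorCalculus
-- Coboundaries are special; the horizontal differential squares to zero.
section Coboundaries
variable {K : Type uK} [CommRing K] {C : Type u} [Bicategory.{w, v} C] [Bicategory.Strict C]
  [∀ X Y : C, Preadditive (X ⟶ Y)] [∀ X Y : C, Linear K (X ⟶ Y)] [LinearComposition K C]
  {T : TensorFunctor C} [T.IsBilinear K] {A : AssociatorCells T} {S : SemigroupalStructure T A}
open SemigroupalData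

namespace SemigroupalStructure.IsGray
variable (hS : S.IsGray) {ψ : S.DoubleCochain 0 1} (ω : S.PentCochain 2)

include hS in
theorem delta_mem_specialCochains (hψ : ψ ∈ (S.tens 1).specialCochains K 0) :
    (S.tens 1).delta K 0 ψ ∈ (S.tens 1).specialCochains K 1 := by
  obtain ⟨hn, h₁⟩ := mem_specialCochains_eval₂.1 hψ
  refine mem_specialCochains_evalComp₂.2 ⟨fun {X X' X'' Y Y' Y'' f₁ f₂ g₁ g₂ f₁' f₂' g₁' g₂'}
    τ σ τ' σ' => ?_, fun {X X' Y Y'} f g => ?_, fun {X X' Y Y'} f g => ?_⟩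
  · have e₁ := ver_hor_cellId_right_comm (K := K) (T.map₂ τ' σ')
      (by simpa only [ten_cell] using hn τ σ)
    have e₂ := ver_hor_cellId_left_comm (K := K) (T.map₂ τ σ)
      (by simpa only [ten_cell] using hn τ' σ')
    have e₃ := hn (hcomp τ τ') (hcomp σ σ')
    rw [← ten_cell, ← ten_cell] at e₁ e₂
    rw [← hor_cell, ← hor_cell] at e₃
    rw [cell_delta_zero_one, cell_delta_zero_one]
    simp only [map_add, map_sub, LinearMap.add_apply, LinearMap.sub_apply]
    rw [ver_assoc, ver_assoc, ver_assoc, S.tensorComp_naturality_cell, e₃,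
      ← ver_assoc (hor K (cell K _) _), ← ver_assoc (hor K (cellId K _) _), e₁, e₂,
      ← ver_assoc (cell K _), S.tensorComp_naturality_cell, ver_assoc, ver_assoc, ver_assoc]
  -- On a pair followed by identities, two of the three terms of δ_h cancel and the third is ψ on
  -- identities.
  · have hΘ := tensorComp_isIdentityTwo_of_right S hS.tensorId f g (.id X') (.id Y')
    have e : cell K (eval₂ ψ (f ≫ 𝟙 X') (g ≫ 𝟙 Y')) = cell K (eval₂ ψ f g) := by
      rw [Strict.comp_id, Strict.comp_id]
    rw [cell_delta_zero_one, h₁, map_zero, map_zero, LinearMap.zero_apply, add_zero, hor_cell_cellId,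
      ver_cell, ver_cell, cell_comp_identity _ hΘ, cell_identity_comp hΘ, e,
      cell_whiskerRight_identity _ (.map hS (.id _) (.id _)), sub_self]
  · have hΘ := tensorComp_isIdentityTwo_of_left S hS.tensorId (.id X) (.id Y) f g
    have e : cell K (eval₂ ψ (𝟙 X ≫ f) (𝟙 Y ≫ g)) = cell K (eval₂ ψ f g) := by
      rw [Strict.id_comp, Strict.id_comp]
    rw [cell_delta_zero_one, h₁, map_zero, LinearMap.zero_apply, map_zero, LinearMap.zero_apply,
      zero_sub, hor_cellId_cell,
      ver_cell, ver_cell, cell_comp_identity _ hΘ, cell_identity_comp hΘ, e,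
      cell_whiskerLeft_identity (.map hS (.id _) (.id _)), neg_add_cancel]

/-- Each face inherits naturality from ψ, after bracketings are matched by associativity of `ten`;
each vanishes on identities because a tensor product of identities is one. -/
theorem deltaV_mem_specialCochains (hψ : ψ ∈ (S.tens 1).specialCochains K 0) :
    hS.deltaV K 0 1 ψ ∈ (S.tens 2).specialCochains K 0 := by
  obtain ⟨hn, h₁⟩ := mem_specialCochains_eval₂.1 hψ
  refine mem_specialCochains_eval₃.2 ⟨fun {X X' Y Y' Z Z' f₁ f₂ g₁ g₂ h₁ h₂} τ σ η => ?_,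
    fun X Y Z => ?_⟩
  · have e₁ := ver_ten_cellId_left_comm (K := K) (T := T) τ
      (by simpa only [ten_cell] using hn σ η)
    have e₂ := hn (T.map₂ τ σ) η
    have e₃ := hn τ (T.map₂ σ η)
    have e₄ := ver_ten_cellId_right_comm (K := K) (T := T) η
      (by simpa only [ten_cell] using hn τ σ)
    rw [← ten_cell] at e₁ e₂ e₃ e₄
    rw [hS.ten_assoc] at e₂ e₄
    rw [cell_deltaV_zero_one, cell_deltaV_zero_one]
    simp only [map_add, map_sub, LinearMap.add_apply, LinearMap.sub_apply]
    rw [e₁, e₂, e₃, e₄]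
  · rw [cell_deltaV_zero_one, h₁, h₁, cell_eval₂_identity hψ (.map hS (.id _) (.id _)) (.id _),
      cell_eval₂_identity hψ (.id _) (.map hS (.id _) (.id _))]
    simp only [map_zero, LinearMap.zero_apply, sub_zero, add_zero]

include hS in
-- Endomorphisms of identities slide past all 2-morphisms, and their commutator with an identity
-- 1-morphism is zero.
theorem phi_mem_specialCochains : S.phi K 2 ω ∈ (S.tens 2).specialCochains K 0 := by
  refine mem_specialCochains_eval₃.2 ⟨fun {X X' Y Y' Z Z' f₁ f₂ g₁ g₂ h₁ h₂} τ σ η => ?_,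
    fun X Y Z => ?_⟩
  · rw [cell_eval₃_phi, cell_eval₃_phi, ten_cell, ten_cell, map_sub, LinearMap.sub_apply, map_sub,
      ver_hor_endo_left, ver_hor_endo_right]
  · have h : IsIdentityOne (T.map (𝟙 X) (T.map (𝟙 Y) (𝟙 Z))) := .map hS (.id _) (.map hS (.id _) (.id _))
    rw [cell_eval₃_phi, hor_cell_cellId, hor_cellId_cell, cell_whiskerLeft_identity h,
      cell_whiskerRight_identity _ h, sub_self]

variable (ψ) in
-- Both halves of δ_h² reduce to ψ on the three factors minus ψ on the total composite, and
-- associativity of `⊗̂` identifies them.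
theorem delta_delta_cell {X X' X'' X''' Y Y' Y'' Y''' : C} (f : X ⟶ X')
    (g : Y ⟶ Y') (f' : X' ⟶ X'') (g' : Y' ⟶ Y'') (f'' : X'' ⟶ X''') (g'' : Y'' ⟶ Y''') :
    ver K (hor K (S.tensorCell K f g f' g') (cellId K (T.map f'' g'')))
        (cell K (evalComp₂ ((S.tens 1).delta K 0 ψ) (f ≫ f') (g ≫ g') f'' g'')) +
      ver K (hor K (cell K (evalComp₂ ((S.tens 1).delta K 0 ψ) f g f' g')) (cellId K (T.map f'' g'')))
        (S.tensorCell K (f ≫ f') (g ≫ g') f'' g'') =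
      ver K (hor K (cellId K (T.map f g)) (S.tensorCell K f' g' f'' g''))
        (cell K (evalComp₂ ((S.tens 1).delta K 0 ψ) f g (f' ≫ f'') (g' ≫ g''))) +
      ver K (hor K (cellId K (T.map f g)) (cell K (evalComp₂ ((S.tens 1).delta K 0 ψ) f' g' f'' g'')))
        (S.tensorCell K f g (f' ≫ f'') (g' ≫ g'')) := by
  have e : cell K (eval₂ ψ ((f ≫ f') ≫ f'') ((g ≫ g') ≫ g'')) =
      cell K (eval₂ ψ (f ≫ f' ≫ f'') (g ≫ g' ≫ g'')) := by
    rw [Strict.assoc, Strict.assoc]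
  rw [cell_delta_zero_one, cell_delta_zero_one, cell_delta_zero_one, cell_delta_zero_one,
    delta_delta_first, delta_delta_last, S.tensorCell_assoc, e, hor_assoc, hor_assoc,
    ← hor_cellId_cellId, ← hor_cellId_cellId, hor_assoc, hor_cellId_cellId]

theorem delta_delta (ψ : S.DoubleCochain 0 1) : (S.tens 1).delta K 1 ((S.tens 1).delta K 0 ψ) = 0 := by
  funext X W c
  refine cell_injective K (Eq.trans ?_ (map_zero (cell K)).symm)
  cases c with
  | cons f'' c =>
    cases c with
    | cons f' c =>
      cases c with
      | single f =>
        refine (S.cell_delta_one_one (K := K) ((S.tens 1).delta K 0 ψ) f.1 f.2 f'.1 f'.2 f''.1 f''.2).trans ?_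
        rw [← sub_eq_zero.2 (delta_delta_cell (K := K) ψ f.1 f.2 f'.1 f'.2 f''.1 f''.2)]
        abel

end SemigroupalStructure.IsGray
end Coboundaries
-- The remaining blocks of the square of the total differential.
section Coboundaries
variable {K : Type uK} [CommRing K] {C : Type u} [Bicategory.{w, v} C] [Bicategory.Strict C]
  [∀ X Y : C, Preadditive (X ⟶ Y)] [∀ X Y : C, Linear K (X ⟶ Y)] [LinearComposition K C]
  {T : TensorFunctor C} [T.IsBilinear K] {A : AssociatorCells T} {S : SemigroupalStructure T A}
open SemigroupalData

namespace SemigroupalStructure.IsGray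
variable (hS : S.IsGray) {ψ : S.DoubleCochain 0 1} (ω : S.PentCochain 2)

theorem delta_phi : (S.tens 2).delta K 0 (S.phi K 2 ω) = 0 := by
  refine DoubleCochain.extComp₃ (K := K) fun {X X' X'' Y Y' Y'' Z Z' Z''} f g h f' g' h' => ?_
  rw [cell_delta_zero_two, cell_eval₃_phi, cell_eval₃_phi, cell_eval₃_phi, tensorCell₃, ten_cell,
    ver_cell, delta_hor_endo]
  exact (map_zero (cell K)).symm

/-- The outer faces preserve the shape of δ_h. For the inner faces the constraint of the face has to
be moved past ψ, which is where naturality of ψ with respect to `⊗̂` enters; `m₁` and `m₂` record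
the result. -/
theorem delta_deltaV (hψ : ψ ∈ (S.tens 1).specialCochains K 0) :
    (S.tens 2).delta K 0 (hS.deltaV K 0 1 ψ) = hS.deltaV K 1 1 ((S.tens 1).delta K 0 ψ) := by
  obtain ⟨hn, -⟩ := mem_specialCochains_eval₂.1 hψ
  refine DoubleCochain.extComp₃ (K := K) fun {X X' X'' Y Y' Y'' Z Z' Z''} f g h f' g' h' => ?_
  have e₁ := S.tensorComp_delta_left (K := K) f f' (eval₂ ψ g h) (eval₂ ψ g' h')
    (S.tensorComp g h g' h').hom (eval₂ ψ (g ≫ g') (h ≫ h'))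
  have e₂ := S.tensorComp_delta_right (K := K) h h' (eval₂ ψ f g) (eval₂ ψ f' g')
    (S.tensorComp f g f' g').hom (eval₂ ψ (f ≫ f') (g ≫ g'))
  have n₁ := hn (𝟙 (f ≫ f')) (S.tensorComp g h g' h').hom
  have n₂ := hn (S.tensorComp f g f' g').hom (𝟙 (h ≫ h'))
  have m₁ : ver K (cell K (evalComp₂ ((S.tens 1).delta K 0 ψ) f (T.map g h) f' (T.map g' h')))
      (ten K T (cellId K (f ≫ f')) (S.tensorCell K g h g' h')) =
      ver K (hor K (cell K (eval₂ ψ f (T.map g h))) (cellId K (T.map f' (T.map g' h'))))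
        (S.tensorCell₃ K f g h f' g' h') -
      ver K (S.tensorCell₃ K f g h f' g' h')
        (cell K (eval₂ ψ (f ≫ f') (T.map (g ≫ g') (h ≫ h')))) +
      ver K (hor K (cellId K (T.map f (T.map g h))) (cell K (eval₂ ψ f' (T.map g' h'))))
        (S.tensorCell₃ K f g h f' g' h') := by
    rw [cell_delta_zero_one]
    simp only [map_add, map_sub, LinearMap.add_apply, LinearMap.sub_apply]
    rw [ver_assoc, ver_assoc, ver_assoc, ver_assoc, n₁]
  have m₂ : ver K (cell K (evalComp₂ ((S.tens 1).delta K 0 ψ) (T.map f g) h (T.map f' g') h'))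
      (ten K T (S.tensorCell K f g f' g') (cellId K (h ≫ h'))) =
      ver K (hor K (cell K (eval₂ ψ (T.map f g) h)) (cellId K (T.map f' (T.map g' h'))))
        (S.tensorCell₃ K f g h f' g' h') -
      ver K (S.tensorCell₃ K f g h f' g' h')
        (cell K (eval₂ ψ (T.map (f ≫ f') (g ≫ g')) (h ≫ h'))) +
      ver K (hor K (cellId K (T.map f (T.map g h))) (cell K (eval₂ ψ (T.map f' g') h')))
        (S.tensorCell₃ K f g h f' g' h') := by
    rw [cell_delta_zero_one, ← hS.tensorCell₃_eq, ← hS.cellId_map_assoc, ← hS.cellId_map_assoc]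
    simp only [map_add, map_sub, LinearMap.add_apply, LinearMap.sub_apply]
    rw [ver_assoc, ver_assoc, ver_assoc, ver_assoc, n₂]
  rw [hS.tensorCell₃_eq, hS.cellId_map_assoc, hS.cellId_map_assoc] at e₂
  rw [cell_delta_zero_two, hS.cell_deltaV_one_one, m₁, m₂, cell_deltaV_zero_one, cell_deltaV_zero_one,
    cell_deltaV_zero_one, cell_delta_zero_one, cell_delta_zero_one, e₁, e₂]
  simp only [map_add, map_sub, LinearMap.add_apply, LinearMap.sub_apply]
  abel

/-- The simplicial cancellation of faces; it needs strict associativity of objects and of `ten`, and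
id ⊗ id = id. -/
theorem deltaPent_deltaPent : hS.deltaPent K 3 (hS.deltaPent K 2 ω) = 0 := by
  refine PentCochain.ext₅ (K := K) fun X Y Z V U => ?_
  have hp {X X' Y Y' Z Z' : C} (hX : X = X') (hY : Y = Y') (hZ : Z = Z') :
      cell K (pent₃ ω X Y Z) = cell K (pent₃ ω X' Y' Z') := by
    rw [hX, hY, hZ]
  have h₁ (X Y : C) : cellId K (𝟙 (T.obj X Y)) = ten K T (cellId K (𝟙 X)) (cellId K (𝟙 Y)) := by
    rw [ten_cellId, hS.map_id]
  rw [hS.cell_deltaPent₃, hS.cell_deltaPent₂, hS.cell_deltaPent₂, hS.cell_deltaPent₂,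
    hS.cell_deltaPent₂, hS.cell_deltaPent₂, hS.cell_deltaPent₂, h₁, h₁]
  simp only [map_add, map_sub, LinearMap.add_apply, LinearMap.sub_apply]
  rw [hS.ten_assoc, hS.ten_assoc, hS.ten_assoc, hp (hS.tensor_assoc X Y Z) rfl rfl,
    hp rfl (hS.tensor_assoc Y Z V) rfl, hp rfl rfl (hS.tensor_assoc Z V U)]
  refine Eq.trans ?_ (map_zero (cell K)).symm
  abel

/-- Inner faces commute with the commutator by definition; for the outer faces whiskering is moved
across the tensor product by naturality of `⊗̂`. -/
theorem deltaV_phi : hS.deltaV K 0 2 (S.phi K 2 ω) = S.phi K 3 (hS.deltaPent K 2 ω) := by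
  refine DoubleCochain.ext₄ (K := K) fun {X X' Y Y' Z Z' W W'} f g h k => ?_
  have h₁ : cellId K (T.map f (T.map (T.map g h) k)) = cellId K (T.map f (T.map g (T.map h k))) := by
    rw [← ten_cellId, hS.cellId_map_assoc, ten_cellId]
  have h₂ : cellId K (T.map (T.map f (T.map g h)) k) = cellId K (T.map f (T.map g (T.map h k))) := by
    rw [hS.cellId_map_assoc, h₁]
  have h₃ : cellId K (T.map (T.map f g) (T.map h k)) = cellId K (T.map f (T.map g (T.map h k))) :=
    hS.cellId_map_assoc _ _ _
  rw [hS.cell_deltaV_zero_two, cell_eval₄_phi, cell_eval₃_phi, cell_eval₃_phi, cell_eval₃_phi,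
    cell_eval₃_phi, cell_eval₃_phi, hS.cell_deltaPent₂, hS.cell_deltaPent₂]
  simp only [map_add, map_sub, LinearMap.add_apply, LinearMap.sub_apply]
  rw [hS.hor_cellId_ten_left, hS.hor_ten_cellId_left, hS.hor_cellId_ten_right,
    hS.hor_ten_cellId_right, h₁, h₂, h₃]
  abel

theorem deltaV_deltaV : hS.deltaV K 0 2 (hS.deltaV K 0 1 ψ) = 0 := by
  refine DoubleCochain.ext₄ (K := K) fun {X X' Y Y' Z Z' W W'} f g h k => ?_
  have h₁ : cell K (eval₂ ψ (T.map (T.map f g) h) k) = cell K (eval₂ ψ (T.map f (T.map g h)) k) :=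
    cell_eval₂_congr ψ (hS.tensor_assoc _ _ _).symm (hS.tensor_assoc _ _ _).symm (hS.map_assoc _ _ _)
      rfl rfl HEq.rfl
  have h₂ : cell K (eval₂ ψ f (T.map (T.map g h) k)) = cell K (eval₂ ψ f (T.map g (T.map h k))) :=
    cell_eval₂_congr ψ rfl rfl HEq.rfl (hS.tensor_assoc _ _ _).symm (hS.tensor_assoc _ _ _).symm
      (hS.map_assoc _ _ _)
  rw [hS.cell_deltaV_zero_two, hS.cell_deltaV_zero_one, hS.cell_deltaV_zero_one,
    hS.cell_deltaV_zero_one, hS.cell_deltaV_zero_one, hS.cell_deltaV_zero_one, ← ten_cellId,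
    ← ten_cellId]
  simp only [map_add, map_sub, LinearMap.add_apply, LinearMap.sub_apply]
  rw [hS.ten_assoc, hS.ten_assoc, hS.ten_assoc, h₁, h₂]
  refine Eq.trans ?_ (map_zero (cell K)).symm
  abel

/-- The signs are arranged so that the blocks cancel in pairs: -δ_v δ_h against δ_h δ_v, and δ_v
`phi` against -`phi` δ_pent. -/
theorem unitaryCoboundaries_le : hS.unitaryCoboundaries K 1 ≤ hS.unitaryCocycles K 2 := by
  rintro _ ⟨x, hx, rfl⟩
  have hψ := mem_unitaryCochains_one_iff.1 hx
  refine Submodule.mem_inf.2 ⟨mem_unitaryCochains_two_iff.2 ⟨?_, ?_⟩, LinearMap.mem_ker.2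
    ((hS.deltaUnit_two_eq_zero_iff _).2 ⟨?_, ?_, ?_, ?_⟩)⟩
  · rw [hS.deltaUnit_one_tensor]
    exact neg_mem (hS.delta_mem_specialCochains hψ)
  · rw [hS.deltaUnit_one_assoc]
    exact add_mem (hS.deltaV_mem_specialCochains hψ) (hS.phi_mem_specialCochains _)
  · rw [hS.deltaUnit_one_tensor, map_neg, delta_delta, neg_zero]
  · rw [hS.deltaUnit_one_tensor, hS.deltaUnit_one_assoc, map_neg, map_add, delta_phi, add_zero,
      hS.delta_deltaV hψ, add_neg_cancel]
  · rw [hS.deltaUnit_one_assoc, hS.deltaUnit_one_pent, map_neg, map_add, hS.deltaV_deltaV,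
      hS.deltaV_phi, zero_add, add_neg_cancel]
  · rw [hS.deltaUnit_one_pent, map_neg, hS.deltaPent_deltaPent, neg_zero]

end SemigroupalStructure.IsGray
end Coboundaries
end GrayDeformation

/-! ### The classification of first order unitary deformations. -/

theorem mainTheorem1 {K : Type uK} [CommRing K] {C : Type u} [Bicategory.{w, v} C]
    [Bicategory.Strict C] [∀ X Y : C, Preadditive (X ⟶ Y)] [∀ X Y : C, Linear K (X ⟶ Y)]
    [LinearComposition K C] {T : TensorFunctor C} [T.IsBilinear K] {A : AssociatorCells T}
    {S : SemigroupalStructure T A} (hS : S.IsGray) :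
    Equivalence (UnitaryDeformation.Equivalent : UnitaryDeformation K S → _ → Prop) ∧
    hS.unitaryCoboundaries K 1 ≤ hS.unitaryCocycles K 2 ∧
    ∃ Φ : Quot (UnitaryDeformation.Equivalent : UnitaryDeformation K S → _ → Prop) ≃
        hS.unitaryCohomology K 1,
      ∀ D : UnitaryDeformation K S, ∃ hD : D.firstOrderTerm hS ∈ hS.unitaryCocycles K 2,
        Φ (Quot.mk _ D) = Submodule.Quotient.mk ⟨D.firstOrderTerm hS, hD⟩ := by
  -- A submodule is closed under negation, so the order of the difference may be reversed to fit the
  -- criterion for equality in a quotient.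
  have hE {D D' : UnitaryDeformation K S} : D.Equivalent D' ↔
      D.firstOrderTerm hS - D'.firstOrderTerm hS ∈ hS.unitaryCoboundaries K 1 := by
    rw [hS.equivalent_iff, ← neg_sub, neg_mem_iff]
  refine ⟨⟨fun D => hE.2 ?_, fun h => hE.2 ?_, fun h h' => hE.2 ?_⟩, hS.unitaryCoboundaries_le, ?_⟩
  · rw [sub_self]
    exact zero_mem _
  · rw [← neg_sub]
    exact neg_mem (hE.1 h)
  · rw [← sub_add_sub_cancel]
    exact add_mem (hE.1 h) (hE.1 h')
  let cls (D : UnitaryDeformation K S) : hS.unitaryCohomology K 1 :=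
    Submodule.Quotient.mk ⟨D.firstOrderTerm hS, D.firstOrderTerm_mem hS⟩
  have hcls (D D' : UnitaryDeformation K S) : cls D = cls D' ↔ D.Equivalent D' :=
    -- Equality of cohomology classes is equivalence of deformations, which gives both
    -- well-definedness and injectivity.
    (Submodule.Quotient.eq _).trans hE.symm
  refine ⟨Equiv.ofBijective (Quot.lift cls fun D D' => (hcls D D').2) ⟨?_, ?_⟩,
    fun D => ⟨D.firstOrderTerm_mem hS, rfl⟩⟩
  · rintro ⟨D⟩ ⟨D'⟩ h
    exact Quot.sound ((hcls D D').1 h)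
  · intro x
    obtain ⟨⟨x, hx⟩, rfl⟩ := Submodule.Quotient.mk_surjective _ x
    obtain ⟨D, rfl⟩ := hS.exists_firstOrderTerm_eq hx
    exact ⟨Quot.mk _ D, rfl⟩
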